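/- **Definitions.** Graphs are simple and may be infinite. A *separation* of a graph $G$ is an ordered pair $(A,B)$ with $A\cup B=V(G)$ and no edge between $A\setminus B$ and $B\setminus A$; its *order* is $|A\cap B|$; $(A,B)\le(C,D)$ means $A\subseteq C$ and $D\subseteq B$. A *profile* of $G$ is a set $P$ of separations of $G$ such that (P1) if $(C,D)\le(A,B)\in P$ then $(D,C)\notin P$, and (P2) if $(A,B),(C,D)\in P$ then $(B\cap D,A\cup C)\notin P$. For $\ell\in\mathbb N\cup\{\aleph_0\}$ it is an *$\ell$-profile* if all its elements have order less than $\ell$ and for every separation $(A,B)$ of $G$ of order less than $\ell$ it contains $(A,B)$ or $(B,A)$. It is *principal* if $\bigcap_{i\in I}(B_i\setminus A_i)\ne\emptyset$ for every non-empty family $((A_i,B_i))_{i\in I}$ in $P$ with $A_i\cap B_i=A_j\cap B_j$ for all $i,j\in I$. It is *robust* if for every $(A,B)\in P$ and every separation $(C,D)$ of finite order: if $(B\cap C,A\cup D)$ and $(B\cap D,A\cup C)$ both have order less than $|A\cap B|$, then they do not both lie in $P$. A separation $(A,B)$ *distinguishes* $P$ and $P'$ if $(A,B)\in P$ and $(B,A)\in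 P'$ or vice versa, and does so *efficiently* if no separation of smaller order distinguishes $P$ and $P'$. A *tree-decomposition* $(T,\mathcal V)$ of $G$ is a tree $T$ with sets $V_t\subseteq V(G)$ $(t\in V(T))$ that cover $V(G)$, such that each edge of $G$ lies in some $V_t$ and $V_{t_1}\cap V_{t_3}\subseteq V_{t_2}$ whenever $t_2$ lies on the $t_1$–$t_3$ path in $T$. The sets $V_s\cap V_t$ with $st\in E(T)$ are its *adhesion sets*; it is *$k$-balanced* if they all have size exactly $k$, and has *adhesion at most $k$* if they all have size at most $k$. An edge $st$ of $T$ *induces* the separation $(\bigcup_{x\in T_1}V_x,\bigcup_{x\in T_2}V_x)$, where $T_1,T_2$ are the components of $T-st$. The *torso* at $t$ is $G[V_t]$ with additional edges between any two vertices that lie in a common adhesion set $V_t\cap V_s$. If $H$ is a graph with $V(H)\subseteq V(G)$, then $(A,B)$ *induces* $(A\cap V(H),B\cap V(H))$ on $H$ if this pair is a separation of $H$; a profile of $G$ induces on $H$ the set of the separations induced by its elements. A *tree of tree-decompositions* of $G$ consists of a tree $T$ with root $r$, graphs $G_t$ $(t\in V(T))$ with $G_r=G$, and tree-decompositions $(T_t,\mathcal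 V_t)$ of $G_t$ such that the graphs assigned to the children of a node $t$ (its neighbours farther from $r$) are the torsos of $(T_t,\mathcal V_t)$ at distinct nodes of $T_t$. It *distinguishes* $P$ and $P'$ *efficiently* if for some node $t$ the sets induced by $P$ and $P'$ on $G_t$ are profiles of $G_t$, and some separation of $G_t$ induced by an edge of $T_t$ efficiently distinguishes these two profiles and is itself induced by a separation of $G$ that efficiently distinguishes $P$ and $P'$. The *level* of a node $t$ is $d(t,r)+1$ if $G$ is connected (the empty graph counts as connected), and $d(t,r)$ if $G$ is disconnected. A construction $\psi$ that assigns to each pair $(G,\mathcal P)$ a tree of tree-decompositions of $G$ is *canonical* if it commutes with isomorphisms of pairs: each isomorphism $\varphi:G\to G'$ that maps $\mathcal P$ onto $\mathcal P'$ induces an isomorphism from $\psi(G,\mathcal P)$ to $\psi(G',\mathcal P')$ that acts on vertices of the graphs as $\varphi$, in a way that respects identities and composition. **Theorem.** There is a canonical construction $\psi$ such that for every graph $G$ and every set $\mathcal P$ of pairwise distinguishable, robust, principal profiles of $G$, each of which is an $\ell$-profile for some $\ell\in\mathbb N\cup\{\aleph_0\}$, the tree of tree-decompositions $\psi(G,\mathcal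 P)=((T,r),(G_t)_{t\in V(T)},(T_t,\mathcal V_t)_{t\in V(T)})$ satisfies the following. 1. It distinguishes any two distinct elements of $\mathcal P$ efficiently. 2. If $t$ has level $2k$, then $(T_t,\mathcal V_t)$ is $k$-balanced. 3. If $t$ has level $2k$, then the children of $t$ correspond bijectively to the nodes of $T_t$, and the graphs assigned to them are the torsos at these nodes. 4. If $t$ has level $2k+1$, then $(T_t,\mathcal V_t)$ has adhesion at most $k$. 5. If $t$ has level $2k+1$, then $t$ has at most one child. -/

import Mathlib

universe u

namespace TreeOfTD

/-- A graph whose vertex set is a subset of `V`: a subgraph of the complete graph on `V`. -/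
abbrev GraphIn (V : Type u) := (⊤ : SimpleGraph V).Subgraph

/-- A simple graph on `V`, regarded as a graph with vertex set all of `V`. -/
def whole {V : Type u} (G : SimpleGraph V) : GraphIn V := SimpleGraph.toSubgraph G le_top

section Separations

variable {V : Type u}

/-- `(A, B)` is a separation of `H`: the sides cover the vertex set and there is no edge between
`A \ B` and `B \ A`. -/
def IsSeparation (H : GraphIn V) (p : Set V × Set V) : Prop :=
  p.1 ∪ p.2 = H.verts ∧ ∀ a ∈ p.1 \ p.2, ∀ b ∈ p.2 \ p.1, ¬ H.Adj a b

/-- The order of `(A, B)` is the size of `A ∩ B`. -/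
noncomputable def order (p : Set V × Set V) : ℕ∞ := (p.1 ∩ p.2).encard

/-- `(A, B) ≤ (C, D)` if `A ⊆ C` and `D ⊆ B`. -/
def SepLE (p q : Set V × Set V) : Prop := p.1 ⊆ q.1 ∧ q.2 ⊆ p.2

/-- Profiles of `H`: consistent sets of separations of `H` that satisfy (P2). -/
structure IsProfile (H : GraphIn V) (P : Set (Set V × Set V)) : Prop where
  isSeparation : ∀ p ∈ P, IsSeparation H p
  consistent : ∀ p q, IsSeparation H p → IsSeparation H q → SepLE q p → p ∈ P → q.swap ∉ P
  corner : ∀ p ∈ P, ∀ q ∈ P, (p.2 ∩ q.2, p.1 ∪ q.1) ∉ P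

/-- `ℓ`-profiles; the value `ℓ = ⊤` stands for `ℓ = ℵ₀`. -/
structure IsProfileOfOrder (H : GraphIn V) (ℓ : ℕ∞) (P : Set (Set V × Set V)) : Prop where
  isProfile : IsProfile H P
  order_lt : ∀ p ∈ P, order p < ℓ
  mem_or_mem : ∀ p, IsSeparation H p → order p < ℓ → p ∈ P ∨ p.swap ∈ P

/-- For all families in `P` with a common separator, the strict right sides have a common
vertex. -/
def IsPrincipal (P : Set (Set V × Set V)) : Prop :=
  ∀ F ⊆ P, F.Nonempty → (∀ p ∈ F, ∀ q ∈ F, p.1 ∩ p.2 = q.1 ∩ q.2) →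
    (⋂ p ∈ F, p.2 \ p.1).Nonempty

def IsRobustFor (H : GraphIn V) (n : ℕ) (P : Set (Set V × Set V)) : Prop :=
  ∀ p ∈ P, ∀ q, IsSeparation H q → order q ≤ n →
    order (p.2 ∩ q.1, p.1 ∪ q.2) < order p → order (p.2 ∩ q.2, p.1 ∪ q.1) < order p →
    ¬ ((p.2 ∩ q.1, p.1 ∪ q.2) ∈ P ∧ (p.2 ∩ q.2, p.1 ∪ q.1) ∈ P)

def IsRobust (H : GraphIn V) (P : Set (Set V × Set V)) : Prop :=
  ∀ n : ℕ, IsRobustFor H n P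

def Distinguishes (p : Set V × Set V) (P P' : Set (Set V × Set V)) : Prop :=
  (p ∈ P ∧ p.swap ∈ P') ∨ (p.swap ∈ P ∧ p ∈ P')

def DistinguishesEfficiently (p : Set V × Set V) (P P' : Set (Set V × Set V)) : Prop :=
  Distinguishes p P P' ∧ ∀ q, Distinguishes q P P' → order p ≤ order q

/-- The pair of vertex sets that `(A, B)` leaves on the vertex set of `H`. -/
def restrict (H : GraphIn V) (p : Set V × Set V) : Set V × Set V :=
  (p.1 ∩ H.verts, p.2 ∩ H.verts)

/-- The set of separations of `H` that are induced by the elements of `P`. -/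
def induced (H : GraphIn V) (P : Set (Set V × Set V)) : Set (Set V × Set V) :=
  {q | IsSeparation H q ∧ ∃ p ∈ P, q = restrict H p}

end Separations

/-- Tree-decompositions of `H`. -/
structure TreeDecomposition {V : Type u} (H : GraphIn V) where
  Node : Type u
  tree : SimpleGraph Node
  isTree : tree.IsTree
  part : Node → Set V
  iUnion_part : ⋃ t, part t = H.verts
  exists_of_adj : ∀ x y, H.Adj x y → ∃ t, x ∈ part t ∧ y ∈ part t
  inter_subset : ∀ (t₁ t₃ : Node) (w : tree.Walk t₁ t₃), w.IsPath →
    ∀ t₂ ∈ w.support, part t₁ ∩ part t₃ ⊆ part t₂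

namespace TreeDecomposition

variable {V : Type u} {H : GraphIn V}

/-- The union of the parts in the component of `T - st` that contains `s`. -/
def side (D : TreeDecomposition H) (s t : D.Node) : Set V :=
  ⋃ x ∈ {x | (D.tree.deleteEdges {s(s, t)}).Reachable s x}, D.part x

/-- `p` is a separation induced by an edge of the decomposition tree (in either direction). -/
def Induces (D : TreeDecomposition H) (p : Set V × Set V) : Prop :=
  ∃ s t, D.tree.Adj s t ∧ p = (D.side s t, D.side t s)

/-- All adhesion sets have size at most `k`. -/
def AdhesionLE (D : TreeDecomposition H) (k : ℕ) : Prop :=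
  ∀ s t, D.tree.Adj s t → (D.part s ∩ D.part t).encard ≤ k

/-- All adhesion sets have size exactly `k`. -/
def IsBalanced (D : TreeDecomposition H) (k : ℕ) : Prop :=
  ∀ s t, D.tree.Adj s t → (D.part s ∩ D.part t).encard = k

/-- The torso of the part at `t`: the subgraph induced by the part, together with all edges between
distinct vertices in a common adhesion set `V_t ∩ V_s`, where `s` is a neighbour of `t`. -/
def torso (D : TreeDecomposition H) (t : D.Node) : GraphIn V where
  verts := D.part t
  Adj x y := x ≠ y ∧ x ∈ D.part t ∧ y ∈ D.part t ∧
    (H.Adj x y ∨ ∃ s, D.tree.Adj t s ∧ x ∈ D.part s ∧ y ∈ D.part s)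
  adj_sub h := h.1
  edge_vert h := h.2.1
  symm := ⟨fun _ _ h => ⟨h.1.symm, h.2.2.1, h.2.1,
    h.2.2.2.imp (fun a => a.symm) (fun ⟨s, a, b, c⟩ => ⟨s, a, c, b⟩)⟩⟩

end TreeDecomposition

/-- `s` is a neighbour of `t` on the next level of the tree `T` with root `r`. -/
def IsChild {N : Type u} (T : SimpleGraph N) (r t s : N) : Prop :=
  T.Adj t s ∧ T.dist r s = T.dist r t + 1

/-- Trees of tree-decompositions of `G`. The graphs assigned to the children of `t` are the torsos
of distinct nodes of the decomposition tree at `t`: the child `s` belongs to the node `place t s`. -/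
structure TreeOfTreeDecompositions {V : Type u} (G : SimpleGraph V) where
  Node : Type u
  tree : SimpleGraph Node
  isTree : tree.IsTree
  root : Node
  graph : Node → GraphIn V
  decomp : ∀ t, TreeDecomposition (graph t)
  graph_root : graph root = whole G
  place : ∀ t s, IsChild tree root t s → (decomp t).Node
  place_injective : ∀ t s s' (h : IsChild tree root t s) (h' : IsChild tree root t s'),
    place t s h = place t s' h' → s = s'
  graph_child : ∀ t s (h : IsChild tree root t s), graph s = (decomp t).torso (place t s h)

namespace TreeOfTreeDecompositions

variable {V : Type u} {G : SimpleGraph V}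

open Classical in
/-- The level of a node: the root has level `1` if any two vertices of `G` are joined by a path,
and level `0` if `G` is disconnected. -/
noncomputable def level (D : TreeOfTreeDecompositions G) (t : D.Node) : ℕ :=
  D.tree.dist D.root t + if G.Preconnected then 1 else 0

/-- Some node `t` has an induced separation `q` of `G_t` that efficiently distinguishes the profiles
of `G_t` induced by `P` and `P'`, and `q` is itself induced by a separation `p` of `G` that
efficiently distinguishes `P` and `P'`. -/
def DistinguishesEfficiently (D : TreeOfTreeDecompositions G)
    (P P' : Set (Set V × Set V)) : Prop :=
  ∃ t : D.Node,
    IsProfile (D.graph t) (induced (D.graph t) P) ∧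
    IsProfile (D.graph t) (induced (D.graph t) P') ∧
    ∃ q, (D.decomp t).Induces q ∧
      TreeOfTD.DistinguishesEfficiently q
        (induced (D.graph t) P) (induced (D.graph t) P') ∧
      ∃ p, IsSeparation (whole G) p ∧ q = restrict (D.graph t) p ∧
        TreeOfTD.DistinguishesEfficiently p P P'

/-- An isomorphism of trees of tree-decompositions lying over a bijection `φ` of the vertex sets. -/
structure IsoOver {W : Type u} {G' : SimpleGraph W} (φ : V ≃ W)
    (D : TreeOfTreeDecompositions G) (D' : TreeOfTreeDecompositions G') where
  onTree : D.tree ≃g D'.tree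
  map_root : onTree D.root = D'.root
  map_verts : ∀ t, (D'.graph (onTree t)).verts = φ '' (D.graph t).verts
  map_adj : ∀ t x y, (D'.graph (onTree t)).Adj (φ x) (φ y) ↔ (D.graph t).Adj x y
  onDecomp : ∀ t, (D.decomp t).tree ≃g (D'.decomp (onTree t)).tree
  map_part : ∀ t x, (D'.decomp (onTree t)).part (onDecomp t x) = φ '' (D.decomp t).part x
  map_place : ∀ t s (h : IsChild D.tree D.root t s)
    (h' : IsChild D'.tree D'.root (onTree t) (onTree s)),
    onDecomp t (D.place t s h) = D'.place (onTree t) (onTree s) h'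

/-- The map that an isomorphism induces on all nodes of all decomposition trees. It determines the
isomorphism. -/
def IsoOver.nodeMap {W : Type u} {G' : SimpleGraph W} {φ : V ≃ W}
    {D : TreeOfTreeDecompositions G} {D' : TreeOfTreeDecompositions G'} (f : IsoOver φ D D') :
    (Σ t : D.Node, (D.decomp t).Node) → (Σ t : D'.Node, (D'.decomp t).Node) :=
  fun x => ⟨f.onTree x.1, f.onDecomp x.1 x.2⟩

end TreeOfTreeDecompositions

/-- A pair `(G, Ps)` of a graph and a set of sets of separations. -/
structure ProfiledGraph where
  V : Type u
  graph : SimpleGraph V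
  profiles : Set (Set (Set V × Set V))

/-- Isomorphisms of pairs `(G, Ps)`: graph isomorphisms that map the one set of profiles onto the
other. -/
structure ProfiledGraph.Iso (X Y : ProfiledGraph.{u}) where
  toIso : X.graph ≃g Y.graph
  map_profiles : Y.profiles =
    (fun P => (fun p : Set X.V × Set X.V => (toIso '' p.1, toIso '' p.2)) '' P) '' X.profiles

/-- A construction of trees of tree-decompositions from pairs `(G, Ps)` is canonical if it commutes
with the isomorphisms of pairs: every isomorphism `φ : (G, Ps) → (G', Ps')` induces an isomorphism
over `φ` between the objects constructed from the two pairs, and this is compatible with identities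
and with composition. -/
def IsCanonical (ψ : ∀ X : ProfiledGraph.{u}, TreeOfTreeDecompositions X.graph) : Prop :=
  ∃ L : ∀ (X Y : ProfiledGraph.{u}) (φ : X.Iso Y),
      TreeOfTreeDecompositions.IsoOver φ.toIso.toEquiv (ψ X) (ψ Y),
    (∀ X (φ : X.Iso X), (∀ v, φ.toIso v = v) → (L X X φ).nodeMap = id) ∧
    ∀ X Y Z (φ : X.Iso Y) (χ : Y.Iso Z) (ω : X.Iso Z),
      (∀ v, ω.toIso v = χ.toIso (φ.toIso v)) →
        (L X Z ω).nodeMap = (L Y Z χ).nodeMap ∘ (L X Y φ).nodeMap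

end TreeOfTD

/-! Let H be a graph in which no two of the profiles under consideration are distinguished by a
separation of order less than k. A principal profile of sufficiently large order chooses, for every
X of size k, one component of H - X (`RPProfile.exists_comp`). If two profiles choose distinct
components, both components are full: every vertex of X has a neighbour in them
(`ProfileFamily.full_of_ne`), since otherwise a smaller separator would do. Distinguishing
separators of size k are thus minimal separators of pairs of vertices. Even in an infinite graph two
vertices have only finitely many minimal separators of a given finite size, so each such separator
is crossed by finitely many others. For every pair of profiles take all distinguishing separators
with the minimum number of crossings. No choice is made, and uncrossing at opposite corners lowers
the number of crossings (`ncard_crossers_corner_lt`), so the separators obtained are nested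
(`ProfileFamily.not_separates_optimalSeps`).

These separators may leave components that are not full. Such components are pairwise disjoint and
avoid all the chosen separators, and they have fewer than k neighbours. A star splits them off; this
is an odd level. In the torso at its centre, the core, all components are full, and the nested
separators become nodes of a tree whose other nodes are blocks: coherent choices of a component for
each separator. All its adhesion sets are separators of size exactly k; this is an even level. Two
profiles either choose different components at some separator, and then an edge of the tree
distinguishes them, or their common choice is a block, and both live in its torso
(`Invariant.induces_or_lives`).

To pass to torsos, separations of a torso are lifted to G with the same separator, so a profile that
lives in the torso induces a robust principal profile there (`Lives.rpProfile_induced`). Conversely,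
an efficient distinguisher may cut an adhesion set and then leaves no separation of the torso.
Robustness of a profile living behind that adhesion set allows it to be uncrossed without raising
its order (`exists_uncrossed`). Hence torsos of the block tree satisfy the same hypothesis with k +
1 (`Invariant.torso`), and any two profiles, being distinguished by some separation of finite order,
are separated after finitely many levels. Canonicity holds because all nodes are labelled by sets
and functions defined from the graph and its profiles. -/

namespace TreeOfTD

/-! ### Components of H - X and finiteness of minimal separators. -/

section Components

variable {V : Type u} {H : GraphIn V} {X Y Z C D : Set V} {u v w : V}

/-- `C` is closed under adjacency in `H - X`. -/
def ClosedOff (H : GraphIn V) (X C : Set V) : Prop :=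
  ∀ a ∈ C, ∀ b, H.Adj a b → b ∉ X → b ∈ C

/-- The component of `H - X` that contains `v`. -/
def conn (H : GraphIn V) (X : Set V) (v : V) : Set V :=
  {w | ∀ C, ClosedOff H X C → v ∈ C → w ∈ C}

theorem mem_conn_self (H : GraphIn V) (X : Set V) (v : V) : v ∈ conn H X v := fun _ _ h => h

theorem conn_subset (hC : ClosedOff H X C) (hv : v ∈ C) : conn H X v ⊆ C := fun _ h => h C hC hv

theorem closedOff_conn (H : GraphIn V) (X : Set V) (v : V) : ClosedOff H X (conn H X v) :=
  fun a ha b hab hb C hC hv => hC a (ha C hC hv) b hab hb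

theorem conn_trans (huv : v ∈ conn H X u) (hvw : w ∈ conn H X v) : w ∈ conn H X u :=
  conn_subset (closedOff_conn H X u) huv hvw

/-- The complement of a closed set, with X removed, is closed again. -/
theorem conn_symm (hu : u ∉ X) (h : v ∈ conn H X u) : u ∈ conn H X v := by
  intro C hC hv
  by_contra huC
  have : ClosedOff H X (Cᶜ \ X) := by
    rintro a ⟨ha, haX⟩ b hab hb
    exact ⟨fun hbC => ha (hC b hbC a hab.symm haX), hb⟩
  exact (h _ this ⟨huC, hu⟩).1 hv

theorem conn_eq (hu : u ∉ X) (h : v ∈ conn H X u) : conn H X v = conn H X u :=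
  Set.Subset.antisymm (fun _ hw => conn_trans h hw) (fun _ hw => conn_trans (conn_symm hu h) hw)

theorem conn_subset_verts_diff (hv : v ∈ H.verts \ X) : conn H X v ⊆ H.verts \ X :=
  conn_subset (fun _ _ _ hab hb => ⟨hab.snd_mem, hb⟩) hv

theorem conn_mono (hXY : X ⊆ Y) : conn H Y v ⊆ conn H X v :=
  conn_subset (fun a ha b hab hb => closedOff_conn H X v a ha b hab fun h => hb (hXY h))
    (mem_conn_self H X v)

/-- A component of `H - X` that avoids `Y` lies in a component of `H - Y`. -/
theorem conn_subset_conn_of_disjoint (h : Disjoint (conn H X v) Y) :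
    conn H X v ⊆ conn H Y v := by
  have : ClosedOff H X (conn H X v ∩ conn H Y v) := by
    rintro a ⟨ha, ha'⟩ b hab hb
    have hb' := closedOff_conn H X v a ha b hab hb
    exact ⟨hb', closedOff_conn H Y v a ha' b hab (fun hbY => Set.disjoint_left.1 h hb' hbY)⟩
  exact fun w hw => (conn_subset this ⟨mem_conn_self _ _ _, mem_conn_self _ _ _⟩ hw).2

/-- `C` is the vertex set of a component of `H - X`. -/
def IsComp (H : GraphIn V) (X C : Set V) : Prop := ∃ v ∈ H.verts \ X, C = conn H X v

/-- Every vertex of `X` has a neighbour in `C`. -/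
def Full (H : GraphIn V) (X C : Set V) : Prop := ∀ x ∈ X, ∃ c ∈ C, H.Adj c x

theorem IsComp.subset (h : IsComp H X C) : C ⊆ H.verts \ X := by
  obtain ⟨v, hv, rfl⟩ := h
  exact conn_subset_verts_diff hv

theorem IsComp.nonempty (h : IsComp H X C) : C.Nonempty := by
  obtain ⟨v, hv, rfl⟩ := h
  exact ⟨v, mem_conn_self _ _ _⟩

theorem IsComp.eq_conn (h : IsComp H X C) (hv : v ∈ C) : C = conn H X v := by
  obtain ⟨u, hu, rfl⟩ := h
  exact (conn_eq hu.2 hv).symm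

theorem isComp_conn (hv : v ∈ H.verts \ X) : IsComp H X (conn H X v) := ⟨v, hv, rfl⟩

theorem IsComp.closed (h : IsComp H X C) : ClosedOff H X C := by
  obtain ⟨u, hu, rfl⟩ := h
  exact closedOff_conn _ _ _

theorem IsComp.eq_of_mem (h : IsComp H X C) (h' : IsComp H X D) (hv : v ∈ C) (hv' : v ∈ D) :
    C = D := (h.eq_conn hv).trans (h'.eq_conn hv').symm

theorem IsComp.disjoint_sep (h : IsComp H X C) : Disjoint C X :=
  Set.disjoint_left.2 fun _ hv hv' => (h.subset hv).2 hv'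

theorem IsComp.mem_or_of_adj (h : IsComp H X C) (hv : v ∈ C) (ha : H.Adj v w) : w ∈ C ∨ w ∈ X := by
  by_cases hw : w ∈ X
  · exact Or.inr hw
  · exact Or.inl (h.closed v hv w ha hw)

/-- A component of `H - X` that avoids `Y` lies in a component of `H - Y`. -/
theorem IsComp.subset_comp (h : IsComp H X C) (hd : Disjoint C Y) :
    ∃ D, IsComp H Y D ∧ C ⊆ D := by
  obtain ⟨v, hv, rfl⟩ := h
  exact ⟨conn H Y v, ⟨v, ⟨hv.1, Set.disjoint_left.1 hd (mem_conn_self _ _ _)⟩, rfl⟩,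
    conn_subset_conn_of_disjoint hd⟩

theorem IsComp.subset_of_disjoint (h : IsComp H X C) (hd : Disjoint C Y) (hD : IsComp H Y D)
    (hv : v ∈ C) (hv' : v ∈ D) : C ⊆ D := by
  obtain ⟨D', hD', hCD⟩ := h.subset_comp hd
  rwa [hD.eq_of_mem hD' hv' (hCD hv)]

/-- The neighbourhood of a full component of `H - X` that lies in a component of `H - Y`. -/
theorem Full.subset_union (hf : Full H X C) (hD : IsComp H Y D) (hCD : C ⊆ D) : X ⊆ D ∪ Y := by
  intro x hx
  obtain ⟨c, hc, hcx⟩ := hf x hx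
  exact hD.mem_or_of_adj (hCD hc) hcx

theorem IsComp.subset_or_subset {p : Set V × Set V} (hp : IsSeparation H p) (h : IsComp H X C)
    (hd : Disjoint C (p.1 ∩ p.2)) : C ⊆ p.1 \ p.2 ∨ C ⊆ p.2 \ p.1 := by
  obtain ⟨v, hv, rfl⟩ := h
  have key : ∀ a ∈ conn H X v, a ∈ p.1 \ p.2 ∨ a ∈ p.2 \ p.1 := by
    intro a ha
    have h1 : a ∈ p.1 ∪ p.2 := hp.1 ▸ (conn_subset_verts_diff hv ha).1
    have h2 := Set.disjoint_left.1 hd ha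
    simp only [Set.mem_union, Set.mem_inter_iff, Set.mem_sdiff] at *
    tauto
  rcases key v (mem_conn_self _ _ _) with h1 | h1
  · left
    have : ClosedOff H X (conn H X v ∩ (p.1 \ p.2)) := by
      rintro a ⟨ha, ha'⟩ b hab hb
      have hb' := closedOff_conn H X v a ha b hab hb
      exact ⟨hb', (key b hb').resolve_right fun hb2 => hp.2 a ha' b hb2 hab⟩
    exact fun w hw => (conn_subset this ⟨mem_conn_self _ _ _, h1⟩ hw).2
  · right
    have : ClosedOff H X (conn H X v ∩ (p.2 \ p.1)) := by
      rintro a ⟨ha, ha'⟩ b hab hb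
      have hb' := closedOff_conn H X v a ha b hab hb
      exact ⟨hb', (key b hb').resolve_left fun hb2 => hp.2 b hb2 a ha' hab.symm⟩
    exact fun w hw => (conn_subset this ⟨mem_conn_self _ _ _, h1⟩ hw).2

/-- `(V(H) \ C, C ∪ X)`. -/
def compSep (H : GraphIn V) (X C : Set V) : Set V × Set V := (H.verts \ C, C ∪ X)

theorem isSeparation_compSep (hX : X ⊆ H.verts) (hC : IsComp H X C) :
    IsSeparation H (compSep H X C) := by
  refine ⟨?_, ?_⟩
  · ext v
    have h1 := @hX v
    have h2 : v ∈ C → _ := fun h => hC.subset h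
    simp only [compSep, Set.mem_union, Set.mem_sdiff] at *
    tauto
  · rintro a ⟨⟨ha1, ha2⟩, ha3⟩ b ⟨hb1, hb2⟩ hab
    have hb : b ∈ C := by
      by_contra h
      exact hb2 ⟨hab.snd_mem, h⟩
    rcases hC.mem_or_of_adj hb hab.symm with h | h
    · exact ha2 h
    · exact ha3 (Or.inr h)

theorem compSep_inter (hX : X ⊆ H.verts) (hC : IsComp H X C) :
    (compSep H X C).1 ∩ (compSep H X C).2 = X := by
  ext v
  have h1 := @hX v
  have h2 : v ∈ C → _ := fun h => hC.subset h
  simp only [compSep, Set.mem_union, Set.mem_sdiff, Set.mem_inter_iff] at *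
  tauto

theorem order_compSep (hX : X ⊆ H.verts) (hC : IsComp H X C) :
    order (compSep H X C) = X.encard := by
  rw [order, compSep_inter hX hC]

/-- If `v` lies in the component of `u`, then a finite set of vertices witnesses this. -/
theorem exists_finite_witness (hv : v ∈ conn H Y u) :
    ∃ Q : Set V, Q.Finite ∧ ∀ Z, Y ⊆ Z → v ∉ conn H Z u → ∃ q ∈ Q, q ∈ Z ∧ q ∉ Y := by
  -- The vertices with a finite witness form a closed set containing u, which plays the role of
  -- following a path: a step from a to b adds b to the witness.
  refine hv {v | ∃ Q : Set V, Q.Finite ∧ ∀ Z, Y ⊆ Z → v ∉ conn H Z u → ∃ q ∈ Q, q ∈ Z ∧ q ∉ Y}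
    ?_ ⟨∅, Set.finite_empty, fun Z _ h => absurd (mem_conn_self H Z u) h⟩
  rintro a ⟨Q, hQ, h⟩ b hab hb
  refine ⟨insert b Q, hQ.insert b, fun Z hYZ hbZ => ?_⟩
  by_cases hbz : b ∈ Z
  · exact ⟨b, Set.mem_insert _ _, hbz, hb⟩
  · have : a ∉ conn H Z u := fun ha => hbZ (closedOff_conn H Z u a ha b hab hbz)
    obtain ⟨q, hq, hq'⟩ := h Z hYZ this
    exact ⟨q, Set.mem_insert_of_mem _ hq, hq'⟩

/-- Y is the part of Z already chosen and k the number of vertices still missing. If Y does not yet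
separate u from v, then Z must contain a vertex outside Y of a fixed finite witness, which leaves
finitely many continuations. If Y already separates them, no vertex can be missing: it would have
neighbours in the components of both u and v in H - Z and so join them in H - Y. Fullness is
required towards Z \ Y only, so that it survives when Y grows. -/
theorem finite_minimal_separators_aux (k : ℕ) (Y : Set V) :
    {Z : Set V | Y ⊆ Z ∧ (Z \ Y).encard = k ∧ v ∉ Z ∧ v ∉ conn H Z u ∧
      Full H (Z \ Y) (conn H Z u) ∧ Full H (Z \ Y) (conn H Z v)}.Finite := by
  induction k generalizing Y with
  | zero =>
    refine (Set.finite_singleton Y).subset ?_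
    rintro Z ⟨hYZ, hc, -⟩
    simp only [Nat.cast_zero, Set.encard_eq_zero, Set.sdiff_eq_empty] at hc
    exact Set.Subset.antisymm hc hYZ
  | succ k ih =>
    by_cases hv : v ∈ conn H Y u
    · obtain ⟨Q, hQ, hQ'⟩ := exists_finite_witness hv
      refine (hQ.biUnion fun q _ => ih (insert q Y)).subset ?_
      rintro Z ⟨hYZ, hc, hvZ, hsep, hf, hf'⟩
      obtain ⟨q, hq, hqZ, hqY⟩ := hQ' Z hYZ hsep
      have hsub : Z \ insert q Y ⊆ Z \ Y := Set.sdiff_subset_sdiff_right (Set.subset_insert _ _)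
      refine Set.mem_biUnion hq ⟨Set.insert_subset hqZ hYZ, ?_, hvZ, hsep, fun x hx => hf x (hsub hx),
        fun x hx => hf' x (hsub hx)⟩
      have h1 : Z \ Y = insert q (Z \ insert q Y) := by
        ext z
        simp only [Set.mem_sdiff, Set.mem_insert_iff]
        by_cases hz : z = q
        · subst hz; simp [hqZ, hqY]
        · simp [hz]
      rw [h1, Set.encard_insert_of_notMem (by simp)] at hc
      push_cast at hc
      exact ENat.add_left_injective_of_ne_top ENat.one_ne_top hc
    · convert Set.finite_empty
      rw [Set.eq_empty_iff_forall_notMem]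
      rintro Z ⟨hYZ, hc, hvZ, hsep, hf, hf'⟩
      have hne : (Z \ Y).Nonempty := by
        rw [← Set.encard_ne_zero, hc]
        simp
      obtain ⟨z, hz⟩ := hne
      obtain ⟨a, ha, haz⟩ := hf z hz
      obtain ⟨b, hb, hbz⟩ := hf' z hz
      have h1 := closedOff_conn H Y u a (conn_mono hYZ ha) z haz hz.2
      have h2 := closedOff_conn H Y v b (conn_mono hYZ hb) z hbz hz.2
      exact hv (conn_trans h1 (conn_symm (fun h => hvZ (hYZ h)) h2))

/-- Only finitely many sets of given finite size are minimal separators of two given vertices. -/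
theorem finite_minimal_separators (H : GraphIn V) (k : ℕ) (u v : V) :
    {Z : Set V | Z.encard = k ∧ ∃ C D, IsComp H Z C ∧ IsComp H Z D ∧ C ≠ D ∧ Full H Z C ∧
      Full H Z D ∧ u ∈ C ∧ v ∈ D}.Finite := by
  refine (finite_minimal_separators_aux (H := H) (u := u) (v := v) k ∅).subset ?_
  rintro Z ⟨hc, C, D, hC, hD, hne, hfC, hfD, hu, hv⟩
  have h1 := hC.eq_conn hu
  have h2 := hD.eq_conn hv
  refine ⟨Set.empty_subset _, by simpa using hc, (hD.subset hv).2, ?_, ?_, ?_⟩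
  · rw [← h1]
    exact fun h => hne (hC.eq_of_mem hD h hv)
  · rw [← h1]; exact fun x hx => hfC x hx.1
  · rw [← h2]; exact fun x hx => hfD x hx.1

end Components

/-! ### Crossing of tight separators, and the crossing numbers of corners. -/

section Crossing

variable {V : Type u} {H : GraphIn V} {X Y Z C D E : Set V} {k : ℕ} {p q : Set V × Set V}

/-- Two vertices of `X` lie in distinct components of `H - Z`. -/
def Separates (H : GraphIn V) (Z X : Set V) : Prop :=
  ∃ x ∈ X \ Z, ∃ y ∈ X \ Z, y ∉ conn H Z x

/-- `X` is a set of `k` vertices with at least two full components. -/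
def TightSep (H : GraphIn V) (k : ℕ) (X : Set V) : Prop :=
  X ⊆ H.verts ∧ X.encard = k ∧
    ∃ C D, IsComp H X C ∧ IsComp H X D ∧ C ≠ D ∧ Full H X C ∧ Full H X D

theorem TightSep.finite (h : TightSep H k X) : X.Finite :=
  Set.finite_of_encard_eq_coe h.2.1

/-- If `X` separates `Y`, then `X` meets all full components of `H - Y`. -/
theorem Separates.exists_mem (h : Separates H X Y) (hC : IsComp H Y C) (hf : Full H Y C) :
    ∃ x ∈ X, x ∈ C := by
  by_contra! hcon
  obtain ⟨D, hD, hCD⟩ := hC.subset_comp (Y := X)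
    (Set.disjoint_left.2 fun x hx hx' => hcon x hx' hx)
  have hY := hf.subset_union hD hCD
  obtain ⟨x, hx, y, hy, hxy⟩ := h
  refine hxy ?_
  rw [← hD.eq_conn ((hY hx.1).resolve_right hx.2)]
  exact (hY hy.1).resolve_right hy.2

theorem separates_of_mem (hC : IsComp H Y C) (hD : IsComp H Y D) (hne : C ≠ D) {x y : V}
    (hx : x ∈ X) (hxC : x ∈ C) (hy : y ∈ X) (hyD : y ∈ D) : Separates H Y X := by
  refine ⟨x, ⟨hx, (hC.subset hxC).2⟩, y, ⟨hy, (hD.subset hyD).2⟩, ?_⟩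
  rw [← hC.eq_conn hxC]
  exact fun h => hne (hC.eq_of_mem hD h hyD)

/-- Crossing is symmetric for tight separators, because X has to meet both of two full components of
H - Y. -/
theorem Separates.symm (h : Separates H X Y) (hY : TightSep H k Y) : Separates H Y X := by
  obtain ⟨-, -, C, D, hC, hD, hne, hfC, hfD⟩ := hY
  obtain ⟨x, hx, hxC⟩ := h.exists_mem hC hfC
  obtain ⟨y, hy, hyD⟩ := h.exists_mem hD hfD
  exact separates_of_mem hC hD hne hx hxC hy hyD

/-- The set of the tight separators of size `k` that separate `X`. -/
def crossers (H : GraphIn V) (k : ℕ) (X : Set V) : Set (Set V) :=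
  {Z | TightSep H k Z ∧ Separates H Z X}

/-- A tight separator that crosses X is a minimal separator of two vertices of X, and X has finitely
many pairs of vertices. -/
theorem finite_crossers (hX : TightSep H k X) : (crossers H k X).Finite := by
  refine (hX.finite.biUnion fun x _ => hX.finite.biUnion fun y _ =>
    finite_minimal_separators H k x y).subset ?_
  rintro Z ⟨hZ, hs⟩
  have hs' := hs.symm hX
  obtain ⟨-, hk, C, D, hC, hD, hne, hfC, hfD⟩ := hZ
  obtain ⟨x, hx, hxC⟩ := hs'.exists_mem hC hfC
  obtain ⟨y, hy, hyD⟩ := hs'.exists_mem hD hfD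
  simp only [Set.mem_iUnion]
  exact ⟨x, hx, y, hy, hk, C, D, hC, hD, hne, hfC, hfD, hxC, hyD⟩

/-- The separator of the corner separation `(A ∪ C, B ∩ D)`. -/
def corner (p q : Set V × Set V) : Set V := (p.1 ∪ q.1) ∩ (p.2 ∩ q.2)

theorem corner_comm (p q : Set V × Set V) : corner p q = corner q p := by
  rw [corner, corner, Set.union_comm, Set.inter_comm p.2]

/-- The sides of `p` contain full components of the separator of `p`. -/
structure TightSides (H : GraphIn V) (p : Set V × Set V) : Prop where
  isSeparation : IsSeparation H p
  left : ∃ C, IsComp H (p.1 ∩ p.2) C ∧ Full H (p.1 ∩ p.2) C ∧ C ⊆ p.1 \ p.2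
  right : ∃ C, IsComp H (p.1 ∩ p.2) C ∧ Full H (p.1 ∩ p.2) C ∧ C ⊆ p.2 \ p.1

theorem IsSeparation.swap (h : IsSeparation H p) : IsSeparation H p.swap :=
  ⟨by rw [← h.1]; exact Set.union_comm _ _, fun a ha b hb hab => h.2 b hb a ha hab.symm⟩

theorem TightSides.swap (h : TightSides H p) : TightSides H p.swap := by
  have e : p.swap.1 ∩ p.swap.2 = p.1 ∩ p.2 := Set.inter_comm _ _
  refine ⟨h.isSeparation.swap, ?_, ?_⟩
  · rw [e]; exact h.right
  · rw [e]; exact h.left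

/-- By symmetry E would separate the separator of p, and hence meet the full component on the left
of p. -/
theorem not_separates_of_subset (hp : TightSides H p) (hE : TightSep H k E) (hEp : E ⊆ p.2) :
    ¬ Separates H (p.1 ∩ p.2) E := by
  intro h
  obtain ⟨C, hC, hf, hCs⟩ := hp.left
  obtain ⟨x, hx, hxC⟩ := (h.symm hE).exists_mem hC hf
  exact (hCs hxC).2 (hEp hx)

/-- Write X and Y for the separators of p and q. The corner lies in X ∪ Y and meets two full
components K and L of H - Z. The only problem is a vertex e of X in K and a vertex of Y in L. Unless
Z separates Y, the component K avoids Y and lies strictly right of q. As Y crosses X, some x in X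
lies strictly left of q. It is not in Z, all of whose vertices have neighbours in K, and not in K;
so Z separates e from x. -/
theorem separates_or_of_separates_corner (hq : TightSides H q)
    (hX : TightSep H k (p.1 ∩ p.2)) (hE : TightSep H k (corner p q))
    (hcross : Separates H (q.1 ∩ q.2) (p.1 ∩ p.2)) (hZ : TightSep H k Z)
    (h : Separates H Z (corner p q)) :
    Separates H Z (p.1 ∩ p.2) ∨ Separates H Z (q.1 ∩ q.2) := by
  by_contra! hcon
  obtain ⟨h1, h2⟩ := hcon
  have h' := h.symm hE
  obtain ⟨-, -, K, L, hK, hL, hne, hfK, hfL⟩ := hZ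
  obtain ⟨e, he, heK⟩ := h'.exists_mem hK hfK
  obtain ⟨f, hf, hfL'⟩ := h'.exists_mem hL hfL
  have key : ∀ K L, IsComp H Z K → IsComp H Z L → K ≠ L → Full H Z K → ∀ e f, e ∈ corner p q →
      f ∈ corner p q → e ∈ K → f ∈ L → e ∈ p.1 ∩ p.2 → f ∈ q.1 ∩ q.2 → False := by
    intro K L hK hL hne hfK e f he hf heK hfL heX hfY
    obtain ⟨M, hM, hfM, hMs⟩ := hq.left
    obtain ⟨x, hx, hxM⟩ := (hcross.symm hX).exists_mem hM hfM
    have hKY : Disjoint K (q.1 ∩ q.2) := Set.disjoint_left.2 fun y hy hy' =>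
      h2 (separates_of_mem hK hL hne hy' hy hfY hfL)
    have heq : e ∈ q.2 \ q.1 := ⟨he.2.2, fun h => Set.disjoint_left.1 hKY heK ⟨h, he.2.2⟩⟩
    have hKs : K ⊆ q.2 \ q.1 := (hK.subset_or_subset hq.isSeparation hKY).resolve_left
      fun h => (h heK).2 heq.1
    have hxq := hMs hxM
    have hxZ : x ∉ Z := by
      intro hxZ
      obtain ⟨c, hc, hcx⟩ := hfK x hxZ
      exact hq.isSeparation.2 x hxq c (hKs hc) hcx.symm
    have hxK : x ∉ K := fun h => (hKs h).2 hxq.1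
    refine h1 ⟨e, ⟨heX, (hK.subset heK).2⟩, x, ⟨hx, hxZ⟩, ?_⟩
    rw [← hK.eq_conn heK]
    exact hxK
  have hcov : ∀ e ∈ corner p q, e ∈ p.1 ∩ p.2 ∨ e ∈ q.1 ∩ q.2 := fun e he =>
    he.1.imp (fun h => ⟨h, he.2.1⟩) (fun h => ⟨h, he.2.2⟩)
  rcases hcov e he with heX | heY <;> rcases hcov f hf with hfX | hfY
  · exact h1 (separates_of_mem hK hL hne heX heK hfX hfL')
  · exact key K L hK hL hne hfK e f he hf heK hfL' heX hfY
  · exact key L K hL hK hne.symm hfL f e hf he hfL' heK hfX heY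
  · exact h2 (separates_of_mem hK hL hne heY heK hfY hfL')

/-- It suffices that both full components of H - Z meet X, the separator of p. If one of them
avoided X, it would contain a corner vertex strictly right of p and lie in a component of H - X on
that side. That component misses Z, as Z lies left of p, so fullness gives Z ⊆ X and, by size, Z =
X. But X does not separate a corner lying on one side of p. -/
theorem separates_of_separates_corner_aux (hp : TightSides H p)
    (hX : TightSep H k (p.1 ∩ p.2)) (hE : TightSep H k (corner p q)) (hZ : TightSep H k Z)
    (hZp : Z ⊆ p.1) (h : Separates H Z (corner p q)) : Separates H Z (p.1 ∩ p.2) := by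
  by_contra h1
  have h' := h.symm hE
  have key : ∀ K, IsComp H Z K → Full H Z K → Disjoint K (p.1 ∩ p.2) → False := by
    intro K hK hfK hd
    obtain ⟨e, he, heK⟩ := h'.exists_mem hK hfK
    have hep : e ∉ p.1 := fun h => Set.disjoint_left.1 hd heK ⟨h, he.2.1⟩
    have hR : IsComp H (p.1 ∩ p.2) (conn H (p.1 ∩ p.2) e) :=
      isComp_conn ⟨(hK.subset heK).1, fun h => hep h.1⟩
    have heR := mem_conn_self H (p.1 ∩ p.2) e
    have hRs := (hR.subset_or_subset hp.isSeparation hR.disjoint_sep).resolve_left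
      fun h => hep (h heR).1
    have hRZ : Disjoint (conn H (p.1 ∩ p.2) e) Z :=
      Set.disjoint_left.2 fun x hx hx' => (hRs hx).2 (hZp hx')
    have hKR := hK.subset_of_disjoint hd hR heK heR
    have hZX : Z ⊆ p.1 ∩ p.2 := fun z hz =>
      (hfK.subset_union hR hKR hz).resolve_left fun h => Set.disjoint_left.1 hRZ h hz
    have hZX' : Z = p.1 ∩ p.2 :=
      hZ.finite.eq_of_subset_of_encard_le hZX (by rw [hX.2.1, hZ.2.1])
    rw [hZX'] at h
    exact not_separates_of_subset hp hE (fun x hx => hx.2.1) h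
  obtain ⟨-, -, K, L, hK, hL, hne, hfK, hfL⟩ := hZ
  by_cases hKd : Disjoint K (p.1 ∩ p.2)
  · exact key K hK hfK hKd
  · by_cases hLd : Disjoint L (p.1 ∩ p.2)
    · exact key L hL hfL hLd
    · obtain ⟨x, hxK, hx⟩ := Set.not_disjoint_iff.1 hKd
      obtain ⟨y, hyL, hy⟩ := Set.not_disjoint_iff.1 hLd
      exact h1 (separates_of_mem hK hL hne hx hxK hy hyL)

theorem subset_or_subset_of_not_separates (hp : IsSeparation H p) (hZ : Z ⊆ H.verts)
    (h : ¬ Separates H (p.1 ∩ p.2) Z) : Z ⊆ p.1 ∨ Z ⊆ p.2 := by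
  by_contra! hcon
  obtain ⟨z, hz, hz1⟩ := Set.not_subset.1 hcon.1
  obtain ⟨y, hy, hy2⟩ := Set.not_subset.1 hcon.2
  have hz2 : z ∈ p.2 := by
    have : z ∈ p.1 ∪ p.2 := hp.1 ▸ hZ hz
    exact this.resolve_left hz1
  have hzX : z ∉ p.1 ∩ p.2 := fun h => hz1 h.1
  have hR : IsComp H (p.1 ∩ p.2) (conn H (p.1 ∩ p.2) z) := isComp_conn ⟨hZ hz, hzX⟩
  have hRs := (hR.subset_or_subset hp hR.disjoint_sep).resolve_left
      fun h => hz1 (h (mem_conn_self _ _ _)).1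
  exact h ⟨z, ⟨hz, hzX⟩, y, ⟨hy, fun h => hy2 h.2⟩, fun h => hy2 (hRs h).1⟩

/-- If Z does not cross the separator of p, it lies on one side of p, and the previous lemma applies
to the corner on the other side. -/
theorem separates_of_separates_corners (hp : TightSides H p)
    (hX : TightSep H k (p.1 ∩ p.2)) (hE : TightSep H k (corner p q))
    (hF : TightSep H k (corner p.swap q.swap)) (hZ : TightSep H k Z)
    (h : Separates H Z (corner p q)) (h' : Separates H Z (corner p.swap q.swap)) :
    Separates H Z (p.1 ∩ p.2) := by
  have e : p.swap.1 ∩ p.swap.2 = p.1 ∩ p.2 := Set.inter_comm _ _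
  by_contra hcon
  rcases subset_or_subset_of_not_separates hp.isSeparation hZ.1 fun h => hcon (h.symm hZ)
    with hs | hs
  · exact hcon (separates_of_separates_corner_aux hp hX hE hZ hs h)
  · have := separates_of_separates_corner_aux hp.swap (e ▸ hX) hF hZ hs h'
    rw [e] at this
    exact hcon this

/-- Opposite corners of crossing separators are crossed less often. -/
theorem ncard_crossers_corner_lt (hp : TightSides H p) (hq : TightSides H q)
    (hX : TightSep H k (p.1 ∩ p.2)) (hY : TightSep H k (q.1 ∩ q.2))
    (hE : TightSep H k (corner p q)) (hF : TightSep H k (corner p.swap q.swap))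
    (hcross : Separates H (q.1 ∩ q.2) (p.1 ∩ p.2)) :
    (crossers H k (corner p q)).ncard + (crossers H k (corner p.swap q.swap)).ncard <
      (crossers H k (p.1 ∩ p.2)).ncard + (crossers H k (q.1 ∩ q.2)).ncard := by
  have ep : p.swap.1 ∩ p.swap.2 = p.1 ∩ p.2 := Set.inter_comm _ _
  have eq : q.swap.1 ∩ q.swap.2 = q.1 ∩ q.2 := Set.inter_comm _ _
  have fX := finite_crossers hX
  have fY := finite_crossers hY
  have fE := finite_crossers hE
  have fF := finite_crossers hF
  -- Counted with multiplicity: whatever crosses one corner crosses one of the two separators, and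
  -- whatever crosses both corners crosses both separators.
  rw [← Set.ncard_union_add_ncard_inter _ _ fE fF, ← Set.ncard_union_add_ncard_inter _ _ fX fY]
  refine add_lt_add_of_lt_of_le (Set.ncard_lt_ncard ?_ (fX.union fY))
    (Set.ncard_le_ncard ?_ (fX.inter_of_left _))
  -- Strictness: the separator of p crosses that of q, but it crosses neither corner, as each corner
  -- lies on one side of p.
  · refine (Set.ssubset_iff_of_subset ?_).2 ⟨p.1 ∩ p.2, Or.inr ⟨hX, hcross.symm hX⟩, ?_⟩
    · rintro Z (⟨hZ, h⟩ | ⟨hZ, h⟩)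
      · exact (separates_or_of_separates_corner hq hX hE hcross hZ h).imp
          (fun h => ⟨hZ, h⟩) (fun h => ⟨hZ, h⟩)
      · have := separates_or_of_separates_corner hq.swap (ep ▸ hX) hF
          (by rwa [ep, eq]) hZ h
        rw [ep, eq] at this
        exact this.imp (fun h => ⟨hZ, h⟩) (fun h => ⟨hZ, h⟩)
    · rintro (⟨-, h⟩ | ⟨-, h⟩)
      · exact not_separates_of_subset hp hE (fun x hx => hx.2.1) h
      · rw [← ep] at h
        exact not_separates_of_subset hp.swap hF (fun x hx => hx.2.1) h
  · rintro Z ⟨⟨hZ, h⟩, -, h'⟩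
    refine ⟨⟨hZ, separates_of_separates_corners hp hX hE hF hZ h h'⟩, hZ, ?_⟩
    rw [corner_comm] at h h' hE hF
    exact separates_of_separates_corners hq hY hE hF hZ h h'

end Crossing

/-! ### Profiles as choices of components, optimal separators, and uncrossing. -/

section Profiles

variable {V : Type u} {H : GraphIn V} {X Y Z C D E : Set V} {k : ℕ} {p q : Set V × Set V}
  {P P' Q Q' : Set (Set V × Set V)} {ℓ ℓ' : ℕ∞}

/-- Robust principal `ℓ`-profiles. -/
structure RPProfile (H : GraphIn V) (ℓ : ℕ∞) (P : Set (Set V × Set V)) : Prop where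
  ofOrder : IsProfileOfOrder H ℓ P
  robust : IsRobust H P
  principal : IsPrincipal P

/-- The separation `(A ∪ C, B ∩ D)`. -/
def sup (p q : Set V × Set V) : Set V × Set V := (p.1 ∪ q.1, p.2 ∩ q.2)

theorem order_sup (p q : Set V × Set V) : order (sup p q) = (corner p q).encard := rfl

theorem order_swap (p : Set V × Set V) : order p.swap = order p := by
  rw [order, order]; congr 1; exact Set.inter_comm _ _

theorem isSeparation_sup (hp : IsSeparation H p) (hq : IsSeparation H q) :
    IsSeparation H (sup p q) := by
  refine ⟨?_, ?_⟩
  · ext v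
    have h1 : v ∈ p.1 ∪ p.2 ↔ v ∈ H.verts := by rw [hp.1]
    have h2 : v ∈ q.1 ∪ q.2 ↔ v ∈ H.verts := by rw [hq.1]
    simp only [sup, Set.mem_union, Set.mem_inter_iff] at *
    tauto
  · rintro a ⟨ha1, ha2⟩ b ⟨hb1, hb2⟩ hab
    simp only [sup, Set.mem_union, Set.mem_inter_iff, not_or, not_and] at *
    have h1 : a ∈ p.1 ∪ p.2 := hp.1 ▸ hab.fst_mem
    have h2 : a ∈ q.1 ∪ q.2 := hq.1 ▸ hab.fst_mem
    by_cases hap : a ∈ p.2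
    · have haq := ha2 hap
      exact hq.2 a ⟨h2.resolve_right haq, haq⟩ b ⟨hb1.2, hb2.2⟩ hab
    · exact hp.2 a ⟨h1.resolve_right hap, hap⟩ b ⟨hb1.1, hb2.1⟩ hab

/-- Submodularity of the order. -/
theorem encard_corner_add_le (p q : Set V × Set V) :
    (corner p q).encard + (corner p.swap q.swap).encard ≤ order p + order q := by
  rw [← Set.encard_union_add_encard_inter, order, order,
    ← Set.encard_union_add_encard_inter (p.1 ∩ p.2)]
  refine add_le_add (Set.encard_le_encard ?_) (Set.encard_le_encard ?_)
  · intro v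
    simp only [corner, Set.mem_union, Set.mem_inter_iff, Prod.fst_swap, Prod.snd_swap]
    tauto
  · intro v
    simp only [corner, Set.mem_union, Set.mem_inter_iff, Prod.fst_swap, Prod.snd_swap]
    tauto

namespace RPProfile

theorem isSeparation (h : RPProfile H ℓ P) (hp : p ∈ P) : IsSeparation H p :=
  h.ofOrder.isProfile.isSeparation p hp

theorem order_lt (h : RPProfile H ℓ P) (hp : p ∈ P) : order p < ℓ := h.ofOrder.order_lt p hp

theorem mem_or_mem (h : RPProfile H ℓ P) (hp : IsSeparation H p) (ho : order p < ℓ) :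
    p ∈ P ∨ p.swap ∈ P := h.ofOrder.mem_or_mem p hp ho

theorem finite (h : RPProfile H ℓ P) (hp : p ∈ P) : (p.1 ∩ p.2).Finite :=
  Set.encard_lt_top_iff.1 ((h.order_lt hp).trans_le le_top)

theorem consistent (h : RPProfile H ℓ P) (hp : p ∈ P) (hq : q.swap ∈ P) (hqp : SepLE q p) :
    False :=
  h.ofOrder.isProfile.consistent p q (h.isSeparation hp)
    (by simpa using (h.isSeparation hq).swap) hqp hp hq

theorem swap_not_mem (h : RPProfile H ℓ P) (hp : p ∈ P) : p.swap ∉ P :=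
  fun hq => h.consistent hp hq ⟨subset_rfl, subset_rfl⟩

theorem mem_of_le (h : RPProfile H ℓ P) (hp : p ∈ P) (hq : IsSeparation H q) (ho : order q < ℓ)
    (hqp : SepLE q p) : q ∈ P :=
  (h.mem_or_mem hq ho).resolve_right fun hq' => h.consistent hp hq' hqp

theorem sup_mem (h : RPProfile H ℓ P) (hp : p ∈ P) (hq : q ∈ P) (ho : order (sup p q) < ℓ) :
    sup p q ∈ P :=
  (h.mem_or_mem (isSeparation_sup (h.isSeparation hp) (h.isSeparation hq)) ho).resolve_right
    (h.ofOrder.isProfile.corner p hp q hq)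

theorem verts_not_subset (h : RPProfile H ℓ P) (hp : p ∈ P) : ¬ H.verts ⊆ p.1 := by
  intro hs
  have hsep := h.isSeparation hp
  refine h.consistent (q := p.swap) hp (by simpa using hp) ⟨?_, ?_⟩
  · exact (Set.subset_union_right.trans hsep.1.subset).trans hs
  · exact (Set.subset_union_right.trans hsep.1.subset).trans hs

/-- Principality enters here. All elements of P with separator X have a common vertex v strictly on
their right. If P pointed away from the component of v, the corresponding separation would belong to
this family and exclude v. -/
theorem exists_comp (h : RPProfile H ℓ P) (hX : X ⊆ H.verts) (hXℓ : X.encard < ℓ) :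
    ∃ C, IsComp H X C ∧ compSep H X C ∈ P := by
  have h0 : IsSeparation H (X, H.verts) :=
    ⟨Set.union_eq_right.2 hX, fun a ha _ _ _ => ha.2 (hX ha.1)⟩
  have h0' : X ∩ H.verts = X := Set.inter_eq_left.2 hX
  have h1 : {p | p ∈ P ∧ p.1 ∩ p.2 = X}.Nonempty := by
    rcases h.mem_or_mem h0 (by rwa [order, h0']) with h1 | h1
    · exact ⟨_, h1, h0'⟩
    · exact ⟨_, h1, (Set.inter_comm _ _).trans h0'⟩
  obtain ⟨v, hv⟩ := h.principal {p | p ∈ P ∧ p.1 ∩ p.2 = X} (fun p hp => hp.1) h1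
    (fun p hp q hq => hp.2.trans hq.2.symm)
  simp only [Set.mem_iInter] at hv
  obtain ⟨p, hp⟩ := h1
  have hvX : v ∈ H.verts \ X := by
    have := hv p hp
    refine ⟨(h.isSeparation hp.1).1 ▸ Or.inr this.1, fun h => this.2 ?_⟩
    rw [← hp.2] at h
    exact h.1
  have hC := isComp_conn hvX
  refine ⟨_, hC, (h.mem_or_mem (isSeparation_compSep hX hC)
    (by rwa [order_compSep hX hC])).resolve_right fun hm => ?_⟩
  have := hv _ ⟨hm, (Set.inter_comm _ _).trans (compSep_inter hX hC)⟩
  exact this.1.2 (mem_conn_self _ _ _)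

/-- Otherwise the supremum of the two separations has all vertices on its left and a separator
inside X, so (P2) would put it into P. -/
theorem not_comp_subset (h : RPProfile H ℓ P) (hC : compSep H X C ∈ P) (hp : p ∈ P)
    (hd : Disjoint C p.2) : False := by
  have hsub : (sup (compSep H X C) p).1 ∩ (sup (compSep H X C) p).2 ⊆
      (compSep H X C).1 ∩ (compSep H X C).2 := by
    rintro v ⟨hv1, hv2, hv3⟩
    refine ⟨⟨(h.isSeparation hC).1 ▸ Or.inr hv2, fun hvC => Set.disjoint_left.1 hd hvC hv3⟩, hv2⟩
  have hm := h.sup_mem hC hp ((Set.encard_le_encard hsub).trans_lt (h.order_lt hC))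
  refine h.verts_not_subset hm fun v hv => ?_
  by_cases hvC : v ∈ C
  · have : v ∈ p.1 ∪ p.2 := (h.isSeparation hp).1 ▸ hv
    exact Or.inr (this.resolve_right (Set.disjoint_left.1 hd hvC))
  · exact Or.inl ⟨hv, hvC⟩

theorem comp_subset (h : RPProfile H ℓ P) (hC : IsComp H X C) (hCP : compSep H X C ∈ P)
    (hp : p ∈ P) (hd : Disjoint C (p.1 ∩ p.2)) : C ⊆ p.2 \ p.1 :=
  (hC.subset_or_subset (h.isSeparation hp) hd).resolve_left fun hs =>
    h.not_comp_subset hCP hp (Set.disjoint_left.2 fun _ hv hv' => (hs hv).2 hv')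

theorem comp_subset_comp (h : RPProfile H ℓ P) (hC : IsComp H X C) (hCP : compSep H X C ∈ P)
    (hY : Y ⊆ H.verts) (hD : IsComp H Y D) (hDP : compSep H Y D ∈ P) (hd : Disjoint C Y) :
    C ⊆ D := by
  have := h.comp_subset hC hCP hDP (by rwa [compSep_inter hY hD])
  intro v hv
  exact (this hv).1.resolve_right (Set.disjoint_left.1 hd hv)

theorem comp_unique (h : RPProfile H ℓ P) (hX : X ⊆ H.verts) (hC : IsComp H X C)
    (hCP : compSep H X C ∈ P) (hD : IsComp H X D) (hDP : compSep H X D ∈ P) : C = D := by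
  obtain ⟨v, hv⟩ := hC.nonempty
  exact hC.eq_of_mem hD hv (h.comp_subset_comp hC hCP hX hD hDP hC.disjoint_sep hv)

theorem compSep_swap_mem (h : RPProfile H ℓ P) (hX : X ⊆ H.verts) (hC : IsComp H X C)
    (hCP : compSep H X C ∈ P) (hD : IsComp H X D) (hne : C ≠ D) : (compSep H X D).swap ∈ P := by
  refine (h.mem_or_mem (isSeparation_compSep hX hD) ?_).resolve_left fun hDP =>
    hne (h.comp_unique hX hC hCP hD hDP)
  have := h.order_lt hCP
  rwa [order_compSep hX hC, ← order_compSep hX hD] at this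

/-- P contains the supremum by (P2), and P' contains its inverse by consistency with `p.swap`. -/
theorem sup_distinguishes (h : RPProfile H ℓ P) (h' : RPProfile H ℓ' P') (hp : p ∈ P)
    (hp' : p.swap ∈ P') (hq : q ∈ P) (ho : order (sup p q) < ℓ) (ho' : order (sup p q) < ℓ') :
    sup p q ∈ P ∧ (sup p q).swap ∈ P' := by
  refine ⟨h.sup_mem hp hq ho,
    (h'.mem_or_mem (isSeparation_sup (h.isSeparation hp) (h.isSeparation hq)) ho').resolve_left
      fun hm => ?_⟩
  exact h'.consistent hm hp' ⟨Set.subset_union_left, Set.inter_subset_left⟩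

end RPProfile

/-- A set of robust principal profiles no two of which are distinguished by a separation of order
less than `k`. -/
structure ProfileFamily (H : GraphIn V) (k : ℕ) (𝓠 : Set (Set (Set V × Set V))) : Prop where
  exists_profile : ∀ P ∈ 𝓠, ∃ ℓ, RPProfile H ℓ P
  le_order : ∀ P ∈ 𝓠, ∀ P' ∈ 𝓠, ∀ q, q ∈ P → q.swap ∈ P' → k ≤ order q

/-- The separators of the separations of order `k` that distinguish `P` and `P'`. -/
def sepSets (k : ℕ) (P P' : Set (Set V × Set V)) : Set (Set V) :=
  {X | ∃ p, p ∈ P ∧ p.swap ∈ P' ∧ p.1 ∩ p.2 = X ∧ X.encard = k}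

theorem sepSets_comm (k : ℕ) (P P' : Set (Set V × Set V)) : sepSets k P P' = sepSets k P' P := by
  have : ∀ P P' : Set (Set V × Set V), sepSets k P P' ⊆ sepSets k P' P := by
    rintro P P' X ⟨p, hp, hp', hX, hk⟩
    exact ⟨p.swap, hp', by simpa using hp, by rw [← hX]; exact Set.inter_comm _ _, hk⟩
  exact Set.Subset.antisymm (this _ _) (this _ _)

/-- The separators of size `k` that distinguish two elements of `𝓠` and are crossed as rarely as
possible by tight separators of size `k`. -/
def optimalSeps (H : GraphIn V) (k : ℕ) (𝓠 : Set (Set (Set V × Set V))) : Set (Set V) :=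
  {X | ∃ P ∈ 𝓠, ∃ P' ∈ 𝓠, X ∈ sepSets k P P' ∧
    ∀ X' ∈ sepSets k P P', (crossers H k X).ncard ≤ (crossers H k X').ncard}

namespace ProfileFamily

variable {𝓠 : Set (Set (Set V × Set V))}

/-- Delete from X the vertices without a neighbour in C. The component C survives, P still points to
it, and P' still points to D and hence away from C. So a separation of order less than k would
distinguish P from P'. -/
theorem full_of_ne (h𝓠 : ProfileFamily H k 𝓠) (hP : P ∈ 𝓠) (hP' : P' ∈ 𝓠) (hX : X ⊆ H.verts)
    (hk : X.encard = k) (hC : IsComp H X C) (hCP : compSep H X C ∈ P) (hD : IsComp H X D)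
    (hDP : compSep H X D ∈ P') (hne : C ≠ D) : Full H X C := by
  obtain ⟨ℓ, hPr⟩ := h𝓠.exists_profile P hP
  obtain ⟨ℓ', hPr'⟩ := h𝓠.exists_profile P' hP'
  intro x hx
  by_contra hcon
  set X' := {y ∈ X | ∃ c ∈ C, H.Adj c y} with hX'
  have hsub : X' ⊆ X := Set.sep_subset _ _
  have hX'H := hsub.trans hX
  have hlt : X'.encard < k := by
    rw [← hk]
    have hfin : X.Finite := Set.finite_of_encard_eq_coe hk
    exact (hfin.subset hsub).encard_lt_encard
      ((Set.ssubset_iff_of_subset hsub).2 ⟨x, hx, fun h => hcon h.2⟩)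
  have hC' : IsComp H X' C := by
    obtain ⟨v, hv⟩ := hC.nonempty
    refine ⟨v, ⟨(hC.subset hv).1, fun h => (hC.subset hv).2 (hsub h)⟩,
      Set.Subset.antisymm ?_ (conn_subset ?_ hv)⟩
    · rw [hC.eq_conn hv]; exact conn_mono hsub
    · intro a ha b hab hb
      exact (hC.mem_or_of_adj ha hab).resolve_right fun hbX => hb ⟨hbX, a, ha, hab⟩
  have hs := isSeparation_compSep hX'H hC'
  have ho : order (compSep H X' C) < k := by rwa [order_compSep hX'H hC']
  have hkℓ : (k : ℕ∞) < ℓ := by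
    have := hPr.order_lt hCP
    rwa [order_compSep hX hC, hk] at this
  have hkℓ' : (k : ℕ∞) < ℓ' := by
    have := hPr'.order_lt hDP
    rwa [order_compSep hX hD, hk] at this
  have h1 : compSep H X' C ∈ P := (hPr.mem_or_mem hs (ho.trans hkℓ)).resolve_right fun hm =>
    hPr.not_comp_subset hCP hm (Set.disjoint_left.2 fun v hv hv' => hv'.2 hv)
  have h2 : (compSep H X' C).swap ∈ P' := (hPr'.mem_or_mem hs (ho.trans hkℓ')).resolve_left
    fun hm => by
      obtain ⟨v, hv⟩ := hD.nonempty
      have := hPr'.comp_subset_comp hD hDP hX'H hC' hm (hD.disjoint_sep.mono_right hsub) hv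
      exact hne (hC.eq_of_mem hD this hv)
  exact absurd (h𝓠.le_order P hP P' hP' _ h1 h2) (not_le.2 ho)

theorem tight (h𝓠 : ProfileFamily H k 𝓠) (hP : P ∈ 𝓠) (hP' : P' ∈ 𝓠) (hp : p ∈ P)
    (hp' : p.swap ∈ P') (hk : order p = k) :
    ∃ C D, IsComp H (p.1 ∩ p.2) C ∧ IsComp H (p.1 ∩ p.2) D ∧ C ≠ D ∧
      Full H (p.1 ∩ p.2) C ∧ Full H (p.1 ∩ p.2) D ∧ C ⊆ p.2 \ p.1 ∧ D ⊆ p.1 \ p.2 ∧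
      compSep H (p.1 ∩ p.2) C ∈ P ∧ compSep H (p.1 ∩ p.2) D ∈ P' := by
  obtain ⟨ℓ, hPr⟩ := h𝓠.exists_profile P hP
  obtain ⟨ℓ', hPr'⟩ := h𝓠.exists_profile P' hP'
  have hX : p.1 ∩ p.2 ⊆ H.verts := fun v hv => (hPr.isSeparation hp).1 ▸ Or.inl hv.1
  obtain ⟨C, hC, hCP⟩ := hPr.exists_comp hX (hPr.order_lt hp)
  obtain ⟨D, hD, hDP⟩ := hPr'.exists_comp hX (by
    have := hPr'.order_lt hp'
    rwa [order_swap] at this)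
  have hCs := hPr.comp_subset hC hCP hp hC.disjoint_sep
  have hDs := hPr'.comp_subset hD hDP hp' (by
    rw [Prod.fst_swap, Prod.snd_swap, Set.inter_comm]; exact hD.disjoint_sep)
  have hne : C ≠ D := by
    rintro rfl
    obtain ⟨v, hv⟩ := hC.nonempty
    exact (hCs hv).2 (hDs hv).1
  exact ⟨C, D, hC, hD, hne, h𝓠.full_of_ne hP hP' hX hk hC hCP hD hDP hne,
    h𝓠.full_of_ne hP' hP hX hk hD hDP hC hCP hne.symm, hCs, hDs, hCP, hDP⟩

theorem tightSep (h𝓠 : ProfileFamily H k 𝓠) (hP : P ∈ 𝓠) (hP' : P' ∈ 𝓠) (hp : p ∈ P)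
    (hp' : p.swap ∈ P') (hk : order p = k) : TightSep H k (p.1 ∩ p.2) := by
  obtain ⟨C, D, hC, hD, hne, hfC, hfD, -⟩ := h𝓠.tight hP hP' hp hp' hk
  obtain ⟨ℓ, hPr⟩ := h𝓠.exists_profile P hP
  exact ⟨fun v hv => (hPr.isSeparation hp).1 ▸ Or.inl hv.1, hk, C, D, hC, hD, hne, hfC, hfD⟩

theorem tightSides (h𝓠 : ProfileFamily H k 𝓠) (hP : P ∈ 𝓠) (hP' : P' ∈ 𝓠) (hp : p ∈ P)
    (hp' : p.swap ∈ P') (hk : order p = k) : TightSides H p := by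
  obtain ⟨C, D, hC, hD, hne, hfC, hfD, hCs, hDs, -⟩ := h𝓠.tight hP hP' hp hp' hk
  obtain ⟨ℓ, hPr⟩ := h𝓠.exists_profile P hP
  exact ⟨hPr.isSeparation hp, ⟨D, hD, hfD, hDs⟩, ⟨C, hC, hfC, hCs⟩⟩

/-- Opposite corners that distinguish pairs of elements of `𝓠` both have order `k`. -/
theorem corner_orders (h𝓠 : ProfileFamily H k 𝓠) {R R' : Set (Set V × Set V)} {p' q' : Set V × Set V}
    (hP : P ∈ 𝓠) (hP' : P' ∈ 𝓠) (hR : R ∈ 𝓠) (hR' : R' ∈ 𝓠)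
    (hp : p ∈ P) (hp' : p.swap ∈ P') (hq : q ∈ P) (hpk : order p = k) (hqk : order q = k)
    (hr : p' ∈ R) (hr' : p'.swap ∈ R') (hs : q' ∈ R)
    (hpq : p' = p.swap ∧ q' = q.swap ∨ p' = q.swap ∧ q' = p.swap) :
    corner p q ∈ sepSets k P P' ∧ corner p.swap q.swap ∈ sepSets k R R' ∧
      TightSep H k (corner p q) ∧ TightSep H k (corner p.swap q.swap) := by
  obtain ⟨ℓ, hPr⟩ := h𝓠.exists_profile P hP
  obtain ⟨ℓ', hPr'⟩ := h𝓠.exists_profile P' hP'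
  obtain ⟨m, hRr⟩ := h𝓠.exists_profile R hR
  obtain ⟨m', hRr'⟩ := h𝓠.exists_profile R' hR'
  have hℓ : (k : ℕ∞) < ℓ := hpk ▸ hPr.order_lt hp
  have hℓ' : (k : ℕ∞) < ℓ' := by rw [← hpk, ← order_swap]; exact hPr'.order_lt hp'
  have hp'k : order p' = k := by
    rcases hpq with ⟨rfl, -⟩ | ⟨rfl, -⟩ <;> rwa [order_swap]
  have hm : (k : ℕ∞) < m := hp'k ▸ hRr.order_lt hr
  have hm' : (k : ℕ∞) < m' := by rw [← hp'k, ← order_swap]; exact hRr'.order_lt hr'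
  have hcor : corner p' q' = corner p.swap q.swap := by
    rcases hpq with ⟨rfl, rfl⟩ | ⟨rfl, rfl⟩
    · rfl
    · exact corner_comm _ _
  have hsum := encard_corner_add_le p q
  rw [hpk, hqk, ← hcor] at hsum
  have h1 : order (sup p q) ≤ k → sup p q ∈ P ∧ (sup p q).swap ∈ P' := fun h =>
    hPr.sup_distinguishes hPr' hp hp' hq (h.trans_lt hℓ) (h.trans_lt hℓ')
  have h2 : order (sup p' q') ≤ k → sup p' q' ∈ R ∧ (sup p' q').swap ∈ R' := fun h =>
    hRr.sup_distinguishes hRr' hr hr' hs (h.trans_lt hm) (h.trans_lt hm')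
  -- The lower bound is available only under the upper bound, since larger corners need not be
  -- oriented by the profiles.
  have h1' : order (sup p q) ≤ k → k ≤ order (sup p q) := fun h =>
    h𝓠.le_order P hP P' hP' _ (h1 h).1 (h1 h).2
  have h2' : order (sup p' q') ≤ k → k ≤ order (sup p' q') := fun h =>
    h𝓠.le_order R hR R' hR' _ (h2 h).1 (h2 h).2
  rw [order_sup] at h1' h2'
  -- The orders add up to at most 2k, so one corner has order at most k, hence exactly k; then the
  -- other one has order at most k as well.
  have h3 : (corner p q).encard = k ∧ (corner p' q').encard = k := by
    have ha : (corner p q).encard ≠ ⊤ := by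
      intro h; rw [h] at hsum; simp at hsum
    have hb : (corner p' q').encard ≠ ⊤ := by
      intro h; rw [h] at hsum; simp at hsum
    lift (corner p q).encard to ℕ using ha with a
    lift (corner p' q').encard to ℕ using hb with b
    norm_cast at *
    omega
  have h4 := h1 h3.1.le
  have h5 := h2 h3.2.le
  have h6 := h𝓠.tightSep hP hP' h4.1 h4.2 h3.1
  have h7 := h𝓠.tightSep hR hR' h5.1 h5.2 h3.2
  exact ⟨⟨_, h4.1, h4.2, rfl, h3.1⟩, hcor ▸ ⟨_, h5.1, h5.2, rfl, h3.2⟩, h6, hcor ▸ h7⟩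

/-- One corner distinguishes P from P', the opposite one Q' from Q, and both have order k. By
minimality they are crossed at least as often as p and q respectively, against
`ncard_crossers_corner_lt`. -/
theorem not_mem_of_separates_aux (h𝓠 : ProfileFamily H k 𝓠)
    (hP : P ∈ 𝓠) (hP' : P' ∈ 𝓠) (hQ : Q ∈ 𝓠) (hQ' : Q' ∈ 𝓠)
    (hp : p ∈ P) (hp' : p.swap ∈ P') (hq : q ∈ Q) (hq' : q.swap ∈ Q')
    (hpk : order p = k) (hqk : order q = k)
    (hpmin : ∀ X' ∈ sepSets k P P', (crossers H k (p.1 ∩ p.2)).ncard ≤ (crossers H k X').ncard)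
    (hqmin : ∀ X' ∈ sepSets k Q Q', (crossers H k (q.1 ∩ q.2)).ncard ≤ (crossers H k X').ncard)
    (hcross : Separates H (q.1 ∩ q.2) (p.1 ∩ p.2)) (h1 : q ∈ P) (h3 : p.swap ∈ Q') : False := by
  have hc := h𝓠.corner_orders hP hP' hQ' hQ hp hp' h1 hpk hqk hq' (by simpa using hq) h3
    (Or.inr ⟨rfl, rfl⟩)
  have := ncard_crossers_corner_lt (h𝓠.tightSides hP hP' hp hp' hpk)
    (h𝓠.tightSides hQ hQ' hq hq' hqk) (h𝓠.tightSep hP hP' hp hp' hpk)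
    (h𝓠.tightSep hQ hQ' hq hq' hqk) hc.2.2.1 hc.2.2.2 hcross
  have h4 := hpmin _ hc.1
  have h5 := hqmin _ (sepSets_comm k Q' Q ▸ hc.2.1)
  omega

/-- Q' orients p in one of two ways; exchanging P and P' reduces one of them to the other. -/
theorem not_mem_of_separates (h𝓠 : ProfileFamily H k 𝓠)
    (hP : P ∈ 𝓠) (hP' : P' ∈ 𝓠) (hQ : Q ∈ 𝓠) (hQ' : Q' ∈ 𝓠)
    (hp : p ∈ P) (hp' : p.swap ∈ P') (hq : q ∈ Q) (hq' : q.swap ∈ Q')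
    (hpk : order p = k) (hqk : order q = k)
    (hpmin : ∀ X' ∈ sepSets k P P', (crossers H k (p.1 ∩ p.2)).ncard ≤ (crossers H k X').ncard)
    (hqmin : ∀ X' ∈ sepSets k Q Q', (crossers H k (q.1 ∩ q.2)).ncard ≤ (crossers H k X').ncard)
    (hcross : Separates H (q.1 ∩ q.2) (p.1 ∩ p.2)) (h1 : q ∈ P) (h2 : q ∈ P') : False := by
  obtain ⟨ℓ, hPr⟩ := h𝓠.exists_profile P hP
  obtain ⟨m, hQr⟩ := h𝓠.exists_profile Q' hQ'
  have hm : (k : ℕ∞) < m := by rw [← hqk, ← order_swap]; exact hQr.order_lt hq'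
  rcases hQr.mem_or_mem (hPr.isSeparation hp) (hpk ▸ hm) with h3 | h3
  · have e : p.swap.1 ∩ p.swap.2 = p.1 ∩ p.2 := Set.inter_comm _ _
    refine h𝓠.not_mem_of_separates_aux (p := p.swap) hP' hP hQ hQ' hp' (by simpa using hp) hq hq'
      (by rwa [order_swap]) hqk ?_ hqmin ?_ h2 (by simpa using h3)
    · rwa [sepSets_comm, e]
    · rwa [e]
  · exact h𝓠.not_mem_of_separates_aux hP hP' hQ hQ' hp hp' hq hq' hpk hqk hpmin hqmin hcross h1 h3

/-- Here both corners distinguish P from P'. Each is crossed at least as often as p, while together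
they are crossed less often than p and q together. -/
theorem ncard_lt_of_separates_aux (h𝓠 : ProfileFamily H k 𝓠)
    (hP : P ∈ 𝓠) (hP' : P' ∈ 𝓠) (hQ : Q ∈ 𝓠) (hQ' : Q' ∈ 𝓠)
    (hp : p ∈ P) (hp' : p.swap ∈ P') (hq : q ∈ Q) (hq' : q.swap ∈ Q')
    (hpk : order p = k) (hqk : order q = k)
    (hpmin : ∀ X' ∈ sepSets k P P', (crossers H k (p.1 ∩ p.2)).ncard ≤ (crossers H k X').ncard)
    (hcross : Separates H (q.1 ∩ q.2) (p.1 ∩ p.2)) (h1 : q ∈ P) (h2 : q.swap ∈ P') :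
    (crossers H k (p.1 ∩ p.2)).ncard < (crossers H k (q.1 ∩ q.2)).ncard := by
  have hc := h𝓠.corner_orders hP hP' hP' hP hp hp' h1 hpk hqk hp' (by simpa using hp) h2
    (Or.inl ⟨rfl, rfl⟩)
  have := ncard_crossers_corner_lt (h𝓠.tightSides hP hP' hp hp' hpk)
    (h𝓠.tightSides hQ hQ' hq hq' hqk) (h𝓠.tightSep hP hP' hp hp' hpk)
    (h𝓠.tightSep hQ hQ' hq hq' hqk) hc.2.2.1 hc.2.2.2 hcross
  have h4 := hpmin _ hc.1
  have h5 := hpmin _ (sepSets_comm k P' P ▸ hc.2.1)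
  omega

theorem ncard_lt_of_separates (h𝓠 : ProfileFamily H k 𝓠)
    (hP : P ∈ 𝓠) (hP' : P' ∈ 𝓠) (hQ : Q ∈ 𝓠) (hQ' : Q' ∈ 𝓠)
    (hp : p ∈ P) (hp' : p.swap ∈ P') (hq : q ∈ Q) (hq' : q.swap ∈ Q')
    (hpk : order p = k) (hqk : order q = k)
    (hpmin : ∀ X' ∈ sepSets k P P', (crossers H k (p.1 ∩ p.2)).ncard ≤ (crossers H k X').ncard)
    (hqmin : ∀ X' ∈ sepSets k Q Q', (crossers H k (q.1 ∩ q.2)).ncard ≤ (crossers H k X').ncard)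
    (hcross : Separates H (q.1 ∩ q.2) (p.1 ∩ p.2)) :
    (crossers H k (p.1 ∩ p.2)).ncard < (crossers H k (q.1 ∩ q.2)).ncard := by
  obtain ⟨ℓ, hPr⟩ := h𝓠.exists_profile P hP
  obtain ⟨ℓ', hPr'⟩ := h𝓠.exists_profile P' hP'
  obtain ⟨m, hQr⟩ := h𝓠.exists_profile Q hQ
  have hℓ : (k : ℕ∞) < ℓ := hpk ▸ hPr.order_lt hp
  have hℓ' : (k : ℕ∞) < ℓ' := by rw [← hpk, ← order_swap]; exact hPr'.order_lt hp'
  have hqs := hQr.isSeparation hq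
  have e : q.swap.1 ∩ q.swap.2 = q.1 ∩ q.2 := Set.inter_comm _ _
  have hqk' : order q.swap = k := by rwa [order_swap]
  rcases hPr.mem_or_mem hqs (hqk ▸ hℓ) with h1 | h1 <;>
    rcases hPr'.mem_or_mem hqs (hqk ▸ hℓ') with h2 | h2
  · exact (h𝓠.not_mem_of_separates hP hP' hQ hQ' hp hp' hq hq' hpk hqk hpmin hqmin hcross
      h1 h2).elim
  · exact h𝓠.ncard_lt_of_separates_aux hP hP' hQ hQ' hp hp' hq hq' hpk hqk hpmin hcross h1 h2
  · have := h𝓠.ncard_lt_of_separates_aux hP hP' hQ' hQ hp hp' hq' (by simpa using hq) hpk hqk'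
      hpmin (by rwa [e]) h1 (by simpa using h2)
    rwa [e] at this
  · refine (h𝓠.not_mem_of_separates hP hP' hQ' hQ hp hp' hq' (by simpa using hq) hpk hqk' hpmin
      ?_ (by rwa [e]) h1 h2).elim
    rwa [sepSets_comm, e]

/-- Of two crossing optimal separators, each would be crossed strictly less often than the other. -/
theorem not_separates_optimalSeps (h𝓠 : ProfileFamily H k 𝓠) (hX : X ∈ optimalSeps H k 𝓠)
    (hY : Y ∈ optimalSeps H k 𝓠) : ¬ Separates H Y X := by
  obtain ⟨P, hP, P', hP', ⟨p, hp, hp', rfl, hpk⟩, hpmin⟩ := hX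
  obtain ⟨Q, hQ, Q', hQ', ⟨q, hq, hq', rfl, hqk⟩, hqmin⟩ := hY
  intro hcross
  have h1 := h𝓠.ncard_lt_of_separates hP hP' hQ hQ' hp hp' hq hq' hpk hqk hpmin hqmin hcross
  have h2 := h𝓠.ncard_lt_of_separates hQ hQ' hP hP' hq hq' hp hp' hqk hpk hqmin hpmin
    (hcross.symm (h𝓠.tightSep hP hP' hp hp' hpk))
  omega

end ProfileFamily

/-- Nested sets of tight separators of size `k` that avoid the components that are not full. -/
structure GoodSeps (H : GraphIn V) (k : ℕ) (N : Set (Set V)) : Prop where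
  tight : ∀ X ∈ N, TightSep H k X
  nested : ∀ X ∈ N, ∀ Y ∈ N, ¬ Separates H X Y
  avoid : ∀ X ∈ N, ∀ K, IsComp H X K → ¬ Full H X K → ∀ Y ∈ N, Disjoint K Y

/-- Every optimal separator has two elements of `𝓠` in distinct components. -/
theorem ProfileFamily.exists_of_mem {𝓠 : Set (Set (Set V × Set V))} (h𝓠 : ProfileFamily H k 𝓠)
    (hX : X ∈ optimalSeps H k 𝓠) : TightSep H k X ∧
    ∃ P ∈ 𝓠, ∃ P' ∈ 𝓠, ∃ C D, IsComp H X C ∧ IsComp H X D ∧ C ≠ D ∧ Full H X C ∧ Full H X D ∧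
      compSep H X C ∈ P ∧ compSep H X D ∈ P' := by
  obtain ⟨P, hP, P', hP', ⟨p, hp, hp', rfl, hpk⟩, hpmin⟩ := hX
  obtain ⟨C, D, hC, hD, hne, hfC, hfD, -, -, hCP, hDP⟩ := h𝓠.tight hP hP' hp hp' hpk
  exact ⟨h𝓠.tightSep hP hP' hp hp' hpk, P, hP, P', hP', C, D, hC, hD, hne, hfC, hfD, hCP, hDP⟩

/-- For the avoidance of non-full components, suppose that such a component K of H - X contains a
vertex y of Y. Two profiles choose distinct full components E and F of H - Y. If E avoided X, the
profile choosing E would choose at X the component containing E; this is K, because y has a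
neighbour in E. But some profile chooses another component at X, so K would be full. Thus E meets X,
likewise F does, and Y separates X against nestedness. -/
theorem ProfileFamily.goodSeps {𝓠 : Set (Set (Set V × Set V))} (h𝓠 : ProfileFamily H k 𝓠) :
    GoodSeps H k (optimalSeps H k 𝓠) := by
  refine ⟨fun X hX => (h𝓠.exists_of_mem hX).1,
    fun X hX Y hY => h𝓠.not_separates_optimalSeps hY hX, fun X hX K hK hnf Y hY => ?_⟩
  by_contra hnd
  obtain ⟨y, hyK, hyY⟩ := Set.not_disjoint_iff.1 hnd
  obtain ⟨hXt, P, hP, P', hP', C, D, hC, hD, hne, -, -, hCP, hDP⟩ := h𝓠.exists_of_mem hX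
  obtain ⟨hYt, Q, hQ, Q', hQ', E, F, hE, hF, hne', hfE, hfF, hEQ, hFQ⟩ := h𝓠.exists_of_mem hY
  have key : ∀ Q ∈ 𝓠, ∀ E, IsComp H Y E → Full H Y E → compSep H Y E ∈ Q → Disjoint E X →
      False := by
    intro Q hQ E hE hfE hEQ hd
    obtain ⟨m, hQr⟩ := h𝓠.exists_profile Q hQ
    have hm : (k : ℕ∞) < m := by
      have := hQr.order_lt hEQ
      rwa [order_compSep hYt.1 hE, hYt.2.1] at this
    obtain ⟨L, hL, hLQ⟩ := hQr.exists_comp hXt.1 (hXt.2.1 ▸ hm)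
    have hEL := hQr.comp_subset_comp hE hEQ hXt.1 hL hLQ hd
    obtain ⟨e, he, hey⟩ := hfE y hyY
    have hLK : L = K := hL.eq_of_mem hK (hL.closed e (hEL he) y hey (hK.subset hyK).2) hyK
    subst hLK
    rcases ne_or_eq L C with h | h
    · exact hnf (h𝓠.full_of_ne hQ hP hXt.1 hXt.2.1 hL hLQ hC hCP h)
    · exact hnf (h𝓠.full_of_ne hQ hP' hXt.1 hXt.2.1 hL hLQ hD hDP (h ▸ hne))
  by_cases hEd : Disjoint E X
  · exact key Q hQ E hE hfE hEQ hEd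
  · by_cases hFd : Disjoint F X
    · exact key Q' hQ' F hF hfF hFQ hFd
    · obtain ⟨x, hxE, hx⟩ := Set.not_disjoint_iff.1 hEd
      obtain ⟨z, hzF, hz⟩ := Set.not_disjoint_iff.1 hFd
      exact h𝓠.not_separates_optimalSeps hX hY (separates_of_mem hE hF hne' hx hxE hz hzF)

/-- Uncrossing of a separation that distinguishes `P` and `P'` with a separation on the far side of
which a robust profile lives. -/
theorem exists_uncrossed {𝓁 : ℕ∞} {s : Set V × Set V} (hP : RPProfile H ℓ P)
    (hP' : RPProfile H ℓ' P') (hQ : RPProfile H 𝓁 Q) (hs : s ∈ P) (hs' : s ∈ P')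
    (hsQ : s.swap ∈ Q) (hPQ : ∀ q, q ∈ P → q.swap ∈ Q → order s ≤ order q)
    (hp : p ∈ P) (hp' : p.swap ∈ P') :
    ∃ p', p' ∈ P ∧ p'.swap ∈ P' ∧ order p' ≤ order p ∧
      p'.1 ∩ p'.2 ⊆ ((p.1 ∩ p.2) ∪ (s.1 ∩ s.2)) ∩ s.2 := by
  have hfs := hP.finite hs
  have hsum1 := encard_corner_add_le s p
  have hsum2 := encard_corner_add_le s p.swap
  rw [Prod.swap_swap, order_swap p] at hsum2
  have cancel : ∀ a b : ℕ∞, a + b ≤ order s + order p → order s ≤ b → a ≤ order p := by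
    intro a b h1 h2
    have h3 : order s + a ≤ order s + order p := by
      rw [add_comm]; exact (add_le_add_right h2 a).trans h1
    exact (ENat.add_le_add_iff_left (Set.encard_ne_top_iff.2 hfs)).1 h3
  -- If one of the two corners on the left of s has order at least that of s, the opposite corner
  -- has order at most that of p by submodularity. It lies on the right of s and distinguishes P
  -- from P'.
  by_cases ha : order s ≤ (corner s.swap p.swap).encard
  · have h1 : order (sup s p) ≤ order p := cancel _ _ hsum1 ha
    have h2 := order_swap p ▸ hP'.order_lt hp'
    have e : sup s p = sup p s := by
      rw [sup, sup, Set.union_comm, Set.inter_comm s.2]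
    rw [e] at h1
    obtain ⟨h3, h4⟩ := hP.sup_distinguishes hP' hp hp' hs (h1.trans_lt (hP.order_lt hp))
      (h1.trans_lt h2)
    refine ⟨_, h3, h4, h1, ?_⟩
    rintro v ⟨hv1, hv2, hv3⟩
    exact ⟨hv1.imp (fun h => ⟨h, hv2⟩) (fun h => ⟨h, hv3⟩), hv3⟩
  · by_cases hb : order s ≤ (corner s.swap p).encard
    · have h1 : order (sup s p.swap) ≤ order p := cancel _ _ hsum2 hb
      have h2 := order_swap p ▸ hP'.order_lt hp'
      have e : sup s p.swap = sup p.swap s := by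
        rw [sup, sup, Set.union_comm, Set.inter_comm s.2]
      rw [e] at h1
      obtain ⟨h3, h4⟩ := hP'.sup_distinguishes hP hp' (by simpa using hp) hs' (h1.trans_lt h2)
        (h1.trans_lt (hP.order_lt hp))
      refine ⟨_, h4, by simpa using h3, by rwa [order_swap], ?_⟩
      rintro v ⟨⟨hv2, hv3⟩, hv1⟩
      exact ⟨hv1.imp (fun h => ⟨hv2, h⟩) (fun h => ⟨h, hv3⟩), hv3⟩
    · exfalso
      -- Both corners on the left of s are now smaller than s. They lie in P by consistency, so by
      -- the minimality of s they do not distinguish P from Q and lie in Q as well. This contradicts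
      -- the robustness of Q.
      push Not at ha hb
      have hsep := hP.isSeparation hs
      have hpsep := hP.isSeparation hp
      have hlt : order s < 𝓁 := order_swap s ▸ hQ.order_lt hsQ
      have key : ∀ q, IsSeparation H q → (corner s.swap q).encard < order s →
          (sup s.swap q).swap ∈ Q := by
        intro q hq ho
        have hsepc := isSeparation_sup hsep.swap hq
        have ho' : order (sup s.swap q).swap < order s := by rwa [order_swap]
        have hin : (sup s.swap q).swap ∈ P := hP.mem_of_le hs hsepc.swap
          (ho'.trans (hP.order_lt hs)) ⟨Set.inter_subset_left, Set.subset_union_left⟩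
        refine (hQ.mem_or_mem hsepc.swap (ho'.trans hlt)).resolve_right fun hm => ?_
        exact absurd (hPQ _ hin hm) (not_le.2 ho')
      have k1 := key p.swap hpsep.swap ha
      have k2 := key p hpsep hb
      have hpf := hP.finite hp
      obtain ⟨n, hn⟩ := ENat.ne_top_iff_exists.1 (Set.encard_ne_top_iff.2 hpf)
      refine hQ.robust n s.swap hsQ p hpsep hn.ge ?_ ?_ ⟨?_, ?_⟩
      · rw [order_swap s]
        rw [← order_sup, ← order_swap] at ha
        exact ha
      · rw [order_swap s]
        rw [← order_sup, ← order_swap] at hb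
        exact hb
      · exact k1
      · exact k2

end Profiles

/-! ### Edge cuts of trees. -/

section Trees

variable {N : Type u} {T : SimpleGraph N}

/-- A property that only changes along the edge `st` is constant on the components of `T - st`. -/
theorem reachable_deleteEdges_invariant {s t x y : N} (f : N → Prop)
    (hf : ∀ a b, T.Adj a b → s(a, b) ≠ s(s, t) → f a → f b)
    (h : (T.deleteEdges {s(s, t)}).Reachable x y) (hx : f x) : f y := by
  obtain ⟨w⟩ := h
  induction w with
  | nil => exact hx
  | cons hab _ ih =>
    rw [SimpleGraph.deleteEdges_adj] at hab
    exact ih (hf _ _ hab.1 (fun h => hab.2 (by simpa using h)) hx)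

theorem reachable_deleteEdges_of_not_mem_support {s t x y : N} (w : T.Walk x y)
    (hs : s ∉ w.support) : (T.deleteEdges {s(s, t)}).Reachable x y :=
  SimpleGraph.reachable_deleteEdges_iff_exists_walk.2
    ⟨w, fun h => hs (w.fst_mem_support_of_mem_edges h)⟩

/-- The vertices in the component of `T - st` that contains `s`. -/
theorem reachable_or_reachable (hT : T.IsTree) (s t x : N) :
    (T.deleteEdges {s(s, t)}).Reachable s x ∨ (T.deleteEdges {s(t, s)}).Reachable t x := by
  rw [Sym2.eq_swap (a := t)]
  obtain ⟨w⟩ := hT.connected.preconnected x s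
  induction w with
  | nil => exact Or.inl (SimpleGraph.Reachable.refl _)
  | @cons a b c hab _ ih =>
    by_cases he : s(a, b) = s(c, t)
    · rcases Sym2.eq_iff.1 he with ⟨rfl, -⟩ | ⟨rfl, -⟩
      · exact Or.inl (SimpleGraph.Reachable.refl _)
      · exact Or.inr (SimpleGraph.Reachable.refl _)
    · have : (T.deleteEdges {s(c, t)}).Reachable b a := by
        refine SimpleGraph.Adj.reachable ?_
        rw [SimpleGraph.deleteEdges_adj]
        exact ⟨hab.symm, by rw [Set.mem_singleton_iff, Sym2.eq_swap]; exact he⟩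
      exact ih.imp (fun h => h.trans this) (fun h => h.trans this)

theorem not_reachable_deleteEdges (hT : T.IsTree) {s t : N} (h : T.Adj s t) :
    ¬ (T.deleteEdges {s(s, t)}).Reachable s t :=
  SimpleGraph.isAcyclic_iff_forall_adj_isBridge.1 hT.isAcyclic h

theorem exists_adj_reachable (hT : T.IsTree) {t x : N} (h : x ≠ t) :
    ∃ s, T.Adj t s ∧ (T.deleteEdges {s(s, t)}).Reachable s x := by
  obtain ⟨w, hw⟩ := (hT.connected.preconnected t x).exists_isPath
  cases w with
  | nil => exact absurd rfl h
  | cons hts w =>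
    rw [SimpleGraph.Walk.cons_isPath_iff] at hw
    refine ⟨_, hts, ?_⟩
    rw [Sym2.eq_swap]
    exact reachable_deleteEdges_of_not_mem_support w hw.2

/-- Sets assigned to the vertices of a graph such that the sides of every edge meet only in the sets
at the endvertices are connected along paths. -/
theorem inter_subset_of_sides {V : Type u} (part : N → Set V)
    (h : ∀ s t, T.Adj s t → ∀ x y, (T.deleteEdges {s(s, t)}).Reachable s x →
      (T.deleteEdges {s(s, t)}).Reachable t y → part x ∩ part y ⊆ part t)
    (t₁ t₃ : N) (w : T.Walk t₁ t₃) (hw : w.IsPath) :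
    ∀ t₂ ∈ w.support, part t₁ ∩ part t₃ ⊆ part t₂ := by
  induction w with
  | nil =>
    intro t₂ ht₂
    rw [SimpleGraph.Walk.support_nil, List.mem_singleton] at ht₂
    rw [ht₂]
    exact Set.inter_subset_left
  | @cons a b c hab w ih =>
    rw [SimpleGraph.Walk.cons_isPath_iff] at hw
    intro t₂ ht₂
    rw [SimpleGraph.Walk.support_cons, List.mem_cons] at ht₂
    rcases ht₂ with rfl | ht₂
    · exact Set.inter_subset_left
    · have h1 := h a b hab a c (SimpleGraph.Reachable.refl _)
        (reachable_deleteEdges_of_not_mem_support w hw.2)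
      exact (Set.subset_inter h1 Set.inter_subset_right).trans (ih hw.1 t₂ ht₂)

end Trees

/-! ### Separations induced by tree edges, and lifting separations from torsos. -/

section TreeDecompositions

variable {V : Type u} {H : GraphIn V}

namespace TreeDecomposition

variable (D : TreeDecomposition H) {s t x : D.Node} {v : V}

theorem part_subset_side (s t : D.Node) : D.part s ⊆ D.side s t := by
  intro v hv
  simp only [side, Set.mem_iUnion]
  exact ⟨s, SimpleGraph.Reachable.refl _, hv⟩

theorem part_subset (t : D.Node) : D.part t ⊆ H.verts := by
  rw [← D.iUnion_part]; exact Set.subset_iUnion _ _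

theorem side_subset (s t : D.Node) : D.side s t ⊆ H.verts :=
  Set.iUnion₂_subset fun x _ => D.part_subset x

theorem part_subset_side_or (s t x : D.Node) : D.part x ⊆ D.side s t ∨ D.part x ⊆ D.side t s := by
  rcases reachable_or_reachable D.isTree s t x with h | h
  · exact Or.inl fun v hv => Set.mem_iUnion₂.2 ⟨x, h, hv⟩
  · exact Or.inr fun v hv => Set.mem_iUnion₂.2 ⟨x, h, hv⟩

/-- A path between nodes on different sides uses the edge st, since that edge is a bridge; so a
vertex in both end parts lies in the parts at s and t. -/
theorem side_inter_side (h : D.tree.Adj s t) :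
    D.side s t ∩ D.side t s = D.part s ∩ D.part t := by
  refine Set.Subset.antisymm ?_ (Set.inter_subset_inter (D.part_subset_side _ _)
    (D.part_subset_side _ _))
  rintro v ⟨hv1, hv2⟩
  obtain ⟨x, hx, hvx⟩ := Set.mem_iUnion₂.1 hv1
  obtain ⟨y, hy, hvy⟩ := Set.mem_iUnion₂.1 hv2
  obtain ⟨w, hw⟩ := (D.isTree.connected.preconnected x y).exists_isPath
  have hy' : (D.tree.deleteEdges {s(s, t)}).Reachable t y := by rw [Sym2.eq_swap]; exact hy
  have key : s(s, t) ∈ w.edges := by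
    by_contra hcon
    exact not_reachable_deleteEdges D.isTree h
      (SimpleGraph.Reachable.trans hx ((SimpleGraph.reachable_deleteEdges_iff_exists_walk.2
        ⟨w, hcon⟩).trans hy'.symm))
  exact ⟨D.inter_subset x y w hw s (w.fst_mem_support_of_mem_edges key) ⟨hvx, hvy⟩,
    D.inter_subset x y w hw t (w.snd_mem_support_of_mem_edges key) ⟨hvx, hvy⟩⟩

theorem isSeparation_side (s t : D.Node) : IsSeparation H (D.side s t, D.side t s) := by
  refine ⟨Set.Subset.antisymm (Set.union_subset (D.side_subset _ _) (D.side_subset _ _)) ?_, ?_⟩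
  · rw [← D.iUnion_part]
    exact Set.iUnion_subset fun x => (D.part_subset_side_or s t x).elim
      (fun h => h.trans Set.subset_union_left) (fun h => h.trans Set.subset_union_right)
  · rintro a ⟨ha, ha'⟩ b ⟨hb, hb'⟩ hab
    obtain ⟨x, hax, hbx⟩ := D.exists_of_adj a b hab
    rcases D.part_subset_side_or s t x with h | h
    · exact hb' (h hbx)
    · exact ha' (h hax)

theorem exists_mem_side (hv : v ∈ H.verts) (hvt : v ∉ D.part t) :
    ∃ s, D.tree.Adj s t ∧ v ∈ D.side s t \ D.side t s := by
  rw [← D.iUnion_part] at hv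
  obtain ⟨x, hx⟩ := Set.mem_iUnion.1 hv
  obtain ⟨s, hs, hsx⟩ := exists_adj_reachable D.isTree (t := t) (x := x)
    (by rintro rfl; exact hvt hx)
  have h1 : v ∈ D.side s t := Set.mem_iUnion₂.2 ⟨x, hsx, hx⟩
  refine ⟨s, hs.symm, h1, fun h2 => hvt ?_⟩
  have : v ∈ D.side s t ∩ D.side t s := ⟨h1, h2⟩
  rw [D.side_inter_side hs.symm] at this
  exact this.2

theorem mem_side_of_adj {a b : V} (ha : a ∈ D.side s t \ D.side t s) (hab : H.Adj a b) :
    b ∈ D.side s t := by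
  by_contra hb
  have hb' : b ∈ D.side s t ∪ D.side t s := (D.isSeparation_side s t).1 ▸ hab.snd_mem
  exact (D.isSeparation_side s t).2 a ha b ⟨hb'.resolve_left hb, hb⟩ hab

end TreeDecomposition

/-- Every separation of `H` is the trace of a separation of `G` with the same separator. -/
def Lifts (G H : GraphIn V) : Prop :=
  H.verts ⊆ G.verts ∧ ∀ p, IsSeparation H p →
    ∃ p', IsSeparation G p' ∧ restrict H p' = p ∧ p'.1 ∩ p'.2 = p.1 ∩ p.2

theorem IsSeparation.fst_subset {p : Set V × Set V} (h : IsSeparation H p) : p.1 ⊆ H.verts :=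
  Set.subset_union_left.trans h.1.subset

theorem IsSeparation.snd_subset {p : Set V × Set V} (h : IsSeparation H p) : p.2 ⊆ H.verts :=
  Set.subset_union_right.trans h.1.subset

theorem restrict_self {p : Set V × Set V} (h : IsSeparation H p) : restrict H p = p :=
  Prod.ext (Set.inter_eq_left.2 h.fst_subset) (Set.inter_eq_left.2 h.snd_subset)

theorem Lifts.refl (H : GraphIn V) : Lifts H H :=
  ⟨subset_rfl, fun p hp => ⟨p, hp, restrict_self hp, rfl⟩⟩

theorem Lifts.trans {G H K : GraphIn V} (h : Lifts G H) (h' : Lifts H K) : Lifts G K := by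
  refine ⟨h'.1.trans h.1, fun p hp => ?_⟩
  obtain ⟨q, hq, rfl, hqs⟩ := h'.2 p hp
  obtain ⟨r, hr, rfl, hrs⟩ := h.2 q hq
  refine ⟨r, hr, ?_, hrs.trans hqs⟩
  simp only [restrict, Set.inter_assoc, Set.inter_eq_right.2 h'.1]

/-- Adhesion sets are cliques of the torso, so each lies on one side of p. Everything behind an
adhesion set is added to a side that contains it, which leaves the separator unchanged. -/
theorem TreeDecomposition.lifts_torso (D : TreeDecomposition H) (t : D.Node) :
    Lifts H (D.torso t) := by
  refine ⟨D.part_subset t, fun p hp => ?_⟩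
  have hp1 : p.1 ⊆ D.part t := hp.fst_subset
  have hp2 : p.2 ⊆ D.part t := hp.snd_subset
  have hcov : ∀ v ∈ D.part t, v ∈ p.1 ∨ v ∈ p.2 := fun v hv => by
    have : v ∈ p.1 ∪ p.2 := hp.1 ▸ hv
    exact this
  have hclique : ∀ s, D.tree.Adj s t → ¬ D.part s ∩ D.part t ⊆ p.1 →
      D.part s ∩ D.part t ⊆ p.2 := by
    intro s hs hn x hx
    by_contra hx2
    obtain ⟨y, hy, hy1⟩ := Set.not_subset.1 hn
    have hx1 := (hcov x hx.2).resolve_right hx2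
    have hy2 := (hcov y hy.2).resolve_left hy1
    exact hp.2 x ⟨hx1, hx2⟩ y ⟨hy2, hy1⟩
      ⟨by rintro rfl; exact hy1 hx1, hx.2, hy.2, Or.inr ⟨s, hs.symm, hx.1, hy.1⟩⟩
  -- The vertices added on the left. An adhesion set contained in both sides sends the vertices
  -- behind it to the left too.
  set O : Set V := {v | v ∈ H.verts ∧ v ∉ D.part t ∧
    ∃ s, D.tree.Adj s t ∧ v ∈ D.side s t ∧ D.part s ∩ D.part t ⊆ p.1} with hO
  have hstrict : ∀ s v, D.tree.Adj s t → v ∈ D.side s t → v ∉ D.part t →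
      v ∈ D.side s t \ D.side t s := fun s v hs hv hvt => ⟨hv, fun h => hvt
        (((D.side_inter_side hs).subset ⟨hv, h⟩).2)⟩
  have hadj : ∀ s a b, D.tree.Adj s t → a ∈ D.side s t → a ∉ D.part t → H.Adj a b →
      b ∈ D.part t → b ∈ D.part s ∩ D.part t := fun s a b hs ha hat hab hb =>
    (D.side_inter_side hs).subset ⟨D.mem_side_of_adj (hstrict s a hs ha hat) hab,
      D.part_subset_side _ _ hb⟩
  refine ⟨(p.1 ∪ O, p.2 ∪ {v | v ∈ H.verts ∧ v ∉ D.part t ∧ v ∉ O}), ⟨?_, ?_⟩, ?_, ?_⟩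
  · refine Set.Subset.antisymm ?_ fun v hv => ?_
    · rintro v ((h | h) | (h | h))
      · exact D.part_subset t (hp1 h)
      · exact h.1
      · exact D.part_subset t (hp2 h)
      · exact h.1
    · by_cases hvt : v ∈ D.part t
      · exact (hcov v hvt).imp Or.inl Or.inl
      · by_cases hvO : v ∈ O
        · exact Or.inl (Or.inr hvO)
        · exact Or.inr (Or.inr ⟨hv, hvt, hvO⟩)
  · rintro a ⟨ha, ha'⟩ b ⟨hb, hb'⟩ hab
    simp only [Set.mem_union, Set.mem_ofPred_eq, not_or] at ha ha' hb hb'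
    rcases ha with ha | ha
    · rcases hb with hb | hb
      · exact hp.2 a ⟨ha, ha'.1⟩ b ⟨hb, hb'.1⟩
          ⟨hab.ne, hp1 ha, hp2 hb, Or.inl hab⟩
      · obtain ⟨s, hs, hbs⟩ := D.exists_mem_side hb.1 hb.2.1
        have h1 := hadj s b a hs hbs.1 hb.2.1 hab.symm (hp1 ha)
        by_cases h2 : D.part s ∩ D.part t ⊆ p.1
        · exact hb.2.2 ⟨hb.1, hb.2.1, s, hs, hbs.1, h2⟩
        · exact ha'.1 (hclique s hs h2 h1)
    · obtain ⟨-, hat, s, hs, has, hsub⟩ := ha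
      rcases hb with hb | hb
      · exact hb'.1 (hsub (hadj s a b hs has hat hab (hp2 hb)))
      · exact hb'.2 ⟨hb.1, hb.2.1, s, hs, D.mem_side_of_adj (hstrict s a hs has hat) hab, hsub⟩
  · refine Prod.ext ?_ ?_
    · refine Set.Subset.antisymm ?_ fun v hv => ⟨Or.inl hv, hp1 hv⟩
      rintro v ⟨h | h, hv⟩
      · exact h
      · exact absurd hv h.2.1
    · refine Set.Subset.antisymm ?_ fun v hv => ⟨Or.inl hv, hp2 hv⟩
      rintro v ⟨h | h, hv⟩
      · exact h
      · exact absurd hv h.2.1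
  · refine Set.Subset.antisymm ?_ fun v hv => ⟨Or.inl hv.1, Or.inl hv.2⟩
    rintro v ⟨h | h, h' | h'⟩
    · exact ⟨h, h'⟩
    · exact absurd (hp1 h) h'.2.1
    · exact absurd (hp2 h') h.2.1
    · exact absurd h h'.2.2

/-- A separation whose trace is not a separation of the torso separates an adhesion set. -/
theorem TreeDecomposition.isSeparation_restrict (D : TreeDecomposition H) (t : D.Node)
    {p : Set V × Set V} (hp : IsSeparation H p)
    (h : ∀ s, D.tree.Adj t s → ∀ x ∈ D.part s ∩ D.part t, ∀ y ∈ D.part s ∩ D.part t,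
      x ∈ p.1 \ p.2 → y ∈ p.2 \ p.1 → False) :
    IsSeparation (D.torso t) (restrict (D.torso t) p) := by
  refine ⟨?_, ?_⟩
  · change p.1 ∩ D.part t ∪ p.2 ∩ D.part t = D.part t
    rw [← Set.union_inter_distrib_right, hp.1]
    exact Set.inter_eq_right.2 (D.part_subset t)
  · rintro a ⟨⟨ha, hat⟩, ha'⟩ b ⟨⟨hb, hbt⟩, hb'⟩ ⟨-, -, -, hab⟩
    have h1 : a ∈ p.1 \ p.2 := ⟨ha, fun h => ha' ⟨h, hat⟩⟩
    have h2 : b ∈ p.2 \ p.1 := ⟨hb, fun h => hb' ⟨h, hbt⟩⟩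
    rcases hab with hab | ⟨s, hs, has, hbs⟩
    · exact hp.2 a h1 b h2 hab
    · exact h s hs a ⟨has, hat⟩ b ⟨hbs, hbt⟩ h1 h2

end TreeDecompositions

/-! ### Profiles induced on torsos. -/

section Induced

variable {V : Type u} {G H : GraphIn V} {P P' : Set (Set V × Set V)} {ℓ ℓ' : ℕ∞}
  {p q : Set V × Set V}

/-- No element of `P` has `V(H)` on its small side. -/
def Lives (H : GraphIn V) (P : Set (Set V × Set V)) : Prop := ∀ p ∈ P, ¬ H.verts ⊆ p.1

theorem order_restrict_le (H : GraphIn V) (p : Set V × Set V) : order (restrict H p) ≤ order p :=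
  Set.encard_le_encard fun _ hv => ⟨hv.1.1, hv.2.1⟩

/-- The lifts of an induced separation lie in the profile. -/
theorem mem_of_restrict_mem (hP : RPProfile G ℓ P) (hl : Lives H P) (hGH : H.verts ⊆ G.verts)
    (hq : restrict H q ∈ induced H P) (hqs : IsSeparation G q) (hqi : q.1 ∩ q.2 ⊆ H.verts) :
    q ∈ P := by
  obtain ⟨hsep, p, hp, hpq⟩ := hq
  have h1 : q.1 ∩ H.verts = p.1 ∩ H.verts := congrArg Prod.fst hpq
  have h2 : q.2 ∩ H.verts = p.2 ∩ H.verts := congrArg Prod.snd hpq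
  have hsub : q.1 ∩ q.2 ⊆ p.1 ∩ p.2 := fun v hv =>
    ⟨(h1.subset ⟨hv.1, hqi hv⟩).1, (h2.subset ⟨hv.2, hqi hv⟩).1⟩
  have hoq : order q ≤ order p := Set.encard_le_encard hsub
  refine (hP.mem_or_mem hqs (hoq.trans_lt (hP.order_lt hp))).resolve_right fun hq' => ?_
  -- The separator of q is contained in that of p and hence in one corner. So the opposite corner
  -- has order at most that of p and its separation lies in P by (P2), although all vertices of H
  -- are on its left.
  have hsum := encard_corner_add_le q.swap p
  rw [Prod.swap_swap, order_swap] at hsum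
  have hge : order q ≤ (corner q p.swap).encard := Set.encard_le_encard fun v hv =>
    ⟨Or.inl hv.1, hv.2, (hsub hv).1⟩
  have hfin : order q ≠ ⊤ := Set.encard_ne_top_iff.2 ((hP.finite hp).subset hsub)
  have hle : order (sup q.swap p) ≤ order p := by
    have h3 : order q + order (sup q.swap p) ≤ order q + order p := by
      rw [add_comm, order_sup]; exact (add_le_add_right hge _).trans hsum
    exact (ENat.add_le_add_iff_left hfin).1 h3
  refine hl _ (hP.sup_mem hq' hp (hle.trans_lt (hP.order_lt hp))) fun v hv => ?_
  have : v ∈ q.1 ∪ q.2 := hqs.1 ▸ hGH hv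
  rcases this with h | h
  · exact Or.inr (h1.subset ⟨h, hv⟩).1
  · exact Or.inl h

/-- A separation of H with trace in the induced set has all its same-separator lifts in P, so the
axioms can be checked on lifts, whose corners again have separators inside H. -/
theorem Lives.rpProfile_induced (hl : Lives H P) (hP : RPProfile G ℓ P) (hGH : Lifts G H) :
    RPProfile H ℓ (induced H P) := by
  have hmem : ∀ q, IsSeparation G q → q.1 ∩ q.2 ⊆ H.verts → restrict H q ∈ induced H P → q ∈ P :=
    fun q hq hqi h => mem_of_restrict_mem hP hl hGH.1 h hq hqi
  refine ⟨⟨⟨fun p hp => hp.1, ?_, ?_⟩, ?_, ?_⟩, ?_, ?_⟩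
  · intro p q hp hq hqp hpm hqm
    obtain ⟨p', hp', rfl, hpi⟩ := hGH.2 p hp
    obtain ⟨q', hq', rfl, hqi⟩ := hGH.2 q hq
    have hpi' : p'.1 ∩ p'.2 ⊆ H.verts := hpi ▸ fun v hv => hv.1.2
    have hqi' : q'.1 ∩ q'.2 ⊆ H.verts := hqi ▸ fun v hv => hv.1.2
    have h1 := hmem p' hp' hpi' hpm
    -- The lifts need not be nested outside H. The infimum r of p' and q' is below p' and still has
    -- the same trace as q', because q ≤ p in H.
    set r := (sup p'.swap q'.swap).swap with hr
    have hrs : IsSeparation G r := (isSeparation_sup hp'.swap hq'.swap).swap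
    have hri : r.1 ∩ r.2 ⊆ H.verts := by
      rintro v ⟨⟨h1, h2⟩, h3 | h3⟩
      · exact hpi' ⟨h1, h3⟩
      · exact hqi' ⟨h2, h3⟩
    have hrr : restrict H r.swap = (restrict H q').swap := by
      refine Prod.ext (Set.Subset.antisymm ?_ ?_) (Set.Subset.antisymm ?_ ?_)
      · rintro v ⟨h1 | h1, hv⟩
        · exact hqp.2 ⟨h1, hv⟩
        · exact ⟨h1, hv⟩
      · exact fun v hv => ⟨Or.inr hv.1, hv.2⟩
      · exact fun v hv => ⟨hv.1.2, hv.2⟩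
      · exact fun v hv => ⟨⟨(hqp.1 hv).1, hv.1⟩, hv.2⟩
    have h2 : r.swap ∈ P := hmem r.swap hrs.swap
      (by rw [Prod.fst_swap, Prod.snd_swap, Set.inter_comm]; exact hri) (by rwa [hrr])
    exact hP.consistent h1 h2 ⟨Set.inter_subset_left, Set.subset_union_left⟩
  · intro p hp q hq hpq
    obtain ⟨p', hp', rfl, hpi⟩ := hGH.2 p hp.1
    obtain ⟨q', hq', rfl, hqi⟩ := hGH.2 q hq.1
    have hpi' : p'.1 ∩ p'.2 ⊆ H.verts := hpi ▸ fun v hv => hv.1.2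
    have hqi' : q'.1 ∩ q'.2 ⊆ H.verts := hqi ▸ fun v hv => hv.1.2
    have h1 := hmem p' hp' hpi' hp
    have h2 := hmem q' hq' hqi' hq
    refine hP.ofOrder.isProfile.corner p' h1 q' h2 (hmem (sup p' q').swap
      (isSeparation_sup hp' hq').swap ?_ ?_)
    · rintro v ⟨⟨h1, h2⟩, h3 | h3⟩
      · exact hpi' ⟨h3, h1⟩
      · exact hqi' ⟨h3, h2⟩
    · convert hpq using 1
      refine Prod.ext ?_ ?_
      · ext v
        simp only [restrict, sup, Prod.fst_swap, Set.mem_inter_iff]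
        tauto
      · ext v
        simp only [restrict, sup, Prod.snd_swap, Set.mem_inter_iff, Set.mem_union]
        tauto
  · rintro p ⟨-, q, hq, rfl⟩
    exact (order_restrict_le H q).trans_lt (hP.order_lt hq)
  · intro p hp ho
    obtain ⟨p', hp', rfl, hpi⟩ := hGH.2 p hp
    rcases hP.mem_or_mem hp' (by rwa [order, hpi]) with h | h
    · exact Or.inl ⟨hp, p', h, rfl⟩
    · exact Or.inr ⟨hp.swap, p'.swap, h, rfl⟩
  · intro n p hp q hq hqn h1 h2 hcon
    obtain ⟨p', hp', rfl, hpi⟩ := hGH.2 p hp.1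
    obtain ⟨q', hq', rfl, hqi⟩ := hGH.2 q hq
    have hpi' : p'.1 ∩ p'.2 ⊆ H.verts := hpi ▸ fun v hv => hv.1.2
    have hqi' : q'.1 ∩ q'.2 ⊆ H.verts := hqi ▸ fun v hv => hv.1.2
    have hop : order p' = order (restrict H p') := by rw [order, hpi]; rfl
    have hoq : order q' = order (restrict H q') := by rw [order, hqi]; rfl
    have key : ∀ q', IsSeparation G q' → q'.1 ∩ q'.2 ⊆ H.verts →
        order ((restrict H p').2 ∩ (restrict H q').1, (restrict H p').1 ∪ (restrict H q').2) <
          order (restrict H p') →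
        ((restrict H p').2 ∩ (restrict H q').1, (restrict H p').1 ∪ (restrict H q').2)
          ∈ induced H P →
        order (p'.2 ∩ q'.1, p'.1 ∪ q'.2) < order p' ∧ (p'.2 ∩ q'.1, p'.1 ∪ q'.2) ∈ P := by
      intro q' hq' hqi' h1 hcon
      have hi : (p'.2 ∩ q'.1) ∩ (p'.1 ∪ q'.2) ⊆ H.verts := by
        rintro v ⟨⟨h1, h2⟩, h3 | h3⟩
        · exact hpi' ⟨h3, h1⟩
        · exact hqi' ⟨h2, h3⟩
      have hr : restrict H (p'.2 ∩ q'.1, p'.1 ∪ q'.2) =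
          ((restrict H p').2 ∩ (restrict H q').1, (restrict H p').1 ∪ (restrict H q').2) := by
        refine Prod.ext ?_ ?_
        · ext v; simp only [restrict, Set.mem_inter_iff]; tauto
        · ext v; simp only [restrict, Set.mem_inter_iff, Set.mem_union]; tauto
      rw [← hr] at h1 hcon
      refine ⟨?_, hmem _ (isSeparation_sup hp' hq'.swap).swap hi hcon⟩
      rw [hop]
      refine lt_of_le_of_lt (Set.encard_le_encard fun v hv => ?_) h1
      exact ⟨⟨hv.1, hi hv⟩, ⟨hv.2, hi hv⟩⟩
    have k1 := key q' hq' hqi' h1 hcon.1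
    have k2 := key q'.swap hq'.swap
      (by rw [Prod.fst_swap, Prod.snd_swap, Set.inter_comm]; exact hqi') h2 hcon.2
    exact hP.robust n p' (hmem p' hp' hpi' hp) q' hq' (hoq ▸ hqn) k1.1 k2.1 ⟨k1.2, k2.2⟩
  · intro F hF hne hFs
    obtain ⟨p₀, hp₀⟩ := hne
    set X := p₀.1 ∩ p₀.2 with hX
    have hXH : X ⊆ H.verts := fun v hv => (hF hp₀).1.fst_subset hv.1
    have hXℓ : X.encard < ℓ := by
      obtain ⟨-, q, hq, rfl⟩ := hF hp₀
      exact (order_restrict_le H q).trans_lt (hP.order_lt hq)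
    -- Every lift in P with separator X has the component C of G - X chosen by P strictly on its
    -- right. As P lives in H, some vertex of C lies in H, and it serves for the whole family.
    obtain ⟨C, hC, hCP⟩ := hP.exists_comp (hXH.trans hGH.1) hXℓ
    obtain ⟨w, hwH, hwC⟩ := Set.not_subset.1 (hl _ hCP)
    have hwC' : w ∈ C := by
      by_contra h
      exact hwC ⟨hGH.1 hwH, h⟩
    refine ⟨w, Set.mem_iInter₂.2 fun p hp => ?_⟩
    obtain ⟨p', hp', hpr, hpi⟩ := hGH.2 p (hF hp).1
    have hpX : p'.1 ∩ p'.2 = X := hpi.trans (hFs p hp p₀ hp₀)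
    have h1 := hmem p' hp' (hpX ▸ hXH) (hpr ▸ hF hp)
    have h2 := hP.comp_subset hC hCP h1 (hpX ▸ hC.disjoint_sep) hwC'
    rw [← hpr]
    exact ⟨⟨h2.1, hwH⟩, fun h => h2.2 h.1⟩

/-- A profile that lives in `H` and contains the separations given by the edges at a node `t` of a
tree-decomposition of `H` lives in the torso at `t`. -/
theorem Lives.torso (hl : Lives H P) (hP : RPProfile G ℓ P) (hGH : Lifts G H)
    (D : TreeDecomposition H) (t : D.Node)
    (h : ∀ s, D.tree.Adj s t → (D.side s t, D.side t s) ∈ induced H P) :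
    Lives (D.torso t) P := by
  intro p hp hsub
  have hsep := hP.isSeparation hp
  obtain ⟨C, hC, hCP⟩ := hP.exists_comp (X := p.1 ∩ p.2) (fun v hv => hsep.fst_subset hv.1)
    (hP.order_lt hp)
  have hCs := hP.comp_subset hC hCP hp hC.disjoint_sep
  obtain ⟨w, hwH, hw⟩ := Set.not_subset.1 (hl _ hCP)
  have hwC : w ∈ C := by
    by_contra hcon
    exact hw ⟨hGH.1 hwH, hcon⟩
  -- Since C misses the part at t, the vertex w lies behind some edge st. The component C avoids the
  -- adhesion set and must lie on the side that P points to at this edge, yet w lies on the other.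
  obtain ⟨s, hs, hws⟩ := D.exists_mem_side (t := t) hwH fun hwt => (hCs hwC).2 (hsub hwt)
  obtain ⟨r, hr, hrr, hri⟩ := hGH.2 _ (h s hs).1
  have hri' : r.1 ∩ r.2 = D.part s ∩ D.part t := hri.trans (D.side_inter_side hs)
  have hrP : r ∈ P := mem_of_restrict_mem hP hl hGH.1 (hrr ▸ h s hs) hr
    (hri'.subset.trans fun v hv => D.part_subset t hv.2)
  have h1 := hP.comp_subset hC hCP hrP (Set.disjoint_left.2 fun v hv hv' =>
    (hCs hv).2 (hsub (hri'.subset hv').2)) hwC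
  have h2 : w ∈ (restrict H r).1 := by rw [hrr]; exact hws.1
  exact h1.2 h2.1

end Induced

/-! ### Tree-decompositions from bipartite data with an explicit cut for every edge. -/

/-- Labels for the nodes of decomposition trees: vertex sets, and choices of a vertex set for every
vertex set. -/
abbrev NodeOf (V : Type u) := Set V ⊕ (Set V → Set V)

/-- The data of a decomposition along a bipartite tree. -/
structure RawDec (V : Type u) where
  seps : Set (Set V)
  blocks : Set (Set V → Set V)
  inc : Set V → (Set V → Set V) → Prop
  part : NodeOf V → Set V

namespace RawDec

variable {V : Type u} {H : GraphIn V}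

def IsNode (R : RawDec V) : NodeOf V → Prop
  | Sum.inl X => X ∈ R.seps
  | Sum.inr o => o ∈ R.blocks

def adj (R : RawDec V) : NodeOf V → NodeOf V → Prop
  | Sum.inl X, Sum.inr o => R.inc X o
  | Sum.inr o, Sum.inl X => R.inc X o
  | Sum.inl _, Sum.inl _ => False
  | Sum.inr _, Sum.inr _ => False

theorem adj_symm (R : RawDec V) : ∀ {x y : NodeOf V}, R.adj x y → R.adj y x
  | Sum.inl _, Sum.inr _, h => h
  | Sum.inr _, Sum.inl _, h => h

abbrev Node (R : RawDec V) := {x : NodeOf V // R.IsNode x}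

def tree (R : RawDec V) : SimpleGraph R.Node where
  Adj x y := R.adj x.1 y.1
  symm := ⟨fun _ _ h => R.adj_symm h⟩
  loopless := ⟨fun x h => by obtain ⟨x | x, hx⟩ := x <;> exact h⟩

/-- The torso of a part of the decomposition. -/
def torso (R : RawDec V) (H : GraphIn V) (x : NodeOf V) : GraphIn V where
  verts := R.part x
  Adj a b := a ≠ b ∧ a ∈ R.part x ∧ b ∈ R.part x ∧
    (H.Adj a b ∨ ∃ y, R.IsNode y ∧ R.adj x y ∧ a ∈ R.part y ∧ b ∈ R.part y)
  adj_sub h := h.1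
  edge_vert h := h.2.1
  symm := ⟨fun _ _ h => ⟨h.1.symm, h.2.2.1, h.2.1,
    h.2.2.2.imp (fun a => a.symm) (fun ⟨s, n, a, b, c⟩ => ⟨s, n, a, c, b⟩)⟩⟩

/-- The node property `f` witnesses that the edge between `X` and `o` separates the decomposition
tree, and the parts on the two sides lie in `A` and `B`. -/
structure Cut (R : RawDec V) (X : Set V) (o : Set V → Set V) (f : NodeOf V → Prop)
    (A B : Set V) : Prop where
  left : ¬ f (Sum.inl X)
  right : f (Sum.inr o)
  compat : ∀ Y ∈ R.seps, ∀ o' ∈ R.blocks, R.inc Y o' → ¬ (Y = X ∧ o' = o) →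
    (f (Sum.inl Y) ↔ f (Sum.inr o'))
  part_left : ∀ x, R.IsNode x → ¬ f x → R.part x ⊆ A
  part_right : ∀ x, R.IsNode x → f x → R.part x ⊆ B
  inter : A ∩ B ⊆ R.part (Sum.inl X) ∩ R.part (Sum.inr o)

/-- A cut per edge, together with connectedness, yields acyclicity, the path condition on the parts,
and the separations induced by the edges. -/
structure IsDec (R : RawDec V) (H : GraphIn V) : Prop where
  connected : R.tree.Connected
  cut : ∀ X ∈ R.seps, ∀ o ∈ R.blocks, R.inc X o → ∃ f A B, R.Cut X o f A B
  part_subset : ∀ x, R.IsNode x → R.part x ⊆ H.verts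
  cover : ∀ v ∈ H.verts, ∃ x, R.IsNode x ∧ v ∈ R.part x
  edge : ∀ a b, H.Adj a b → ∃ x, R.IsNode x ∧ a ∈ R.part x ∧ b ∈ R.part x

variable {R : RawDec V} {X : Set V} {o : Set V → Set V} {f : NodeOf V → Prop} {A B : Set V}

theorem Cut.reachable_iff (h : R.Cut X o f A B) (hX : X ∈ R.seps) (ho : o ∈ R.blocks)
    {x y : R.Node} (hr : (R.tree.deleteEdges
      {s((⟨Sum.inl X, hX⟩ : R.Node), (⟨Sum.inr o, ho⟩ : R.Node))}).Reachable x y) :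
    f x.1 ↔ f y.1 := by
  have key : ∀ a b : R.Node, R.tree.Adj a b →
      s(a, b) ≠ s((⟨Sum.inl X, hX⟩ : R.Node), (⟨Sum.inr o, ho⟩ : R.Node)) → f a.1 → f b.1 := by
    rintro ⟨Y | o', ha⟩ ⟨Z | o'', hb⟩ hab hne hfa
    · exact hab.elim
    · refine (h.compat Y ha o'' hb hab ?_).1 hfa
      rintro ⟨rfl, rfl⟩
      exact hne rfl
    · refine (h.compat Z hb o' ha hab ?_).2 hfa
      rintro ⟨rfl, rfl⟩
      exact hne Sym2.eq_swap
    · exact hab.elim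
  exact ⟨reachable_deleteEdges_invariant (fun a : R.Node => f a.1) key hr,
    reachable_deleteEdges_invariant (fun a : R.Node => f a.1) key hr.symm⟩

theorem IsDec.isTree (h : R.IsDec H) : R.tree.IsTree := by
  refine ⟨h.connected, SimpleGraph.isAcyclic_iff_forall_adj_isBridge.2 ?_⟩
  have key : ∀ X (hX : X ∈ R.seps) o (ho : o ∈ R.blocks), R.inc X o →
      ¬ (R.tree.deleteEdges {s((⟨Sum.inl X, hX⟩ : R.Node), (⟨Sum.inr o, ho⟩ : R.Node))}).Reachable
        ⟨Sum.inl X, hX⟩ ⟨Sum.inr o, ho⟩ := by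
    intro X hX o ho hi hr
    obtain ⟨f, A, B, hc⟩ := h.cut X hX o ho hi
    exact hc.left ((hc.reachable_iff hX ho hr).2 hc.right)
  rintro ⟨Y | o', ha⟩ ⟨Z | o'', hb⟩ hab
  · exact hab.elim
  · exact key Y ha o'' hb hab
  · rw [SimpleGraph.isBridge_iff]
    intro hr
    refine key Z hb o' ha hab ?_
    rw [Sym2.eq_swap]
    exact hr.symm
  · exact hab.elim

/-- The tree-decomposition with the given data. -/
def toDec (R : RawDec V) (h : R.IsDec H) : TreeDecomposition H where
  Node := R.Node
  tree := R.tree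
  isTree := h.isTree
  part x := R.part x.1
  iUnion_part := by
    refine Set.Subset.antisymm (Set.iUnion_subset fun x => h.part_subset x.1 x.2) fun v hv => ?_
    obtain ⟨x, hx, hvx⟩ := h.cover v hv
    exact Set.mem_iUnion.2 ⟨⟨x, hx⟩, hvx⟩
  exists_of_adj a b hab := by
    obtain ⟨x, hx, hxa, hxb⟩ := h.edge a b hab
    exact ⟨⟨x, hx⟩, hxa, hxb⟩
  inter_subset := by
    have key : ∀ X (hX : X ∈ R.seps) o (ho : o ∈ R.blocks), R.inc X o → ∀ x y : R.Node,
        (R.tree.deleteEdges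
          {s((⟨Sum.inl X, hX⟩ : R.Node), (⟨Sum.inr o, ho⟩ : R.Node))}).Reachable
          ⟨Sum.inl X, hX⟩ x →
        (R.tree.deleteEdges
          {s((⟨Sum.inl X, hX⟩ : R.Node), (⟨Sum.inr o, ho⟩ : R.Node))}).Reachable
          ⟨Sum.inr o, ho⟩ y →
        R.part x.1 ∩ R.part y.1 ⊆ R.part (Sum.inl X) ∩ R.part (Sum.inr o) := by
      intro X hX o ho hi x y hx hy
      obtain ⟨f, A, B, hc⟩ := h.cut X hX o ho hi
      refine Set.Subset.trans (Set.inter_subset_inter ?_ ?_) hc.inter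
      · exact hc.part_left x.1 x.2 fun hf => hc.left ((hc.reachable_iff hX ho hx).2 hf)
      · exact hc.part_right y.1 y.2 ((hc.reachable_iff hX ho hy).1 hc.right)
    refine inter_subset_of_sides (fun x : R.Node => R.part x.1) ?_
    rintro ⟨Y | o', ha⟩ ⟨Z | o'', hb⟩ hab x y hx hy
    · exact hab.elim
    · exact (key Y ha o'' hb hab x y hx hy).trans Set.inter_subset_right
    · rw [Sym2.eq_swap] at hx hy
      rw [Set.inter_comm]
      exact (key Z hb o' ha hab y x hy hx).trans Set.inter_subset_left
    · exact hab.elim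

theorem torso_eq (R : RawDec V) (h : R.IsDec H) (x : R.Node) :
    (R.toDec h).torso x = R.torso H x.1 := by
  refine SimpleGraph.Subgraph.ext rfl ?_
  funext a b
  refine propext ⟨?_, ?_⟩
  · rintro ⟨h1, h2, h3, h4⟩
    exact ⟨h1, h2, h3, h4.imp id fun ⟨s, hs, h⟩ => ⟨s.1, s.2, hs, h⟩⟩
  · rintro ⟨h1, h2, h3, h4⟩
    exact ⟨h1, h2, h3, h4.imp id fun ⟨s, hs, hxs, h⟩ => ⟨⟨s, hs⟩, hxs, h⟩⟩

/-- The separation induced by an edge of the decomposition tree. -/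
theorem Cut.side_eq (hc : R.Cut X o f A B) (h : R.IsDec H) (hX : X ∈ R.seps) (ho : o ∈ R.blocks)
    (hAB : A ∪ B ⊆ H.verts) :
    (R.toDec h).side ⟨Sum.inl X, hX⟩ ⟨Sum.inr o, ho⟩ = A ∧
      (R.toDec h).side ⟨Sum.inr o, ho⟩ ⟨Sum.inl X, hX⟩ = B := by
  set D := R.toDec h
  have h1 : D.side ⟨Sum.inl X, hX⟩ ⟨Sum.inr o, ho⟩ ⊆ A := Set.iUnion₂_subset fun x hx =>
    hc.part_left x.1 x.2 fun hf => hc.left ((hc.reachable_iff hX ho hx).2 hf)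
  have h2 : D.side ⟨Sum.inr o, ho⟩ ⟨Sum.inl X, hX⟩ ⊆ B := Set.iUnion₂_subset fun x hx => by
    have hx' : (R.tree.deleteEdges {s((⟨Sum.inl X, hX⟩ : R.Node),
        (⟨Sum.inr o, ho⟩ : R.Node))}).Reachable ⟨Sum.inr o, ho⟩ x := by
      rw [Sym2.eq_swap]
      exact hx
    exact hc.part_right x.1 x.2 ((hc.reachable_iff hX ho hx').1 hc.right)
  have h3 : A ∩ B ⊆ D.side ⟨Sum.inl X, hX⟩ ⟨Sum.inr o, ho⟩ ∩
      D.side ⟨Sum.inr o, ho⟩ ⟨Sum.inl X, hX⟩ := hc.inter.trans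
    (Set.inter_subset_inter (D.part_subset_side ⟨Sum.inl X, hX⟩ ⟨Sum.inr o, ho⟩)
      (D.part_subset_side ⟨Sum.inr o, ho⟩ ⟨Sum.inl X, hX⟩))
  have h4 : ∀ v ∈ H.verts, v ∈ D.side ⟨Sum.inl X, hX⟩ ⟨Sum.inr o, ho⟩ ∨
      v ∈ D.side ⟨Sum.inr o, ho⟩ ⟨Sum.inl X, hX⟩ := fun v hv => by
    rw [← (D.isSeparation_side ⟨Sum.inl X, hX⟩ ⟨Sum.inr o, ho⟩).1] at hv
    exact hv
  refine ⟨Set.Subset.antisymm h1 fun v hv => ?_, Set.Subset.antisymm h2 fun v hv => ?_⟩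
  · rcases h4 v (hAB (Or.inl hv)) with h | h
    · exact h
    · exact (h3 ⟨hv, h2 h⟩).1
  · rcases h4 v (hAB (Or.inr hv)) with h | h
    · exact (h3 ⟨h1 h, hv⟩).2
    · exact h

end RawDec

/-! ### The star that splits off the components that are not full. -/

section Star

variable {V : Type u} {H : GraphIn V} {N : Set (Set V)} {k : ℕ} {K L : Set V}

/-- The components of the graphs `H - X` with `X ∈ N` that are not full. -/
def rubbish (H : GraphIn V) (N : Set (Set V)) : Set (Set V) :=
  {K | ∃ X ∈ N, IsComp H X K ∧ ¬ Full H X K}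

def nbhd (H : GraphIn V) (K : Set V) : Set V := {x | x ∉ K ∧ ∃ c ∈ K, H.Adj c x}

/-- The star whose leaves are the components that are not full. -/
def starDec (H : GraphIn V) (N : Set (Set V)) : RawDec V where
  seps := rubbish H N
  blocks := {fun _ => ∅}
  inc _ _ := True
  part
    | Sum.inl K => K ∪ nbhd H K
    | Sum.inr _ => H.verts \ ⋃₀ rubbish H N

/-- The label of the centre of the star. -/
def centre (V : Type u) : NodeOf V := Sum.inr fun _ => ∅

theorem isNode_centre (H : GraphIn V) (N : Set (Set V)) : (starDec H N).IsNode (centre V) := rfl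

/-- Each of the two components avoids the separator of the other, so if they meet, each contains the
other. -/
theorem GoodSeps.rubbish_disjoint (hN : GoodSeps H k N) (hK : K ∈ rubbish H N)
    (hL : L ∈ rubbish H N) (hne : K ≠ L) : Disjoint K L := by
  obtain ⟨X, hX, hKX, hfK⟩ := hK
  obtain ⟨Y, hY, hLY, hfL⟩ := hL
  by_contra hcon
  obtain ⟨v, hvK, hvL⟩ := Set.not_disjoint_iff.1 hcon
  exact hne (Set.Subset.antisymm
    (hKX.subset_of_disjoint (hN.avoid X hX K hKX hfK Y hY) hLY hvK hvL)
    (hLY.subset_of_disjoint (hN.avoid Y hY L hLY hfL X hX) hKX hvL hvK))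

theorem nbhd_subset {X : Set V} (hK : IsComp H X K) : nbhd H K ⊆ X := by
  rintro x ⟨hxK, c, hc, hcx⟩
  exact (hK.mem_or_of_adj hc hcx).resolve_left hxK

theorem GoodSeps.subset_centre (hN : GoodSeps H k N) {X : Set V} (hX : X ∈ N) :
    X ⊆ H.verts \ ⋃₀ rubbish H N := by
  refine fun x hx => ⟨(hN.tight X hX).1 hx, ?_⟩
  rintro ⟨K, ⟨Y, hY, hK, hf⟩, hxK⟩
  exact Set.disjoint_left.1 (hN.avoid Y hY K hK hf X hX) hxK hx

theorem GoodSeps.nbhd_subset_centre (hN : GoodSeps H k N) (hK : K ∈ rubbish H N) :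
    nbhd H K ⊆ H.verts \ ⋃₀ rubbish H N := by
  obtain ⟨X, hX, hKX, -⟩ := hK
  exact (nbhd_subset hKX).trans (hN.subset_centre hX)

theorem rubbish_subset (hK : K ∈ rubbish H N) : K ⊆ H.verts := by
  obtain ⟨X, hX, hKX, -⟩ := hK
  exact fun v hv => (hKX.subset hv).1

theorem nbhd_subset_verts (H : GraphIn V) (K : Set V) : nbhd H K ⊆ H.verts := by
  rintro x ⟨-, c, -, h⟩
  exact h.snd_mem

theorem GoodSeps.starCut (hN : GoodSeps H k N) (hK : K ∈ rubbish H N) :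
    (starDec H N).Cut K (fun _ => ∅) (fun x => x ≠ Sum.inl K) (K ∪ nbhd H K) (H.verts \ K) := by
  refine ⟨fun h => h rfl, by simp, ?_, ?_, ?_, ?_⟩
  · rintro Y hY o rfl - hne
    simp only [ne_eq, reduceCtorEq, not_false_eq_true, iff_true, Sum.inl.injEq]
    exact fun h => hne ⟨h, rfl⟩
  · intro x hx hf
    rw [not_not] at hf
    subst hf
    exact subset_rfl
  · rintro (L | o) hx hf
    · have hne : L ≠ K := fun h => hf (by rw [h])
      rintro v (hv | hv)
      · exact ⟨rubbish_subset hx hv, Set.disjoint_left.1 (hN.rubbish_disjoint hx hK hne) hv⟩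
      · have := hN.nbhd_subset_centre hx hv
        exact ⟨this.1, fun h => this.2 ⟨K, hK, h⟩⟩
    · exact fun v hv => ⟨hv.1, fun h => hv.2 ⟨K, hK, h⟩⟩
  · rintro v ⟨hv | hv, hv'⟩
    · exact absurd hv hv'.2
    · exact ⟨Or.inr hv, hN.nbhd_subset_centre hK hv⟩

theorem GoodSeps.isDec_starDec (hN : GoodSeps H k N) : (starDec H N).IsDec H := by
  refine ⟨?_, ?_, ?_, ?_, ?_⟩
  · have hc : ∀ x : (starDec H N).Node,
        (starDec H N).tree.Reachable x ⟨centre V, isNode_centre H N⟩ := by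
      rintro ⟨L | o, hx⟩
      · have : (starDec H N).tree.Adj ⟨Sum.inl L, hx⟩ ⟨centre V, isNode_centre H N⟩ := trivial
        exact this.reachable
      · have : o = fun _ => ∅ := hx
        subst this
        exact SimpleGraph.Reachable.refl _
    have : Nonempty (starDec H N).Node := ⟨⟨centre V, isNode_centre H N⟩⟩
    exact ⟨fun x y => (hc x).trans (hc y).symm⟩
  · rintro K hK o rfl -
    exact ⟨_, _, _, hN.starCut hK⟩
  · rintro (L | o) hx
    · exact Set.union_subset (rubbish_subset hx) (nbhd_subset_verts H L)
    · exact Set.sdiff_subset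
  · intro v hv
    by_cases h : v ∈ ⋃₀ rubbish H N
    · obtain ⟨K, hK, hvK⟩ := h
      exact ⟨Sum.inl K, hK, Or.inl hvK⟩
    · exact ⟨centre V, isNode_centre H N, hv, h⟩
  · have key : ∀ a b, H.Adj a b → a ∈ ⋃₀ rubbish H N →
        ∃ x, (starDec H N).IsNode x ∧ a ∈ (starDec H N).part x ∧ b ∈ (starDec H N).part x := by
      rintro a b hab ⟨K, hK, haK⟩
      refine ⟨Sum.inl K, hK, Or.inl haK, ?_⟩
      by_cases hb : b ∈ K
      · exact Or.inl hb
      · exact Or.inr ⟨hb, a, haK, hab⟩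
    intro a b hab
    by_cases ha : a ∈ ⋃₀ rubbish H N
    · exact key a b hab ha
    · by_cases hb : b ∈ ⋃₀ rubbish H N
      · obtain ⟨x, hx, h1, h2⟩ := key b a hab.symm hb
        exact ⟨x, hx, h2, h1⟩
      · exact ⟨centre V, isNode_centre H N, ⟨hab.fst_mem, ha⟩, hab.snd_mem, hb⟩

/-- The neighbourhood of a component of H - X that is not full is a proper subset of X. This is the
bound on the adhesion on odd levels. -/
theorem GoodSeps.encard_nbhd_lt (hN : GoodSeps H k N) (hK : K ∈ rubbish H N) :
    (nbhd H K).encard < k := by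
  obtain ⟨X, hX, hKX, hf⟩ := hK
  rw [← (hN.tight X hX).2.1]
  refine (((hN.tight X hX).finite).subset (nbhd_subset hKX)).encard_lt_encard
    ((nbhd_subset hKX).ssubset_of_ne ?_)
  rintro rfl
  exact hf fun x hx => hx.2

end Star

/-! ### The tree of a nested set of separators all of whose components are full. -/

section BlockTree

variable {V : Type u} {H : GraphIn V} {N : Set (Set V)} {k : ℕ} {S S' X Y Z W C E : Set V}
  {o : Set V → Set V}

/-- The union of the components of `H - Y` that meet `S`. -/
def compTo (H : GraphIn V) (Y S : Set V) : Set V := {w | ∃ x ∈ S \ Y, w ∈ conn H Y x}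

theorem compTo_eq_conn (hsep : ¬ Separates H Y S) {x : V} (hx : x ∈ S \ Y) :
    compTo H Y S = conn H Y x := by
  refine Set.Subset.antisymm ?_ fun w hw => ⟨x, hx, hw⟩
  rintro w ⟨y, hy, hw⟩
  have : y ∈ conn H Y x := by
    by_contra h
    exact hsep ⟨x, hx, y, hy, h⟩
  exact conn_trans this hw

theorem mem_compTo {x : V} (hx : x ∈ S \ Y) : x ∈ compTo H Y S := ⟨x, hx, mem_conn_self _ _ _⟩

theorem isComp_compTo (hS : S ⊆ H.verts) (hsep : ¬ Separates H Y S) (hne : ¬ S ⊆ Y) :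
    IsComp H Y (compTo H Y S) := by
  obtain ⟨x, hx, hxY⟩ := Set.not_subset.1 hne
  exact ⟨x, ⟨hS hx, hxY⟩, compTo_eq_conn hsep ⟨hx, hxY⟩⟩

theorem subset_compTo_union (H : GraphIn V) (Y S : Set V) : S ⊆ compTo H Y S ∪ Y := by
  intro x hx
  by_cases h : x ∈ Y
  · exact Or.inr h
  · exact Or.inl (mem_compTo ⟨hx, h⟩)

theorem compTo_eq_of_mem (hC : IsComp H Y C) (hsep : ¬ Separates H Y S) {x : V} (hx : x ∈ S)
    (hxC : x ∈ C) : compTo H Y S = C :=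
  (compTo_eq_conn hsep ⟨hx, (hC.subset hxC).2⟩).trans (hC.eq_conn hxC).symm

/-- Nested sets of separators of size `k` all of whose components are full. -/
structure TreeSeps (H : GraphIn V) (k : ℕ) (N : Set (Set V)) : Prop where
  subset : ∀ X ∈ N, X ⊆ H.verts
  encard : ∀ X ∈ N, X.encard = k
  full : ∀ X ∈ N, ∀ C, IsComp H X C → Full H X C
  nested : ∀ X ∈ N, ∀ Y ∈ N, ¬ Separates H X Y

namespace TreeSeps

theorem finite (hN : TreeSeps H k N) (hX : X ∈ N) : X.Finite :=
  Set.finite_of_encard_eq_coe (hN.encard X hX)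

theorem not_subset (hN : TreeSeps H k N) (hX : X ∈ N) (hY : Y ∈ N) (hne : X ≠ Y) : ¬ X ⊆ Y :=
  fun h => hne ((hN.finite hX).eq_of_subset_of_encard_le h (by rw [hN.encard X hX, hN.encard Y hY]))

theorem isComp_compTo (hN : TreeSeps H k N) (hX : X ∈ N) (hY : Y ∈ N) (hne : X ≠ Y) :
    IsComp H Y (compTo H Y X) :=
  TreeOfTD.isComp_compTo (hN.subset X hX) (hN.nested Y hY X hX) (hN.not_subset hX hY hne)

/-- Fullness joins E to a vertex of W \ Z within H - Z. -/
theorem subset_compTo (hN : TreeSeps H k N) (hW : W ∈ N) (hZ : Z ∈ N) (hne : W ≠ Z)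
    (hE : IsComp H W E) (hd : Disjoint E Z) : E ⊆ compTo H Z W := by
  obtain ⟨D, hD, hED⟩ := hE.subset_comp hd
  have h1 := (hN.full W hW E hE).subset_union hD hED
  obtain ⟨w, hw, hwZ⟩ := Set.not_subset.1 (hN.not_subset hW hZ hne)
  rw [compTo_eq_of_mem hD (hN.nested Z hZ W hW) hw ((h1 hw).resolve_right hwZ)]
  exact hED

theorem disjoint_of_ne (hN : TreeSeps H k N) (hW : W ∈ N) (hZ : Z ∈ N)
    (hE : IsComp H W E) (hEZ : E ≠ compTo H W Z) : Disjoint E Z :=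
  Set.disjoint_left.2 fun _ hz hz' =>
    hEZ (compTo_eq_of_mem hE (hN.nested W hW Z hZ) hz' hz).symm

/-- Since its components are full, such a Z is a minimal separator of a vertex of S and a vertex of
S'. -/
theorem finite_between (hN : TreeSeps H k N) (hS : S.Finite) (hS' : S'.Finite)
    (hSH : S ⊆ H.verts) (hSH' : S' ⊆ H.verts) :
    {Z ∈ N | ¬ Separates H Z S ∧ ¬ Separates H Z S' ∧ ¬ S ⊆ Z ∧ ¬ S' ⊆ Z ∧
      compTo H Z S ≠ compTo H Z S'}.Finite := by
  refine (hS.biUnion fun x _ => hS'.biUnion fun y _ =>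
    finite_minimal_separators H k x y).subset ?_
  rintro Z ⟨hZ, h1, h2, h3, h4, hne⟩
  obtain ⟨x, hx, hxZ⟩ := Set.not_subset.1 h3
  obtain ⟨y, hy, hyZ⟩ := Set.not_subset.1 h4
  simp only [Set.mem_iUnion]
  have c1 := TreeOfTD.isComp_compTo hSH h1 h3
  have c2 := TreeOfTD.isComp_compTo hSH' h2 h4
  exact ⟨x, hx, y, hy, hN.encard Z hZ, _, _, c1, c2, hne, hN.full Z hZ _ c1, hN.full Z hZ _ c2,
    mem_compTo ⟨hx, hxZ⟩, mem_compTo ⟨hy, hyZ⟩⟩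

end TreeSeps

/-- The tree whose nodes are the elements of `N` and the blocks, which choose a component of `H - X`
for every `X ∈ N`. -/
def blockDec (H : GraphIn V) (N : Set (Set V)) : RawDec V where
  seps := N
  blocks := {o | (∀ Y, Y ∉ N → o Y = ∅) ∧ (∀ Y ∈ N, IsComp H Y (o Y)) ∧
    (N.Nonempty → ∃ X ∈ N, ∀ Y ∈ N, Y ≠ X → o Y = compTo H Y X)}
  inc X o := ∀ Y ∈ N, Y ≠ X → o Y = compTo H Y X
  part
    | Sum.inl X => X
    | Sum.inr o => {v ∈ H.verts | ∀ Z ∈ N, v ∈ o Z ∪ Z}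

namespace TreeSeps

/-- A consistent choice of components that differs only finitely from the choice of a separator is a
block. -/
theorem mem_blocks (hN : TreeSeps H k N) (ho : ∀ Y, Y ∉ N → o Y = ∅)
    (hcomp : ∀ Y ∈ N, IsComp H Y (o Y))
    (hcons : ∀ Z ∈ N, ∀ W ∈ N, Disjoint (o Z) W → (o Z ∩ o W).Nonempty)
    (hfin : ∀ X ∈ N, {Z ∈ N | Z ≠ X ∧ o Z ≠ compTo H Z X}.Finite) : o ∈ (blockDec H N).blocks := by
  refine ⟨ho, hcomp, ?_⟩
  rintro ⟨X, hX⟩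
  obtain ⟨n, hn⟩ : ∃ n, n = {Z ∈ N | Z ≠ X ∧ o Z ≠ compTo H Z X}.ncard := ⟨_, rfl⟩
  induction n using Nat.strong_induction_on generalizing X with
  | _ n ih =>
  by_cases hall : ∀ Y ∈ N, Y ≠ X → o Y = compTo H Y X
  · exact ⟨X, hX, hall⟩
  · push Not at hall
    obtain ⟨Z, hZ, hZX, hoZ⟩ := hall
    -- Moving from X to a separator Z at which o disagrees with X shrinks the finite set of
    -- disagreements: a W where o disagrees with Z is also one where o disagrees with X, and Z
    -- itself drops out.
    refine ih _ ?_ Z hZ rfl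
    rw [hn]
    refine Set.ncard_lt_ncard ((Set.ssubset_iff_of_subset ?_).2
      ⟨Z, ⟨hZ, hZX, hoZ⟩, fun h => h.2.1 rfl⟩) (hfin X hX)
    rintro W ⟨hW, hWZ, hoW⟩
    have hd := hN.disjoint_of_ne hW hZ (hcomp W hW) hoW
    have hsub := hN.subset_compTo hW hZ hWZ (hcomp W hW) hd
    have hoZ' : o Z = compTo H Z W := by
      obtain ⟨v, hv, hv'⟩ := hcons W hW Z hZ hd
      exact (hcomp Z hZ).eq_of_mem (hN.isComp_compTo hW hZ hWZ) hv' (hsub hv)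
    have hWX : W ≠ X := by
      rintro rfl
      exact hoZ hoZ'
    refine ⟨hW, hWX, fun hcon => hoZ ?_⟩
    obtain ⟨x, hx, hxW⟩ := Set.not_subset.1 (hN.not_subset hX hW hWX.symm)
    have hxo : x ∈ o W := hcon ▸ mem_compTo ⟨hx, hxW⟩
    exact (compTo_eq_of_mem (hcomp Z hZ) (hN.nested Z hZ X hX) hx (hoZ' ▸ hsub hxo)).symm

/-- The block at `X` on the side of the component `C`. -/
theorem exists_block (hN : TreeSeps H k N) (hX : X ∈ N) (hC : IsComp H X C) :
    ∃ o ∈ (blockDec H N).blocks, (blockDec H N).inc X o ∧ o X = C := by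
  classical
  refine ⟨fun Y => if Y ∈ N then if Y = X then C else compTo H Y X else ∅, ⟨?_, ?_, ?_⟩, ?_, ?_⟩
  · intro Y hY
    simp [hY]
  · intro Y hY
    by_cases h : Y = X
    · subst h; simpa [hY] using hC
    · simpa [hY, h] using hN.isComp_compTo hX hY (Ne.symm h)
  · refine fun _ => ⟨X, hX, fun Y hY h => ?_⟩
    simp [hY, h]
  · intro Y hY h
    simp [hY, h]
  · simp [hX]

/-- Induction on the finite number of elements of N strictly between X and Y, that is, with X and Y
towards different components. Any Z between them leaves strictly fewer elements between X and Z, and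
between Z and Y. -/
theorem reachable_seps (hN : TreeSeps H k N) (hX : X ∈ N) (hY : Y ∈ N) :
    (blockDec H N).tree.Reachable ⟨Sum.inl X, hX⟩ ⟨Sum.inl Y, hY⟩ := by
  obtain ⟨n, hn⟩ : ∃ n, n = {Z ∈ N | Z ≠ X ∧ Z ≠ Y ∧ compTo H Z X ≠ compTo H Z Y}.ncard :=
    ⟨_, rfl⟩
  have hfin : ∀ X ∈ N, ∀ Y ∈ N,
      {Z ∈ N | Z ≠ X ∧ Z ≠ Y ∧ compTo H Z X ≠ compTo H Z Y}.Finite := by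
    intro X hX Y hY
    refine (hN.finite_between (hN.finite hX) (hN.finite hY) (hN.subset X hX)
      (hN.subset Y hY)).subset ?_
    rintro Z ⟨hZ, h1, h2, h3⟩
    exact ⟨hZ, hN.nested Z hZ X hX, hN.nested Z hZ Y hY, hN.not_subset hX hZ h1.symm,
      hN.not_subset hY hZ h2.symm, h3⟩
  have hsub : ∀ X ∈ N, ∀ Y ∈ N, ∀ Z ∈ N, Z ≠ X → Z ≠ Y → compTo H Z X ≠ compTo H Z Y →
      {W ∈ N | W ≠ X ∧ W ≠ Z ∧ compTo H W X ≠ compTo H W Z}.ncard <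
        {W ∈ N | W ≠ X ∧ W ≠ Y ∧ compTo H W X ≠ compTo H W Y}.ncard := by
    intro X hX Y hY Z hZ hZX hZY hne
    refine Set.ncard_lt_ncard ((Set.ssubset_iff_of_subset ?_).2
      ⟨Z, ⟨hZ, hZX, hZY, hne⟩, fun h => h.2.2.1 rfl⟩) (hfin X hX Y hY)
    rintro W ⟨hW, hWX, hWZ, hcon⟩
    have hc := hN.isComp_compTo hX hW hWX.symm
    have hd := hN.disjoint_of_ne hW hZ hc hcon
    have hs := hN.subset_compTo hW hZ hWZ hc hd
    obtain ⟨x, hx, hxW⟩ := Set.not_subset.1 (hN.not_subset hX hW hWX.symm)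
    have h1 : compTo H Z X = compTo H Z W := compTo_eq_of_mem (hN.isComp_compTo hW hZ hWZ)
      (hN.nested Z hZ X hX) hx (hs (mem_compTo ⟨hx, hxW⟩))
    refine ⟨hW, hWX, ?_, fun heq => hne ?_⟩
    · rintro rfl
      exact hne h1
    · have hWY : W ≠ Y := by
        rintro rfl
        exact hne h1
      obtain ⟨y, hy, hyW⟩ := Set.not_subset.1 (hN.not_subset hY hW hWY.symm)
      have h2 : compTo H Z Y = compTo H Z W := compTo_eq_of_mem (hN.isComp_compTo hW hZ hWZ)
        (hN.nested Z hZ Y hY) hy (hs (heq ▸ mem_compTo ⟨hy, hyW⟩))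
      rw [h1, h2]
  induction n using Nat.strong_induction_on generalizing X Y with
  | _ n ih =>
  by_cases hXY : X = Y
  · subst hXY
    exact SimpleGraph.Reachable.refl _
  by_cases hall : ∀ Z ∈ N, Z ≠ X → Z ≠ Y → compTo H Z X = compTo H Z Y
  -- With nothing in between, the block at X facing Y is also incident with Y.
  · obtain ⟨o, ho, hinc, hoX⟩ := hN.exists_block hX (hN.isComp_compTo hY hX (Ne.symm hXY))
    have h1 : (blockDec H N).tree.Adj ⟨Sum.inl X, hX⟩ ⟨Sum.inr o, ho⟩ := hinc
    have h2 : (blockDec H N).tree.Adj ⟨Sum.inr o, ho⟩ ⟨Sum.inl Y, hY⟩ := by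
      intro Z hZ hZY
      by_cases hZX : Z = X
      · rw [hZX, hoX]
      · rw [hinc Z hZ hZX, hall Z hZ hZX hZY]
    exact h1.reachable.trans h2.reachable
  · push Not at hall
    obtain ⟨Z, hZ, hZX, hZY, hne⟩ := hall
    have h1 := ih _ (hn ▸ hsub X hX Y hY Z hZ hZX hZY hne) hX hZ rfl
    have h2 := ih {W ∈ N | W ≠ Y ∧ W ≠ Z ∧ compTo H W Y ≠ compTo H W Z}.ncard (by
      have h3 := hsub Y hY X hX Z hZ hZY hZX hne.symm
      have h4 : {W ∈ N | W ≠ Y ∧ W ≠ X ∧ compTo H W Y ≠ compTo H W X} =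
          {W ∈ N | W ≠ X ∧ W ≠ Y ∧ compTo H W X ≠ compTo H W Y} := by
        ext W
        constructor
        · rintro ⟨a, b, c, d⟩
          exact ⟨a, c, b, d.symm⟩
        · rintro ⟨a, b, c, d⟩
          exact ⟨a, c, b, d.symm⟩
      rwa [h4, ← hn] at h3) hY hZ rfl
    exact h1.trans h2.symm

theorem connected (hN : TreeSeps H k N) : (blockDec H N).tree.Connected := by
  by_cases hne : N.Nonempty
  · obtain ⟨X, hX⟩ := hne
    have key : ∀ x : (blockDec H N).Node,
        (blockDec H N).tree.Reachable x ⟨Sum.inl X, hX⟩ := by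
      rintro ⟨Y | o, hx⟩
      · exact hN.reachable_seps hx hX
      · obtain ⟨Y, hY, hinc⟩ := hx.2.2 ⟨X, hX⟩
        have h1 : (blockDec H N).tree.Adj ⟨Sum.inr o, hx⟩ ⟨Sum.inl Y, hY⟩ := hinc
        exact h1.reachable.trans (hN.reachable_seps hY hX)
    have : Nonempty (blockDec H N).Node := ⟨⟨Sum.inl X, hX⟩⟩
    exact ⟨fun x y => (key x).trans (key y).symm⟩
  · rw [Set.not_nonempty_iff_eq_empty] at hne
    subst hne
    have hb : (fun _ => ∅ : Set V → Set V) ∈ (blockDec H ∅).blocks :=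
      ⟨fun _ _ => rfl, fun _ h => h.elim, fun h => (Set.not_nonempty_empty h).elim⟩
    have key : ∀ x : (blockDec H ∅).Node, x = ⟨Sum.inr fun _ => ∅, hb⟩ := by
      rintro ⟨Y | o, hx⟩
      · exact hx.elim
      · have : o = fun _ => ∅ := funext fun Y => hx.1 Y (Set.notMem_empty Y)
        subst this
        rfl
    have : Nonempty (blockDec H ∅).Node := ⟨⟨Sum.inr fun _ => ∅, hb⟩⟩
    refine ⟨fun x y => ?_⟩
    rw [key x, key y]

/-- A node is coloured by whether it points to `o X` as seen from X. For a block this is its choice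
at X, which its incident separators other than X share. A block incident with X that chooses `o X`
there agrees with o everywhere, so the colour changes only along the edge between X and o. -/
theorem blockCut (hN : TreeSeps H k N) (hX : X ∈ N) (ho : o ∈ (blockDec H N).blocks)
    (hinc : (blockDec H N).inc X o) :
    (blockDec H N).Cut X o (Sum.elim (fun Y => Y ≠ X ∧ compTo H X Y = o X) (fun o' => o' X = o X))
      (H.verts \ o X) (o X ∪ X) := by
  have hcomp := ho.2.1 X hX
  have hXo : X ⊆ (blockDec H N).part (Sum.inr o) := by
    refine fun v hv => ⟨hN.subset X hX hv, fun Z hZ => ?_⟩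
    by_cases h : Z = X
    · subst h; exact Or.inr hv
    · rw [hinc Z hZ h]
      exact subset_compTo_union H Z X hv
  refine ⟨fun h => h.1 rfl, rfl, ?_, ?_, ?_, ?_⟩
  · intro Y hY o' ho' hinc' hne
    simp only [Sum.elim_inl, Sum.elim_inr]
    by_cases hYX : Y = X
    · subst hYX
      refine ⟨fun h => (h.1 rfl).elim, fun h => (hne ⟨rfl, funext fun Z => ?_⟩).elim⟩
      by_cases hZ : Z ∈ N
      · by_cases hZY : Z = Y
        · rw [hZY, h]
        · rw [hinc' Z hZ hZY, hinc Z hZ hZY]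
      · rw [ho'.1 Z hZ, ho.1 Z hZ]
    · rw [hinc' X hX (Ne.symm hYX)]
      exact ⟨fun h => h.2, fun h => ⟨hYX, h⟩⟩
  · have key : ∀ S C, S ⊆ H.verts → S ⊆ C ∪ X → IsComp H X C → C ≠ o X → S ⊆ H.verts \ o X := by
      intro S C hS hSC hC hne v hv
      refine ⟨hS hv, fun hvo => ?_⟩
      rcases hSC hv with h | h
      · exact hne (hC.eq_of_mem hcomp h hvo)
      · exact (hcomp.subset hvo).2 h
    rintro (Y | o') hx hf
    · simp only [Sum.elim_inl] at hf
      by_cases hYX : Y = X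
      · subst hYX
        exact fun v hv => ⟨hN.subset Y hX hv, fun hvo => (hcomp.subset hvo).2 hv⟩
      · exact key Y _ (hN.subset Y hx) (subset_compTo_union H X Y) (hN.isComp_compTo hx hX hYX)
          fun h => hf ⟨hYX, h⟩
    · exact key _ _ (fun v hv => hv.1) (fun v hv => hv.2 X hX) (hx.2.1 X hX) hf
  · rintro (Y | o') hx hf
    · rw [← hf.2]
      exact subset_compTo_union H X Y
    · have h : o' X = o X := hf
      rw [← h]
      exact fun v hv => hv.2 X hX
  · rintro v ⟨hv1, hv2⟩
    have hvX := hv2.resolve_left hv1.2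
    exact ⟨hvX, hXo hvX⟩

/-- Finite sets that are not separated by elements of `N` lie in a part. -/
theorem exists_part (hN : TreeSeps H k N) (hS : S ⊆ H.verts) (hfin : S.Finite)
    (hsep : ∀ Z ∈ N, ¬ Separates H Z S) :
    ∃ x, (blockDec H N).IsNode x ∧ S ⊆ (blockDec H N).part x := by
  classical
  by_cases hex : ∃ X ∈ N, S ⊆ X
  · obtain ⟨X, hX, hSX⟩ := hex
    exact ⟨Sum.inl X, hX, hSX⟩
  · push Not at hex
    -- Every separator is oriented towards S; finitely many orientations differ from those towards a
    -- given X, because S is finite.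
    set o : Set V → Set V := fun Y => if Y ∈ N then compTo H Y S else ∅ with ho
    have hoN : ∀ Y ∈ N, o Y = compTo H Y S := fun Y hY => by simp [ho, hY]
    refine ⟨Sum.inr o, hN.mem_blocks (fun Y hY => by simp [ho, hY]) ?_ ?_ ?_, ?_⟩
    · intro Y hY
      rw [hoN Y hY]
      exact TreeOfTD.isComp_compTo hS (hsep Y hY) (hex Y hY)
    · intro Z hZ W hW hd
      rw [hoN Z hZ] at hd
      rw [hoN Z hZ, hoN W hW]
      obtain ⟨s, hs, hsZ⟩ := Set.not_subset.1 (hex Z hZ)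
      have h1 := mem_compTo (H := H) (S := S) ⟨hs, hsZ⟩
      exact ⟨s, h1, mem_compTo ⟨hs, Set.disjoint_left.1 hd h1⟩⟩
    · intro X hX
      refine (hN.finite_between hfin (hN.finite hX) hS (hN.subset X hX)).subset ?_
      rintro Z ⟨hZ, hZX, hne⟩
      exact ⟨hZ, hsep Z hZ, hN.nested Z hZ X hX, hex Z hZ, hN.not_subset hX hZ hZX.symm,
        hoN Z hZ ▸ hne⟩
    · refine fun v hv => ⟨hS hv, fun Z hZ => ?_⟩
      rw [hoN Z hZ]
      exact subset_compTo_union H Z S hv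

theorem isDec_blockDec (hN : TreeSeps H k N) : (blockDec H N).IsDec H := by
  refine ⟨hN.connected, fun X hX o ho hinc => ⟨_, _, _, hN.blockCut hX ho hinc⟩, ?_, ?_, ?_⟩
  · rintro (X | o) hx
    · exact hN.subset X hx
    · exact fun v hv => hv.1
  · intro v hv
    obtain ⟨x, hx, h⟩ := hN.exists_part (S := {v}) (by simpa using hv) (Set.finite_singleton v) (by
      rintro Z hZ ⟨x, ⟨rfl, -⟩, y, ⟨rfl, -⟩, h⟩
      exact h (mem_conn_self _ _ _))
    exact ⟨x, hx, h rfl⟩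
  · intro a b hab
    obtain ⟨x, hx, h⟩ := hN.exists_part (S := {a, b})
      (by rintro v (rfl | rfl); exacts [hab.fst_mem, hab.snd_mem]) (Set.toFinite _) (by
      rintro Z hZ ⟨x, ⟨rfl | rfl, hxZ⟩, y, ⟨rfl | rfl, hyZ⟩, h⟩
      · exact h (mem_conn_self _ _ _)
      · exact h (closedOff_conn _ _ _ _ (mem_conn_self _ _ _) _ hab hyZ)
      · exact h (closedOff_conn _ _ _ _ (mem_conn_self _ _ _) _ hab.symm hyZ)
      · exact h (mem_conn_self _ _ _))
    exact ⟨x, hx, h (Or.inl rfl), h (Or.inr rfl)⟩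

theorem subset_part (hN : TreeSeps H k N) (hX : X ∈ N) (hinc : (blockDec H N).inc X o) :
    X ⊆ (blockDec H N).part (Sum.inr o) := by
  refine fun v hv => ⟨hN.subset X hX hv, fun Z hZ => ?_⟩
  by_cases h : Z = X
  · subst h; exact Or.inr hv
  · rw [hinc Z hZ h]
    exact subset_compTo_union H Z X hv

/-- Every part lies on one side of every separator. -/
theorem exists_comp_part_subset (hN : TreeSeps H k N) {x : NodeOf V}
    (hx : (blockDec H N).IsNode x) (hY : Y ∈ N) :
    (blockDec H N).part x = Y ∨ ∃ C, IsComp H Y C ∧ (blockDec H N).part x ⊆ C ∪ Y := by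
  rcases x with X | o
  · by_cases h : X = Y
    · exact Or.inl h
    · exact Or.inr ⟨_, hN.isComp_compTo hx hY h, subset_compTo_union H Y X⟩
  · exact Or.inr ⟨_, hx.2.1 Y hY, fun v hv => hv.2 Y hY⟩

end TreeSeps

end BlockTree

/-! ### The core: the torso at the centre of the star. -/

section StarTorso

variable {V : Type u} {H : GraphIn V} {N : Set (Set V)} {k : ℕ} {X C : Set V} {v w : V}

/-- The torso at the centre of the star. -/
def core (H : GraphIn V) (N : Set (Set V)) : GraphIn V := (starDec H N).torso H (centre V)

theorem core_verts (H : GraphIn V) (N : Set (Set V)) :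
    (core H N).verts = H.verts \ ⋃₀ rubbish H N := rfl

theorem core_adj {a b : V} : (core H N).Adj a b ↔ a ≠ b ∧ a ∈ (core H N).verts ∧
    b ∈ (core H N).verts ∧ (H.Adj a b ∨ ∃ K ∈ rubbish H N, a ∈ nbhd H K ∧ b ∈ nbhd H K) := by
  constructor
  · rintro ⟨h1, h2, h3, h | ⟨L | o, hy, hadj, h4, h5⟩⟩
    · exact ⟨h1, h2, h3, Or.inl h⟩
    · refine ⟨h1, h2, h3, Or.inr ⟨L, hy, ?_, ?_⟩⟩
      · exact h4.resolve_left fun h => h2.2 ⟨L, hy, h⟩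
      · exact h5.resolve_left fun h => h3.2 ⟨L, hy, h⟩
    · exact hadj.elim
  · rintro ⟨h1, h2, h3, h | ⟨K, hK, h4, h5⟩⟩
    · exact ⟨h1, h2, h3, Or.inl h⟩
    · exact ⟨h1, h2, h3, Or.inr ⟨Sum.inl K, hK, trivial, Or.inr h4, Or.inr h5⟩⟩

namespace GoodSeps

/-- Deleting `X ∈ N` from the core yields the traces of the components of `H - X`. -/
theorem conn_core (hN : GoodSeps H k N) (hX : X ∈ N) (hv : v ∈ (core H N).verts \ X) :
    conn (core H N) X v = conn H X v ∩ (core H N).verts := by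
  have hvH : v ∈ H.verts \ X := ⟨hv.1.1, hv.2⟩
  have hC := isComp_conn hvH
  have hKd : ∀ K ∈ rubbish H N, Disjoint K X := by
    rintro K ⟨Y, hY, hK, hf⟩
    exact hN.avoid Y hY K hK hf X hX
  -- a vertex set `K ∈ rubbish H N` together with its neighbourhood is not separated by `X`
  have hKC : ∀ K ∈ rubbish H N, ∀ a ∈ nbhd H K, a ∈ conn H X v → K ⊆ conn H X v := by
    intro K hK a ha hac
    obtain ⟨-, c, hc, hca⟩ := ha
    have hcX : c ∉ X := Set.disjoint_left.1 (hKd K hK) hc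
    have hcC : c ∈ conn H X v := closedOff_conn H X v a hac c hca.symm hcX
    obtain ⟨Y, hY, hKY, hf⟩ := hK
    exact hKY.subset_of_disjoint (hN.avoid Y hY K hKY hf X hX) hC hc hcC
  refine Set.Subset.antisymm (conn_subset ?_ ⟨mem_conn_self _ _ _, hv.1⟩) ?_
  · rintro a ⟨ha, ha'⟩ b hab hb
    obtain ⟨-, -, hb', h | ⟨K, hK, haK, hbK⟩⟩ := core_adj.1 hab
    · exact ⟨closedOff_conn H X v a ha b h hb, hb'⟩
    · obtain ⟨-, c, hc, hcb⟩ := hbK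
      exact ⟨closedOff_conn H X v c (hKC K hK a haK ha hc) b hcb hb, hb'⟩
  -- A walk in H may run through a split-off component K. Such a vertex is accepted if all
  -- neighbours of K outside X are already reached in the core, where the neighbourhood of K is a
  -- clique.
  · have hcl : ClosedOff H X {w | (w ∈ (core H N).verts → w ∈ conn (core H N) X v) ∧
        ∀ K ∈ rubbish H N, w ∈ K → ∀ a ∈ nbhd H K, a ∉ X → a ∈ conn (core H N) X v} := by
      rintro a ⟨ha1, ha2⟩ b hab hb
      by_cases haR : a ∈ ⋃₀ rubbish H N
      · obtain ⟨K, hK, haK⟩ := haR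
        refine ⟨fun hbc => ha2 K hK haK b ⟨fun h => hbc.2 ⟨K, hK, h⟩, a, haK, hab⟩ hb,
          fun L hL hbL c hc hcX => ?_⟩
        by_cases hKL : K = L
        · subst hKL
          exact ha2 K hK haK c hc hcX
        · have h1 : b ∈ nbhd H K := ⟨Set.disjoint_right.1 (hN.rubbish_disjoint hK hL hKL) hbL,
            a, haK, hab⟩
          exact absurd ⟨L, hL, hbL⟩ (hN.nbhd_subset_centre hK h1).2
      · have hac : a ∈ (core H N).verts := ⟨hab.fst_mem, haR⟩
        have ha := ha1 hac
        refine ⟨fun hbc => closedOff_conn _ _ _ a ha b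
          (core_adj.2 ⟨hab.ne, hac, hbc, Or.inl hab⟩) hb, fun L hL hbL c hc hcX => ?_⟩
        have haL : a ∈ nbhd H L := ⟨fun h => haR ⟨L, hL, h⟩, b, hbL, hab.symm⟩
        by_cases hac' : a = c
        · rwa [← hac']
        · exact closedOff_conn _ _ _ a ha c (core_adj.2 ⟨hac', hac, hN.nbhd_subset_centre hL hc,
            Or.inr ⟨L, hL, haL, hc⟩⟩) hcX
    rintro w ⟨hw, hw'⟩
    refine (conn_subset hcl ?_ hw).1 hw'
    exact ⟨fun _ => mem_conn_self _ _ _, fun K hK hvK => absurd ⟨K, hK, hvK⟩ hv.1.2⟩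

/-- A component of the core minus X is the trace of a full component of H - X. If a vertex x of X
has its neighbour there inside a split-off K, then K has another neighbour in the component, and the
torso joins it to x. -/
theorem treeSeps (hN : GoodSeps H k N) : TreeSeps (core H N) k N := by
  refine ⟨fun X hX => hN.subset_centre hX, fun X hX => (hN.tight X hX).2.1, ?_, ?_⟩
  · rintro X hX C ⟨v, hv, rfl⟩ x hx
    have hC := isComp_conn (H := H) (X := X) (v := v) ⟨hv.1.1, hv.2⟩
    have hf : Full H X (conn H X v) := by
      by_contra hf
      exact hv.1.2 ⟨_, ⟨X, hX, hC, hf⟩, mem_conn_self _ _ _⟩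
    obtain ⟨c, hc, hcx⟩ := hf x hx
    have hxc := hN.subset_centre hX hx
    rw [hN.conn_core hX hv]
    by_cases hcR : c ∈ ⋃₀ rubbish H N
    · obtain ⟨K, hK, hcK⟩ := hcR
      have hKC : K ⊆ conn H X v := by
        obtain ⟨Y, hY, hKY, hfK⟩ := hK
        exact hKY.subset_of_disjoint (hN.avoid Y hY K hKY hfK X hX) hC hcK hc
      have hxK : x ∈ nbhd H K := ⟨fun h => hxc.2 ⟨K, hK, h⟩, c, hcK, hcx⟩
      -- `K` is not the whole component, so it has a neighbour in it
      have hex : ∃ b ∈ nbhd H K, b ∈ conn H X v := by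
        by_contra! hcon
        have hcl : ClosedOff H X K := by
          intro a ha b hab hb
          by_contra hbK
          exact hcon b ⟨hbK, a, ha, hab⟩ (closedOff_conn H X v a (hKC ha) b hab hb)
        have : v ∈ K := by
          have h1 := conn_subset hcl hcK
          exact h1 (conn_symm hv.2 hc)
        exact hv.1.2 ⟨K, hK, this⟩
      obtain ⟨b, hbK, hb⟩ := hex
      have hbc := hN.nbhd_subset_centre hK hbK
      refine ⟨b, ⟨hb, hbc⟩, core_adj.2 ⟨?_, hbc, hxc, Or.inr ⟨K, hK, hbK, hxK⟩⟩⟩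
      rintro rfl
      exact (hC.subset hb).2 hx
    · have hcc : c ∈ (core H N).verts := ⟨hcx.fst_mem, hcR⟩
      exact ⟨c, ⟨hc, hcc⟩, core_adj.2 ⟨hcx.ne, hcc, hxc, Or.inl hcx⟩⟩
  · rintro X hX Y hY ⟨x, hx, y, hy, hxy⟩
    have hxc := hN.subset_centre hY hx.1
    rw [hN.conn_core hX ⟨hxc, hx.2⟩] at hxy
    exact hN.nested X hX Y hY ⟨x, hx, y, hy, fun h => hxy ⟨h, hN.subset_centre hY hy.1⟩⟩

end GoodSeps

end StarTorso

/-! ### One round of the construction: star, block tree, and passage to the torsos. -/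

section Steps

variable {V : Type u} {G H K : GraphIn V} {Ps : Set (Set (Set V × Set V))} {k : ℕ}
  {P P' : Set (Set V × Set V)} {ℓ : ℕ∞} {X Y C : Set V} {p q r : Set V × Set V}

theorem restrict_restrict (h : K.verts ⊆ H.verts) (p : Set V × Set V) :
    restrict K (restrict H p) = restrict K p := by
  simp only [restrict, Set.inter_assoc, Set.inter_eq_right.2 h]

theorem restrict_mem_induced (h : K.verts ⊆ H.verts) (hr : r ∈ induced H P)
    (hs : IsSeparation K (restrict K r)) : restrict K r ∈ induced K P := by
  obtain ⟨-, p, hp, rfl⟩ := hr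
  exact ⟨hs, p, hp, restrict_restrict h p⟩

theorem Lives.mono (h : K.verts ⊆ H.verts) (hl : Lives K P) : Lives H P :=
  fun p hp hs => hl p hp (h.trans hs)

/-- Separations that distinguish induced profiles lift. -/
theorem exists_lift_distinguishes {ℓ' : ℕ∞} (hGH : Lifts G H) (hP : RPProfile G ℓ P)
    (hP' : RPProfile G ℓ' P') (hl : Lives H P) (hl' : Lives H P') (hr : r ∈ induced H P)
    (hr' : r.swap ∈ induced H P') :
    ∃ p, IsSeparation G p ∧ restrict H p = r ∧ p ∈ P ∧ p.swap ∈ P' ∧ order p = order r := by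
  obtain ⟨p, hp, rfl, hpi⟩ := hGH.2 r hr.1
  have hsub : p.1 ∩ p.2 ⊆ H.verts := hpi ▸ fun v hv => hv.1.2
  refine ⟨p, hp, rfl, mem_of_restrict_mem hP hl hGH.1 hr hp hsub,
    mem_of_restrict_mem hP' hl' hGH.1 hr' hp.swap ?_, ?_⟩
  · rw [Prod.fst_swap, Prod.snd_swap, Set.inter_comm]; exact hsub
  · rw [order, hpi]; rfl

/-- The profiles that the elements of `Ps` that live in `H` induce on `H`. -/
def familyOn (Ps : Set (Set (Set V × Set V))) (H : GraphIn V) : Set (Set (Set V × Set V)) :=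
  {R | ∃ P ∈ Ps, Lives H P ∧ R = induced H P}

/-- The canonical nested set of separators of size `k` of `H`. -/
def nestSeps (Ps : Set (Set (Set V × Set V))) (H : GraphIn V) (k : ℕ) : Set (Set V) :=
  -- The condition does not depend on X. It empties the set if the optimal separators are not good,
  -- so that the construction is defined for arbitrary sets `Ps`.
  {X ∈ optimalSeps H k (familyOn Ps H) | GoodSeps H k (optimalSeps H k (familyOn Ps H))}

theorem goodSeps_nestSeps (Ps : Set (Set (Set V × Set V))) (H : GraphIn V) (k : ℕ) :
    GoodSeps H k (nestSeps Ps H k) := by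
  refine ⟨fun X hX => hX.2.tight X hX.1, fun X hX Y hY => hX.2.nested X hX.1 Y hY.1,
    fun X hX K hK hf Y hY => hX.2.avoid X hX.1 K hK hf Y hY.1⟩

/-- Any two elements of `Ps` that live in `H` are efficiently distinguished in `H` by a separation
of order at least `k`. -/
structure Invariant (G : GraphIn V) (Ps : Set (Set (Set V × Set V))) (k : ℕ) (H : GraphIn V) :
    Prop where
  lifts : Lifts G H
  exists_distinguishes : ∀ P ∈ Ps, ∀ P' ∈ Ps, Lives H P → Lives H P' → P ≠ P' →
    ∃ q, q ∈ induced H P ∧ q.swap ∈ induced H P' ∧ k ≤ order q ∧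
      ∀ p, p ∈ P → p.swap ∈ P' → order q ≤ order p

theorem Invariant.profileFamily (hI : Invariant G Ps k H) (hPs : ∀ P ∈ Ps, ∃ ℓ, RPProfile G ℓ P) :
    ProfileFamily H k (familyOn Ps H) := by
  refine ⟨?_, ?_⟩
  · rintro _ ⟨P, hP, hl, rfl⟩
    obtain ⟨ℓ, h⟩ := hPs P hP
    exact ⟨ℓ, hl.rpProfile_induced h hI.lifts⟩
  · rintro _ ⟨P, hP, hl, rfl⟩ _ ⟨P', hP', hl', rfl⟩ q hq hq'
    obtain ⟨ℓ, h⟩ := hPs P hP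
    obtain ⟨ℓ', h'⟩ := hPs P' hP'
    by_cases hne : P = P'
    · subst hne
      exact absurd hq' ((hl.rpProfile_induced h hI.lifts).swap_not_mem hq)
    · obtain ⟨r, -, -, hk, hr⟩ := hI.exists_distinguishes P hP P' hP' hl hl' hne
      obtain ⟨p, -, -, hp, hp', ho⟩ := exists_lift_distinguishes hI.lifts h h' hl hl' hq hq'
      exact ho ▸ hk.trans (hr p hp hp')

theorem Invariant.nestSeps_eq (hI : Invariant G Ps k H) (hPs : ∀ P ∈ Ps, ∃ ℓ, RPProfile G ℓ P) :
    nestSeps Ps H k = optimalSeps H k (familyOn Ps H) := by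
  have := (hI.profileFamily hPs).goodSeps
  ext X
  exact ⟨fun h => h.1, fun h => ⟨h, this⟩⟩

theorem core_verts_subset (H : GraphIn V) (N : Set (Set V)) : (core H N).verts ⊆ H.verts :=
  Set.sdiff_subset

theorem GoodSeps.lifts_core {N : Set (Set V)} (hN : GoodSeps H k N) : Lifts H (core H N) := by
  have := ((starDec H N).toDec hN.isDec_starDec).lifts_torso ⟨centre V, isNode_centre H N⟩
  rwa [RawDec.torso_eq] at this

theorem GoodSeps.isSeparation_restrict_core {N : Set (Set V)} (hN : GoodSeps H k N)
    (hp : IsSeparation H p) (h : ∀ K ∈ rubbish H N, Disjoint K (p.1 ∩ p.2)) :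
    IsSeparation (core H N) (restrict (core H N) p) := by
  have := ((starDec H N).toDec hN.isDec_starDec).isSeparation_restrict
    ⟨centre V, isNode_centre H N⟩ hp ?_
  · rwa [RawDec.torso_eq] at this
  · rintro ⟨K | o, hs⟩ hadj x ⟨hx, hxc⟩ y ⟨hy, hyc⟩ hxp hyp
    · have hxn : x ∈ nbhd H K := hx.resolve_left fun h => hxc.2 ⟨K, hs, h⟩
      have hyn : y ∈ nbhd H K := hy.resolve_left fun h => hyc.2 ⟨K, hs, h⟩
      obtain ⟨-, c, hc, hcx⟩ := hxn
      obtain ⟨-, d, hd, hdy⟩ := hyn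
      have hK := h K hs
      obtain ⟨Z, hZ, hKZ, -⟩ := hs
      rcases hKZ.subset_or_subset hp hK with h1 | h1
      · exact hp.2 d (h1 hd) y hyp hdy
      · exact hp.2 x hxp c (h1 hc) hcx.symm
    · exact hadj.elim

/-- Distinguishing separations can be chosen so that their trace on the torso is a separation, if
those that separate an adhesion set can be uncrossed. -/
theorem exists_isSeparation_restrict {R R' : Set (Set V × Set V)} {m m' : ℕ∞}
    (hR : RPProfile H m R) (hR' : RPProfile H m' R') (D : TreeDecomposition H) (t : D.Node)
    (h : ∀ p, p ∈ R → p.swap ∈ R' → ∀ s, D.tree.Adj t s → ∀ x ∈ D.part s ∩ D.part t,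
      ∀ y ∈ D.part s ∩ D.part t, x ∈ p.1 \ p.2 → y ∈ p.2 \ p.1 →
      ∃ c, c ∈ R ∧ c ∈ R' ∧ (∃ Q n, RPProfile H n Q ∧ c.swap ∈ Q ∧
        ∀ r, r ∈ R → r.swap ∈ Q → order c ≤ order r) ∧ c.1 ∩ c.2 ⊆ D.part t ∧
        ∃ v ∈ p.1 ∩ p.2, v ∉ c.2 ∧ v ∉ D.part t)
    (hq : q ∈ R) (hq' : q.swap ∈ R') :
    ∃ p, p ∈ R ∧ p.swap ∈ R' ∧ order p ≤ order q ∧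
      IsSeparation (D.torso t) (restrict (D.torso t) p) := by
  -- Induction on the number of separator vertices outside the part: uncrossing with c adds only
  -- vertices of the part and loses v.
  obtain ⟨n, hn⟩ : ∃ n, n = ((q.1 ∩ q.2) \ D.part t).ncard := ⟨_, rfl⟩
  induction n using Nat.strong_induction_on generalizing q with
  | _ n ih =>
  by_cases hs : IsSeparation (D.torso t) (restrict (D.torso t) q)
  · exact ⟨q, hq, hq', le_rfl, hs⟩
  · have hex : ∃ s, D.tree.Adj t s ∧ ∃ x ∈ D.part s ∩ D.part t, ∃ y ∈ D.part s ∩ D.part t,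
        x ∈ q.1 \ q.2 ∧ y ∈ q.2 \ q.1 := by
      by_contra! hcon
      exact hs (D.isSeparation_restrict t (hR.isSeparation hq) fun s hst x hx y hy hxq hyq =>
        hcon s hst x hx y hy hxq hyq)
    obtain ⟨s, hst, x, hx, y, hy, hxq, hyq⟩ := hex
    obtain ⟨c, hc, hc', ⟨Q, l, hQ, hcQ, hmin⟩, hcs, v, hv, hvc, hvt⟩ :=
      h q hq hq' s hst x hx y hy hxq hyq
    obtain ⟨p, hp, hp', ho, hsub⟩ := exists_uncrossed hR hR' hQ hc hc' hcQ hmin hq hq'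
    have hlt : ((p.1 ∩ p.2) \ D.part t).ncard < n := by
      rw [hn]
      refine Set.ncard_lt_ncard ((Set.ssubset_iff_of_subset ?_).2
        ⟨v, ⟨hv, hvt⟩, fun h => hvc (hsub h.1).2⟩) ((hR.finite hq).sdiff)
      rintro w ⟨hw, hwt⟩
      exact ⟨(hsub hw).1.resolve_right fun h => hwt (hcs h), hwt⟩
    obtain ⟨p', h1, h2, h3, h4⟩ := ih _ hlt hp hp' rfl
    exact ⟨p', h1, h2, h3.trans ho, h4⟩

/-- Distinct elements of `Ps` that live in `H` live in the core. -/
theorem Invariant.lives_core (hI : Invariant G Ps k H)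
    (hPs : ∀ P ∈ Ps, ∃ ℓ, RPProfile G ℓ P) (hP : P ∈ Ps) (hP' : P' ∈ Ps)
    (hl : Lives H P) (hl' : Lives H P') (hne : P ≠ P') :
    Lives (core H (nestSeps Ps H k)) P := by
  obtain ⟨ℓ, hPr⟩ := hPs P hP
  have hR := hl.rpProfile_induced hPr hI.lifts
  have hN := goodSeps_nestSeps Ps H k
  have hF := hI.profileFamily hPs
  obtain ⟨q, hq, -, hkq, -⟩ := hI.exists_distinguishes P hP P' hP' hl hl' hne
  have hk : (k : ℕ∞) < ℓ := hkq.trans_lt (hR.order_lt hq)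
  have := hl.torso hPr hI.lifts ((starDec H _).toDec hN.isDec_starDec)
    ⟨centre V, isNode_centre H _⟩ ?_
  · rwa [RawDec.torso_eq] at this
  · rintro ⟨K | o, hs⟩ hadj
    · have hside := (hN.starCut hs).side_eq hN.isDec_starDec hs rfl
        (Set.union_subset (Set.union_subset (rubbish_subset hs) (nbhd_subset_verts H K))
          Set.sdiff_subset)
      have e1 : ((starDec H (nestSeps Ps H k)).toDec hN.isDec_starDec).side ⟨Sum.inl K, hs⟩
        ⟨centre V, isNode_centre H _⟩ = K ∪ nbhd H K := hside.1
      have e2 : ((starDec H (nestSeps Ps H k)).toDec hN.isDec_starDec).side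
        ⟨centre V, isNode_centre H _⟩ ⟨Sum.inl K, hs⟩ = H.verts \ K := hside.2
      have hsep := ((starDec H (nestSeps Ps H k)).toDec hN.isDec_starDec).isSeparation_side
        ⟨Sum.inl K, hs⟩ ⟨centre V, isNode_centre H _⟩
      rw [e1, e2] at hsep ⊢
      have hord : order (K ∪ nbhd H K, H.verts \ K) < k := by
        refine lt_of_le_of_lt (Set.encard_le_encard ?_) (hN.encard_nbhd_lt hs)
        rintro v ⟨h | h, h'⟩
        · exact absurd h h'.2
        · exact h
      refine (hR.mem_or_mem hsep (hord.trans hk)).resolve_right fun hmem => ?_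
      -- If P pointed into K, the component it chooses at X would have to be K. But chosen
      -- components are full, since some profile chooses a different one.
      obtain ⟨X, hX, hKX, hf⟩ := hs
      rw [hI.nestSeps_eq hPs] at hX
      obtain ⟨hXt, Q, hQ, Q', hQ', C, D, hC, hD, hCD, -, -, hCQ, hDQ⟩ := hF.exists_of_mem hX
      obtain ⟨L, hL, hLR⟩ := hR.exists_comp hXt.1 (hXt.2.1 ▸ hk)
      have hRF : induced H P ∈ familyOn Ps H := ⟨P, hP, hl, rfl⟩
      by_cases hLK : L = K
      · subst hLK
        rcases ne_or_eq L C with h | h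
        · exact hf (hF.full_of_ne hRF hQ hXt.1 hXt.2.1 hL hLR hC hCQ h)
        · exact hf (hF.full_of_ne hRF hQ' hXt.1 hXt.2.1 hL hLR hD hDQ (h ▸ hCD))
      · refine hR.not_comp_subset hLR hmem (Set.disjoint_left.2 fun v hv hv' => ?_)
        rcases hv' with hv' | hv'
        · exact hLK (hL.eq_of_mem hKX hv hv')
        · exact (hL.subset hv).2 (nbhd_subset hKX hv')
    · exact hadj.elim

/-- The trace on the core of a separation with separator in `N`. -/
theorem restrict_core_mem (hp : p ∈ induced H P) (hX : p.1 ∩ p.2 ∈ nestSeps Ps H k) :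
    restrict (core H (nestSeps Ps H k)) p ∈ induced (core H (nestSeps Ps H k)) P ∧
      (restrict (core H (nestSeps Ps H k)) p).1 ∩ (restrict (core H (nestSeps Ps H k)) p).2 =
        p.1 ∩ p.2 := by
  have hN := goodSeps_nestSeps Ps H k
  refine ⟨restrict_mem_induced (core_verts_subset _ _) hp
    (hN.isSeparation_restrict_core hp.1 ?_), ?_⟩
  · rintro K ⟨Y, hY, hK, hf⟩
    exact hN.avoid Y hY K hK hf _ hX
  · refine Set.Subset.antisymm (fun v hv => ⟨hv.1.1, hv.2.1⟩) fun v hv => ?_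
    have := hN.subset_centre hX hv
    exact ⟨⟨hv.1, this⟩, ⟨hv.2, this⟩⟩

/-- Distinct elements of `Ps` that live in the core are efficiently distinguished there; if the
order is `k`, then by a separation with separator in `N`. -/
theorem Invariant.exists_distinguishes_core (hI : Invariant G Ps k H)
    (hPs : ∀ P ∈ Ps, ∃ ℓ, RPProfile G ℓ P) (hP : P ∈ Ps) (hP' : P' ∈ Ps) (hl : Lives (core H (nestSeps Ps H k)) P)
    (hl' : Lives (core H (nestSeps Ps H k)) P') (hne : P ≠ P') :
    ∃ q, q ∈ induced (core H (nestSeps Ps H k)) P ∧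
      q.swap ∈ induced (core H (nestSeps Ps H k)) P' ∧ k ≤ order q ∧
      (∀ p, p ∈ P → p.swap ∈ P' → order q ≤ order p) ∧
      (order q = k → q.1 ∩ q.2 ∈ nestSeps Ps H k) := by
  obtain ⟨ℓ, hPr⟩ := hPs P hP
  obtain ⟨ℓ', hPr'⟩ := hPs P' hP'
  have hlH := hl.mono (core_verts_subset _ _)
  have hlH' := hl'.mono (core_verts_subset _ _)
  have hR := hlH.rpProfile_induced hPr hI.lifts
  have hR' := hlH'.rpProfile_induced hPr' hI.lifts
  have hN := goodSeps_nestSeps Ps H k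
  have hF := hI.profileFamily hPs
  have hRF : induced H P ∈ familyOn Ps H := ⟨P, hP, hlH, rfl⟩
  have hRF' : induced H P' ∈ familyOn Ps H := ⟨P', hP', hlH', rfl⟩
  have hlC := hI.lifts.trans hN.lifts_core
  obtain ⟨q, hq, hq', hkq, hqmin⟩ := hI.exists_distinguishes P hP P' hP' hlH hlH' hne
  -- every distinguishing separation of `H` has at least the order of `q`
  have hmin : ∀ r, r ∈ induced H P → r.swap ∈ induced H P' → order q ≤ order r := by
    intro r hr hr'
    obtain ⟨p, -, -, hp, hp', ho⟩ := exists_lift_distinguishes hI.lifts hPr hPr' hlH hlH' hr hr'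
    exact ho ▸ hqmin p hp hp'
  rcases hkq.eq_or_lt with hk | hk
  -- In order k a distinguishing separator with fewest crossings belongs to N. It avoids all
  -- split-off components, so its separation restricts to the core.
  · obtain ⟨X, hX, hXmin⟩ := (measure fun X => (crossers H k X).ncard).wf.has_min
      (sepSets k (induced H P) (induced H P')) ⟨_, q, hq, hq', rfl, hk.symm⟩
    have hXN : X ∈ nestSeps Ps H k := by
      rw [hI.nestSeps_eq hPs]
      exact ⟨_, hRF, _, hRF', hX, fun X' hX' => not_lt.1 (hXmin X' hX')⟩
    obtain ⟨p, hp, hp', rfl, hpk⟩ := hX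
    obtain ⟨h1, h2⟩ := restrict_core_mem hp hXN
    have h3 := (restrict_core_mem hp' (by
      rw [Prod.fst_swap, Prod.snd_swap, Set.inter_comm]; exact hXN)).1
    have ho : order (restrict (core H (nestSeps Ps H k)) p) = k := by rw [order, h2, hpk]
    refine ⟨_, h1, h3, ho.ge, fun r hr hr' => ?_, fun _ => h2 ▸ hXN⟩
    rw [ho, hk]
    exact hqmin r hr hr'
  · obtain ⟨p, hp, hp', ho, hs⟩ := exists_isSeparation_restrict hR hR'
      ((starDec H _).toDec hN.isDec_starDec) ⟨centre V, isNode_centre H _⟩ (by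
        rintro p hp hp' ⟨K | o, hs⟩ hadj x ⟨hx, hxc⟩ y ⟨hy, hyc⟩ hxp hyp
        · have hxn : x ∈ nbhd H K := hx.resolve_left fun h => hxc.2 ⟨K, hs, h⟩
          have hyn : y ∈ nbhd H K := hy.resolve_left fun h => hyc.2 ⟨K, hs, h⟩
          obtain ⟨-, c, hc, hcx⟩ := hxn
          obtain ⟨-, d, hd, hdy⟩ := hyn
          have hKs := hs
          obtain ⟨X, hX, hKX, hf⟩ := hs
          have hXc := hN.subset_centre hX
          have hXo := hX
          rw [hI.nestSeps_eq hPs] at hXo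
          have hps := hR.isSeparation hp
          have hKp : ¬ Disjoint K (p.1 ∩ p.2) := by
            intro hd'
            rcases hKX.subset_or_subset hps hd' with h1 | h1
            · exact hps.2 d (h1 hd) y hyp hdy
            · exact hps.2 x hxp c (h1 hc) hcx.symm
          obtain ⟨v, hvK, hvp⟩ := Set.not_disjoint_iff.1 hKp
          obtain ⟨hXt, Q, hQ, Q', hQ', C, D, hC, hD, hCD, -, -, hCQ, hDQ⟩ := hF.exists_of_mem hXo
          obtain ⟨L, hL, hLR⟩ := hR.exists_comp hXt.1
            (hXt.2.1 ▸ hk.trans (hR.order_lt hq))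
          obtain ⟨L', hL', hLR'⟩ := hR'.exists_comp hXt.1
            (hXt.2.1 ▸ hk.trans (order_swap q ▸ hR'.order_lt hq'))
          -- In order greater than k both profiles choose the same component L at X. The uncrossing
          -- partner is a profile choosing another component; the separator loses a vertex in K,
          -- which differs from L because L is full.
          have hLL' : L = L' := by
            by_contra hcon
            have h1 := hmin _ hLR (hR'.compSep_swap_mem hXt.1 hL' hLR' hL (Ne.symm hcon))
            rw [order_compSep hXt.1 hL, hXt.2.1] at h1
            exact absurd h1 (not_le.2 hk)
          subst hLL'
          have hex : ∃ Q ∈ familyOn Ps H, ∃ C, IsComp H X C ∧ compSep H X C ∈ Q ∧ L ≠ C := by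
            rcases ne_or_eq L C with h | h
            · exact ⟨Q, hQ, C, hC, hCQ, h⟩
            · exact ⟨Q', hQ', D, hD, hDQ, h ▸ hCD⟩
          obtain ⟨Q, hQ, C, hC, hCQ, hLC⟩ := hex
          obtain ⟨n, hQr⟩ := hF.exists_profile Q hQ
          have hLf := hF.full_of_ne hRF hQ hXt.1 hXt.2.1 hL hLR hC hCQ hLC
          refine ⟨compSep H X L, hLR, hLR', ⟨Q, n, hQr,
            hQr.compSep_swap_mem hXt.1 hC hCQ hL hLC.symm, fun r hr hr' => ?_⟩, ?_, v, hvp, ?_, ?_⟩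
          · rw [order_compSep hXt.1 hL, hXt.2.1]
            exact hF.le_order _ hRF Q hQ r hr hr'
          · rw [compSep_inter hXt.1 hL]
            exact hXc
          · rintro (h | h)
            · have := hL.eq_of_mem hKX h hvK
              exact hf (this ▸ hLf)
            · exact (hKX.subset hvK).2 h
          · exact fun h => h.2 ⟨K, hKs, hvK⟩
        · exact hadj.elim) hq hq'
    rw [RawDec.torso_eq] at hs
    have h1 := restrict_mem_induced (core_verts_subset _ _) hp hs
    have h2 := restrict_mem_induced (core_verts_subset _ _) hp' hs.swap
    obtain ⟨p₀, -, -, hp₀, hp₀', ho₀⟩ := exists_lift_distinguishes hlC hPr hPr' hl hl' h1 h2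
    have h3 : order q ≤ order (restrict (core H (nestSeps Ps H k)) p) := ho₀ ▸ hqmin p₀ hp₀ hp₀'
    refine ⟨_, h1, h2, hkq.trans h3, fun r hr hr' => ?_, fun h => ?_⟩
    · exact ((order_restrict_le _ p).trans ho).trans (hqmin r hr hr')
    · exact absurd (h3.trans h.le) (not_le.2 hk)

theorem Invariant.core (hI : Invariant G Ps k H) (hPs : ∀ P ∈ Ps, ∃ ℓ, RPProfile G ℓ P) :
    Invariant G Ps k (core H (nestSeps Ps H k)) := by
  refine ⟨hI.lifts.trans (goodSeps_nestSeps Ps H k).lifts_core, fun P hP P' hP' hl hl' hne => ?_⟩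
  obtain ⟨q, h1, h2, h3, h4, -⟩ := hI.exists_distinguishes_core hPs hP hP' hl hl' hne
  exact ⟨q, h1, h2, h3, h4⟩

/-- Every element of `N` distinguishes two profiles that live in the core. -/
theorem Invariant.exists_of_mem_nestSeps (hI : Invariant G Ps k H)
    (hPs : ∀ P ∈ Ps, ∃ ℓ, RPProfile G ℓ P) (hX : X ∈ nestSeps Ps H k) :
    ∃ Q ∈ familyOn Ps (TreeOfTD.core H (nestSeps Ps H k)),
    ∃ Q' ∈ familyOn Ps (TreeOfTD.core H (nestSeps Ps H k)),
    ∃ C D, IsComp (TreeOfTD.core H (nestSeps Ps H k)) X C ∧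
      IsComp (TreeOfTD.core H (nestSeps Ps H k)) X D ∧ C ≠ D ∧
      compSep (TreeOfTD.core H (nestSeps Ps H k)) X C ∈ Q ∧
      compSep (TreeOfTD.core H (nestSeps Ps H k)) X D ∈ Q' := by
  have hXo := hX
  rw [hI.nestSeps_eq hPs] at hXo
  obtain ⟨_, ⟨P, hP, hl, rfl⟩, _, ⟨P', hP', hl', rfl⟩, ⟨p, hp, hp', rfl, hpk⟩, -⟩ := hXo
  have hne : P ≠ P' := by
    rintro rfl
    obtain ⟨ℓ, hPr⟩ := hPs P hP
    exact (hl.rpProfile_induced hPr hI.lifts).swap_not_mem hp hp'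
  have hlc := hI.lives_core hPs hP hP' hl hl' hne
  have hlc' := hI.lives_core hPs hP' hP hl' hl hne.symm
  obtain ⟨h1, h2⟩ := restrict_core_mem hp hX
  have h3 := (restrict_core_mem hp' (by
    rw [Prod.fst_swap, Prod.snd_swap, Set.inter_comm]; exact hX)).1
  have hF := (hI.core hPs).profileFamily hPs
  have hQ : induced (TreeOfTD.core H (nestSeps Ps H k)) P ∈
    familyOn Ps (TreeOfTD.core H (nestSeps Ps H k)) := ⟨P, hP, hlc, rfl⟩
  have hQ' : induced (TreeOfTD.core H (nestSeps Ps H k)) P' ∈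
    familyOn Ps (TreeOfTD.core H (nestSeps Ps H k)) := ⟨P', hP', hlc', rfl⟩
  obtain ⟨C, D, hC, hD, hCD, -, -, -, -, hCQ, hDQ⟩ := hF.tight hQ hQ' h1 h3 (by rw [order, h2, hpk])
  rw [h2] at hC hD hCQ hDQ
  exact ⟨_, hQ, _, hQ', C, D, hC, hD, hCD, hCQ, hDQ⟩

/-- A profile that lives in a torso does not point away from its part. -/
theorem not_subset_of_lives {S : Set V} (hS : K.verts = S) (hl : Lives K P)
    (hC : compSep H X C ∈ induced H P) : ¬ S ⊆ H.verts \ C := by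
  intro hs
  obtain ⟨-, p, hp, hpe⟩ := hC
  have h1 : H.verts \ C = p.1 ∩ H.verts := congrArg Prod.fst hpe
  exact hl p hp (by rw [hS]; exact fun v hv => (h1.subset (hs hv)).1)

theorem TreeSeps.torso_verts_subset {N : Set (Set V)} (hN : TreeSeps H k N) {x : NodeOf V}
    (hx : (blockDec H N).IsNode x) : ((blockDec H N).torso H x).verts ⊆ H.verts :=
  hN.isDec_blockDec.part_subset x hx

theorem TreeSeps.lifts_torso {N : Set (Set V)} (hN : TreeSeps H k N) {x : NodeOf V}
    (hx : (blockDec H N).IsNode x) : Lifts H ((blockDec H N).torso H x) := by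
  have := ((blockDec H N).toDec hN.isDec_blockDec).lifts_torso ⟨x, hx⟩
  rwa [RawDec.torso_eq] at this

theorem TreeSeps.side_eq {N : Set (Set V)} (hN : TreeSeps H k N) {o : Set V → Set V} (hX : X ∈ N)
    (ho : o ∈ (blockDec H N).blocks) (hinc : (blockDec H N).inc X o) :
    (((blockDec H N).toDec hN.isDec_blockDec).side ⟨Sum.inl X, hX⟩ ⟨Sum.inr o, ho⟩,
      ((blockDec H N).toDec hN.isDec_blockDec).side ⟨Sum.inr o, ho⟩ ⟨Sum.inl X, hX⟩) =
      compSep H X (o X) := by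
  have h := (hN.blockCut hX ho hinc).side_eq hN.isDec_blockDec hX ho
    (Set.union_subset Set.sdiff_subset (Set.union_subset (fun v hv => ((ho.2.1 X hX).subset hv).1)
      (hN.subset X hX)))
  exact Prod.ext h.1 h.2

/-- The torsos of the block tree satisfy the invariant for the next order. -/
theorem Invariant.torso (hI : Invariant G Ps k H) (hPs : ∀ P ∈ Ps, ∃ ℓ, RPProfile G ℓ P)
    {x : NodeOf V}
    (hx : (blockDec (TreeOfTD.core H (nestSeps Ps H k)) (nestSeps Ps H k)).IsNode x) :
    Invariant G Ps (k + 1) ((blockDec (TreeOfTD.core H (nestSeps Ps H k)) (nestSeps Ps H k)).torso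
      (TreeOfTD.core H (nestSeps Ps H k)) x) := by
  have hT := (goodSeps_nestSeps Ps H k).treeSeps
  have hIc := hI.core hPs
  have hcore := fun P hP P' hP' hl hl' hne =>
    hI.exists_distinguishes_core (P := P) (P' := P') hPs hP hP' hl hl' hne
  have hexm := fun X hX => hI.exists_of_mem_nestSeps (X := X) hPs hX
  generalize nestSeps Ps H k = N at *
  generalize TreeOfTD.core H N = B at *
  have hF := hIc.profileFamily hPs
  have hGK := hIc.lifts.trans (hT.lifts_torso hx)
  have hsub := hT.torso_verts_subset hx
  refine ⟨hGK, fun P hP P' hP' hlt hlt' hne => ?_⟩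
  have hl := hlt.mono hsub
  have hl' := hlt'.mono hsub
  obtain ⟨ℓ, hPr⟩ := hPs P hP
  obtain ⟨ℓ', hPr'⟩ := hPs P' hP'
  have hR := hl.rpProfile_induced hPr hIc.lifts
  have hR' := hl'.rpProfile_induced hPr' hIc.lifts
  have hRF : induced B P ∈ familyOn Ps B := ⟨P, hP, hl, rfl⟩
  have hRF' : induced B P' ∈ familyOn Ps B := ⟨P', hP', hl', rfl⟩
  obtain ⟨q, hq, hq', hkq, hqmin, hqN⟩ := hcore P hP P' hP' hl hl' hne
  -- In order k the separator of q would be in N, and the profiles would choose distinct components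
  -- there. The part lies on one side of this separator, so one of the profiles would point away
  -- from it.
  have hlt_k : (k : ℕ∞) < order q := by
    refine lt_of_le_of_ne hkq fun hk => ?_
    have hY := hqN hk.symm
    obtain ⟨C, D, hC, hD, hCD, -, -, -, -, hCR, hDR⟩ := hF.tight hRF hRF' hq hq' hk.symm
    have h1 := not_subset_of_lives rfl hlt hCR
    have h2 := not_subset_of_lives rfl hlt' hDR
    have key : ∀ C E, IsComp B (q.1 ∩ q.2) C → IsComp B (q.1 ∩ q.2) E → C ≠ E →
        (blockDec B N).part x ⊆ E ∪ (q.1 ∩ q.2) → (blockDec B N).part x ⊆ B.verts \ C := by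
      intro C E hC hE hCE hs v hv
      refine ⟨hsub hv, fun hvC => ?_⟩
      rcases hs hv with h | h
      · exact hCE (hC.eq_of_mem hE hvC h)
      · exact (hC.subset hvC).2 h
    rcases hT.exists_comp_part_subset hx hY with h | ⟨E, hE, hs⟩
    · exact h1 fun v hv => ⟨hsub hv, fun hvC => (hC.subset hvC).2 (h.subset hv)⟩
    · rcases ne_or_eq C E with h | h
      · exact h1 (key C E hC hE h hs)
      · exact h2 (key D E hD hE (h ▸ hCD.symm) hs)
  have hkℓ : (k : ℕ∞) < ℓ := hlt_k.trans (hR.order_lt hq)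
  have hkℓ' : (k : ℕ∞) < ℓ' := hlt_k.trans (order_swap q ▸ hR'.order_lt hq')
  rcases x with X | o
  · have hXN : X ∈ N := hx
    obtain ⟨C, hC, hCR⟩ := hR.exists_comp (hT.subset X hXN) (hT.encard X hXN ▸ hkℓ)
    exact (not_subset_of_lives (S := X) rfl hlt hCR fun v hv =>
      ⟨hT.subset X hXN hv, fun h => (hC.subset h).2 hv⟩).elim
  · -- both profiles choose the components that the block chooses
    have hchoose : ∀ P m, Lives ((blockDec B N).torso B (Sum.inr o)) P →
        RPProfile B m (induced B P) → (k : ℕ∞) < m →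
        ∀ X ∈ N, compSep B X (o X) ∈ induced B P := by
      intro P m hlt hR hm X hX
      obtain ⟨C, hC, hCR⟩ := hR.exists_comp (hT.subset X hX) (hT.encard X hX ▸ hm)
      by_cases h : C = o X
      · rwa [← h]
      · refine (not_subset_of_lives rfl hlt hCR fun v hv => ⟨hsub hv, fun hvC => ?_⟩).elim
        rcases hv.2 X hX with h' | h'
        · exact h (hC.eq_of_mem (hx.2.1 X hX) hvC h')
        · exact (hC.subset hvC).2 h'
    obtain ⟨p, hp, hp', ho, hs⟩ := exists_isSeparation_restrict hR hR'
      ((blockDec B N).toDec hT.isDec_blockDec) ⟨Sum.inr o, hx⟩ (by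
        rintro p hp hp' ⟨X | o', hs⟩ hadj y ⟨hy, -⟩ z ⟨hz, -⟩ hyp hzp
        · have hXN : X ∈ N := hs
          have hoX := hx.2.1 X hXN
          obtain ⟨Q, hQ, Q', hQ', C, D, hC, hD, hCD, hCQ, hDQ⟩ := hexm X hXN
          have hex : ∃ Q ∈ familyOn Ps B, ∃ C, IsComp B X C ∧ compSep B X C ∈ Q ∧ o X ≠ C := by
            rcases ne_or_eq (o X) C with h | h
            · exact ⟨Q, hQ, C, hC, hCQ, h⟩
            · exact ⟨Q', hQ', D, hD, hDQ, h ▸ hCD⟩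
          obtain ⟨Q, hQ, C, hC, hCQ, hoC⟩ := hex
          obtain ⟨n, hQr⟩ := hF.exists_profile Q hQ
          have hXB := hT.subset X hXN
          have hps := hR.isSeparation hp
          -- The component C is full, so a separation that cuts X has a separator vertex in C. This
          -- is the vertex that uncrossing removes.
          have hCp : ¬ Disjoint C (p.1 ∩ p.2) := by
            intro hd
            obtain ⟨c, hc, hcy⟩ := hT.full X hXN C hC y hy
            obtain ⟨d, hd', hdz⟩ := hT.full X hXN C hC z hz
            rcases hC.subset_or_subset hps hd with h1 | h1
            · exact hps.2 d (h1 hd') z hzp hdz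
            · exact hps.2 y hyp c (h1 hc) hcy.symm
          obtain ⟨v, hvC, hvp⟩ := Set.not_disjoint_iff.1 hCp
          have hv : v ∉ o X ∪ X := by
            rintro (h | h)
            · exact hoC (hoX.eq_of_mem hC h hvC)
            · exact (hC.subset hvC).2 h
          refine ⟨compSep B X (o X), hchoose P ℓ hlt hR hkℓ X hXN,
            hchoose P' ℓ' hlt' hR' hkℓ' X hXN, ⟨Q, n, hQr,
            hQr.compSep_swap_mem hXB hC hCQ hoX hoC.symm, fun r hr hr' => ?_⟩, ?_, v, hvp, hv, ?_⟩
          · rw [order_compSep hXB hoX, hT.encard X hXN]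
            exact hF.le_order _ hRF Q hQ r hr hr'
          · rw [compSep_inter hXB hoX]
            exact hT.subset_part hXN hadj
          · exact fun h => hv (h.2 X hXN)
        · exact hadj.elim) hq hq'
    rw [RawDec.torso_eq] at hs
    have h1 := restrict_mem_induced hsub hp hs
    have h2 := restrict_mem_induced hsub hp' hs.swap
    obtain ⟨p₀, -, -, hp₀, hp₀', ho₀⟩ := exists_lift_distinguishes hGK hPr hPr' hlt hlt' h1 h2
    have h3 : order q ≤ order (restrict ((blockDec B N).torso B (Sum.inr o)) p) :=
      ho₀ ▸ hqmin p₀ hp₀ hp₀'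
    refine ⟨_, h1, h2, ?_, fun r hr hr' =>
      ((order_restrict_le _ p).trans ho).trans (hqmin r hr hr')⟩
    rw [Nat.cast_add, Nat.cast_one]
    exact (Order.add_one_le_of_lt hlt_k).trans h3

/-- Two elements of `Ps` that live in `H` are distinguished by the block tree, or they live in a
common torso. -/
theorem Invariant.induces_or_lives (hI : Invariant G Ps k H)
    (hPs : ∀ P ∈ Ps, ∃ ℓ, RPProfile G ℓ P) (hP : P ∈ Ps) (hP' : P' ∈ Ps)
    (hl : Lives H P) (hl' : Lives H P') (hne : P ≠ P')
    (hT : TreeSeps (TreeOfTD.core H (nestSeps Ps H k)) k (nestSeps Ps H k)) :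
    (∃ q, ((blockDec _ _).toDec hT.isDec_blockDec).Induces q ∧
      q ∈ induced (TreeOfTD.core H (nestSeps Ps H k)) P ∧
      q.swap ∈ induced (TreeOfTD.core H (nestSeps Ps H k)) P' ∧
      ∀ p, p ∈ P → p.swap ∈ P' → order q ≤ order p) ∨
    ∃ x, (blockDec (TreeOfTD.core H (nestSeps Ps H k)) (nestSeps Ps H k)).IsNode x ∧
      Lives ((blockDec (TreeOfTD.core H (nestSeps Ps H k)) (nestSeps Ps H k)).torso
        (TreeOfTD.core H (nestSeps Ps H k)) x) P ∧
      Lives ((blockDec (TreeOfTD.core H (nestSeps Ps H k)) (nestSeps Ps H k)).torso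
        (TreeOfTD.core H (nestSeps Ps H k)) x) P' := by
  have hlc := hI.lives_core hPs hP hP' hl hl' hne
  have hlc' := hI.lives_core hPs hP' hP hl' hl hne.symm
  obtain ⟨q, hq, hq', hkq, hqmin, hqN⟩ := hI.exists_distinguishes_core hPs hP hP' hlc hlc' hne
  have hIc := hI.core hPs
  clear hI hl hl'
  generalize nestSeps Ps H k = N at *
  generalize TreeOfTD.core H N = B at *
  have hF := hIc.profileFamily hPs
  obtain ⟨ℓ, hPr⟩ := hPs P hP
  obtain ⟨ℓ', hPr'⟩ := hPs P' hP'
  have hR := hlc.rpProfile_induced hPr hIc.lifts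
  have hR' := hlc'.rpProfile_induced hPr' hIc.lifts
  have hRF : induced B P ∈ familyOn Ps B := ⟨P, hP, hlc, rfl⟩
  have hRF' : induced B P' ∈ familyOn Ps B := ⟨P', hP', hlc', rfl⟩
  have hXℓ : ∀ X ∈ N, X.encard < ℓ := fun X hX =>
    (hT.encard X hX ▸ hkq).trans_lt (hR.order_lt hq)
  have hXℓ' : ∀ X ∈ N, X.encard < ℓ' := fun X hX =>
    (hT.encard X hX ▸ hkq).trans_lt (order_swap q ▸ hR'.order_lt hq')
  -- If the choices differ at some X, an edge at X distinguishes the profiles; otherwise their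
  -- common choices form a block.
  by_cases hdist : ∃ X ∈ N, ∃ C D, IsComp B X C ∧ IsComp B X D ∧ C ≠ D ∧
      compSep B X C ∈ induced B P ∧ compSep B X D ∈ induced B P'
  · left
    obtain ⟨X, hX, C, D, hC, hD, hCD, hCR, hDR⟩ := hdist
    obtain ⟨o, ho, hinc, hoX⟩ := hT.exists_block hX hC
    have hside := hT.side_eq hX ho hinc
    rw [hoX] at hside
    refine ⟨compSep B X C, ⟨⟨Sum.inl X, hX⟩, ⟨Sum.inr o, ho⟩, hinc, hside.symm⟩, hCR,
      hR'.compSep_swap_mem (hT.subset X hX) hD hDR hC hCD.symm, fun p hp hp' => ?_⟩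
    rw [order_compSep (hT.subset X hX) hC, hT.encard X hX]
    exact hkq.trans (hqmin p hp hp')
  · right
    push Not at hdist
    classical
    choose! c hc hcR using fun X (hX : X ∈ N) => hR.exists_comp (hT.subset X hX) (hXℓ X hX)
    have hcR' : ∀ X ∈ N, compSep B X (c X) ∈ induced B P' := by
      intro X hX
      obtain ⟨D, hD, hDR⟩ := hR'.exists_comp (hT.subset X hX) (hXℓ' X hX)
      by_cases h : c X = D
      · rwa [h]
      · exact absurd hDR (hdist X hX (c X) D (hc X hX) hD h (hcR X hX))
    set o : Set V → Set V := fun X => if X ∈ N then c X else ∅ with ho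
    have hoN : ∀ X ∈ N, o X = c X := fun X hX => by simp [ho, hX]
    have hob : o ∈ (blockDec B N).blocks := by
      refine hT.mem_blocks (fun Y hY => by simp [ho, hY]) ?_ ?_ ?_
      · intro Y hY
        rw [hoN Y hY]
        exact hc Y hY
      · intro Z hZ W hW hd
        rw [hoN Z hZ] at hd
        rw [hoN Z hZ, hoN W hW]
        obtain ⟨v, hv⟩ := (hc Z hZ).nonempty
        exact ⟨v, hv, hR.comp_subset_comp (hc Z hZ) (hcR Z hZ) (hT.subset W hW) (hc W hW)
          (hcR W hW) hd hv⟩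
      -- Finiteness: the component chosen at Z meets the separator of q, for otherwise it would lie
      -- strictly on opposite sides of q for the two profiles. So where the choice differs from X,
      -- the set Z is a minimal separator of one of finitely many pairs of vertices.
      · intro X hX
        refine ((hR.finite hq).biUnion fun s _ => (hT.finite hX).biUnion fun x _ =>
          finite_minimal_separators B k s x).subset ?_
        rintro Z ⟨hZ, hZX, hne⟩
        rw [hoN Z hZ] at hne
        have hnd : ¬ Disjoint (c Z) (q.1 ∩ q.2) := by
          intro hd
          obtain ⟨v, hv⟩ := (hc Z hZ).nonempty
          have h1 := hR.comp_subset (hc Z hZ) (hcR Z hZ) hq hd hv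
          have h2 := hR'.comp_subset (hc Z hZ) (hcR' Z hZ) hq'
            (by rw [Prod.fst_swap, Prod.snd_swap, Set.inter_comm]; exact hd) hv
          exact h1.2 h2.1
        obtain ⟨s, hsZ, hs⟩ := Set.not_disjoint_iff.1 hnd
        obtain ⟨x, hx, hxZ⟩ := Set.not_subset.1 (hT.not_subset hX hZ hZX.symm)
        have hcX := hT.isComp_compTo hX hZ hZX.symm
        simp only [Set.mem_iUnion]
        exact ⟨s, hs, x, hx, hT.encard Z hZ, _, _, hc Z hZ, hcX, hne, hT.full Z hZ _ (hc Z hZ),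
          hT.full Z hZ _ hcX, hsZ, mem_compTo ⟨hx, hxZ⟩⟩
    have key : ∀ P ℓ, RPProfile G ℓ P → Lives B P →
        (∀ X ∈ N, compSep B X (c X) ∈ induced B P) →
        Lives ((blockDec B N).torso B (Sum.inr o)) P := by
      intro P ℓ hPr hl hcP
      have := hl.torso hPr hIc.lifts ((blockDec B N).toDec hT.isDec_blockDec) ⟨Sum.inr o, hob⟩ ?_
      · rwa [RawDec.torso_eq] at this
      · rintro ⟨X | o', hs⟩ hadj
        · have hX : X ∈ N := hs
          have := hT.side_eq hX hob hadj
          rw [this, hoN X hX]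
          exact hcP X hX
        · exact hadj.elim
    exact ⟨Sum.inr o, hob, key P ℓ hPr hlc hcR, key P' ℓ' hPr' hlc' hcR'⟩

end Steps

/-! ### Trees of lists, with distance from the root equal to length. -/

section ListTree

variable {α : Type u} {S : Set (List α)}

/-- The tree on a set of lists in which every list is adjacent to its tail. -/
def listTree (S : Set (List α)) : SimpleGraph S where
  Adj s t := (∃ x, t.1 = x :: s.1) ∨ ∃ x, s.1 = x :: t.1
  symm := ⟨fun _ _ h => h.symm⟩
  loopless := ⟨fun s h => by
    rcases h with ⟨x, h⟩ | ⟨x, h⟩ <;> exact absurd (congrArg List.length h) (by simp)⟩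

structure TailClosed (S : Set (List α)) : Prop where
  nil : [] ∈ S
  tail : ∀ x l, x :: l ∈ S → l ∈ S

namespace TailClosed

theorem exists_walk (hS : TailClosed S) : ∀ l (hl : l ∈ S),
    ∃ w : (listTree S).Walk ⟨[], hS.nil⟩ ⟨l, hl⟩, w.length = l.length
  | [], _ => ⟨SimpleGraph.Walk.nil, rfl⟩
  | x :: l, hl => by
    obtain ⟨w, hw⟩ := hS.exists_walk l (hS.tail x l hl)
    exact ⟨w.concat (Or.inl ⟨x, rfl⟩),
      (SimpleGraph.Walk.length_concat w _).trans (congrArg (· + 1) hw)⟩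

theorem connected (hS : TailClosed S) : (listTree S).Connected :=
  (SimpleGraph.connected_iff_exists_forall_reachable _).2
    ⟨⟨[], hS.nil⟩, fun s => ⟨(hS.exists_walk s.1 s.2).choose⟩⟩

theorem length_le (s t : S) (w : (listTree S).Walk s t) : t.1.length ≤ s.1.length + w.length := by
  induction w with
  | nil => simp
  | cons h w ih =>
    rw [SimpleGraph.Walk.length_cons]
    rcases h with ⟨x, h⟩ | ⟨x, h⟩ <;> have := congrArg List.length h <;>
      rw [List.length_cons] at this <;> omega

theorem dist_eq (hS : TailClosed S) (s : S) :
    (listTree S).dist ⟨[], hS.nil⟩ s = s.1.length := by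
  obtain ⟨s, hs⟩ := s
  obtain ⟨w, hw⟩ := hS.exists_walk s hs
  obtain ⟨w', hw'⟩ := hS.connected.exists_walk_length_eq_dist ⟨[], hS.nil⟩ ⟨s, hs⟩
  have h1 := length_le _ _ w'
  have h2 := SimpleGraph.dist_le w
  simp only [List.length_nil] at h1 ⊢
  omega

/-- Having t as a suffix changes only along the edge from t to its tail, so every edge is a bridge.
-/
theorem isTree (hS : TailClosed S) : (listTree S).IsTree := by
  refine ⟨hS.connected, SimpleGraph.isAcyclic_iff_forall_adj_isBridge.2 ?_⟩
  have key : ∀ (s t : S) x, t.1 = x :: s.1 →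
      ¬ ((listTree S).deleteEdges {s(s, t)}).Reachable t s := by
    intro s t x hx hr
    have := reachable_deleteEdges_invariant (fun a : S => t.1 <:+ a.1) ?_ hr List.suffix_rfl
    · exact absurd this.length_le (by simp [hx])
    · rintro a b (⟨y, h⟩ | ⟨y, h⟩) hne ha
      · exact h ▸ ha.trans (List.suffix_cons y a.1)
      · rw [h, List.suffix_cons_iff] at ha
        refine ha.resolve_left fun ht => hne ?_
        have hta : t = a := Subtype.ext (ht.trans h.symm)
        have hsb : s = b := Subtype.ext (by rw [hx] at ht; exact (List.cons.inj ht).2)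
        rw [hta, hsb, Sym2.eq_swap]
  rintro s t (⟨x, h⟩ | ⟨x, h⟩)
  · rw [SimpleGraph.isBridge_iff]
    exact fun hr => key s t x h hr.symm
  · rw [SimpleGraph.isBridge_iff, Sym2.eq_swap]
    exact fun hr => key t s x h hr

theorem isChild_iff (hS : TailClosed S) (s t : S) :
    IsChild (listTree S) ⟨[], hS.nil⟩ s t ↔ ∃ x, t.1 = x :: s.1 := by
  constructor
  · rintro ⟨h | ⟨x, h⟩, hd⟩
    · exact h
    · rw [hS.dist_eq, hS.dist_eq, h, List.length_cons] at hd
      omega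
  · rintro ⟨x, h⟩
    refine ⟨Or.inl ⟨x, h⟩, ?_⟩
    rw [hS.dist_eq, hS.dist_eq, h, List.length_cons]

end TailClosed

end ListTree

/-! ### The tree of tree-decompositions and its five properties. -/

section Construction

variable {V : Type u} {G H : GraphIn V} {Ps : Set (Set (Set V × Set V))} {n r : ℕ}
  {P P' : Set (Set V × Set V)}

/-- The separators used on level `n`. -/
def sepsAt (Ps : Set (Set (Set V × Set V))) (n : ℕ) (H : GraphIn V) : Set (Set V) :=
  -- The levels 2k - 1 and 2k both use separators of size k, the former for the star and the latter
  -- for the block tree.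
  nestSeps Ps H ((n + 1) / 2)

/-- The graph that is decomposed on level `n`. -/
noncomputable def graphAt (Ps : Set (Set (Set V × Set V))) (n : ℕ) (H : GraphIn V) : GraphIn V :=
  if Even n then core H (sepsAt Ps n H) else H

/-- The decomposition of `graphAt Ps n H` on level `n`: odd levels split off the components that are
not full, even levels decompose along the separators. -/
noncomputable def decAt (Ps : Set (Set (Set V × Set V))) (n : ℕ) (H : GraphIn V) : RawDec V :=
  if Even n then blockDec (core H (sepsAt Ps n H)) (sepsAt Ps n H) else starDec H (sepsAt Ps n H)

/-- An odd level passes H on unchanged, although the child is assigned the core: `graphAt` takes the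
core on the even level, so both levels compute the separators from the same H. -/
noncomputable def stepAt (Ps : Set (Set (Set V × Set V))) (n : ℕ) (H : GraphIn V) (x : NodeOf V) :
    GraphIn V :=
  if Even n then (decAt Ps n H).torso (graphAt Ps n H) x else H

/-- The nodes of the decomposition on level `n` at which the construction continues. -/
def IsStep (Ps : Set (Set (Set V × Set V))) (n : ℕ) (H : GraphIn V) (x : NodeOf V) : Prop :=
  (decAt Ps n H).IsNode x ∧ (¬ Even n → x = centre V)

/-- The graph reached from `G` on level `r` along the list of nodes, read from its end. -/
noncomputable def base (G : GraphIn V) (Ps : Set (Set (Set V × Set V))) (r : ℕ) :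
    List (NodeOf V) → GraphIn V
  | [] => G
  | x :: l => stepAt Ps (l.length + r) (base G Ps r l) x

def IsBranch (G : GraphIn V) (Ps : Set (Set (Set V × Set V))) (r : ℕ) : List (NodeOf V) → Prop
  | [] => True
  | x :: l => IsBranch G Ps r l ∧ IsStep Ps (l.length + r) (base G Ps r l) x

theorem tailClosed_isBranch (G : GraphIn V) (Ps : Set (Set (Set V × Set V))) (r : ℕ) :
    TailClosed {l | IsBranch G Ps r l} :=
  ⟨trivial, fun _ _ h => h.1⟩

theorem isDec_decAt (Ps : Set (Set (Set V × Set V))) (n : ℕ) (H : GraphIn V) :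
    (decAt Ps n H).IsDec (graphAt Ps n H) := by
  have hN := goodSeps_nestSeps Ps H ((n + 1) / 2)
  unfold decAt graphAt
  split_ifs
  · exact hN.treeSeps.isDec_blockDec
  · exact hN.isDec_starDec

theorem graphAt_stepAt (Ps : Set (Set (Set V × Set V))) (n : ℕ) (H : GraphIn V) {x : NodeOf V}
    (hx : IsStep Ps n H x) :
    graphAt Ps (n + 1) (stepAt Ps n H x) = (decAt Ps n H).torso (graphAt Ps n H) x := by
  by_cases hn : Even n
  · have h1 : ¬ Even (n + 1) := by simpa [Nat.even_add_one] using hn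
    simp only [graphAt, stepAt, hn, h1, if_true, if_false]
  · have h1 : Even (n + 1) := by simpa [Nat.even_add_one] using hn
    obtain rfl := hx.2 hn
    have h2 : (n + 1 + 1) / 2 = (n + 1) / 2 := by
      obtain ⟨m, rfl⟩ := Nat.not_even_iff_odd.1 hn
      omega
    simp only [graphAt, stepAt, decAt, sepsAt, hn, h1, h2, if_true, if_false]
    rfl

theorem core_eq_self_of_rubbish (N : Set (Set V)) (h : rubbish H N = ∅) : core H N = H := by
  refine SimpleGraph.Subgraph.ext ?_ ?_
  · simp [core_verts, h]
  · funext a b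
    refine propext ⟨?_, fun hab => ⟨hab.adj_sub, ?_, ?_, Or.inl hab⟩⟩
    · rintro ⟨-, -, -, hab | ⟨K | o, hK, hadj, -⟩⟩
      · exact hab
      · exact absurd (h ▸ hK : K ∈ (∅ : Set (Set V))) (Set.notMem_empty _)
      · exact hadj.elim
    · exact ⟨hab.fst_mem, by simp [h]⟩
    · exact ⟨hab.snd_mem, by simp [h]⟩

/-- Every component is full for the empty separator. So a root of level 0 needs no preceding star.
-/
theorem core_nestSeps_zero (Ps : Set (Set (Set V × Set V))) (H : GraphIn V) :
    core H (nestSeps Ps H 0) = H := by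
  refine core_eq_self_of_rubbish _ (Set.eq_empty_of_forall_notMem ?_)
  rintro K ⟨X, hX, hK, hf⟩
  have := ((goodSeps_nestSeps Ps H 0).tight X hX).2.1
  rw [Nat.cast_zero, Set.encard_eq_zero] at this
  subst this
  exact hf fun x hx => hx.elim

open Classical in
/-- The level of the root. -/
noncomputable def rootLevel (G : SimpleGraph V) : ℕ := if G.Preconnected then 1 else 0

theorem graphAt_rootLevel (G : SimpleGraph V) (Ps : Set (Set (Set V × Set V))) :
    graphAt Ps (rootLevel G) (whole G) = whole G := by
  unfold rootLevel
  split_ifs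
  · simp [graphAt]
  · simpa [graphAt, sepsAt] using core_nestSeps_zero Ps (whole G)

/-- The tree of tree-decompositions of `G` constructed from the set `Ps` of profiles. -/
noncomputable def decTree (G : SimpleGraph V) (Ps : Set (Set (Set V × Set V))) :
    TreeOfTreeDecompositions G where
  Node := {l | IsBranch (whole G) Ps (rootLevel G) l}
  tree := listTree _
  isTree := (tailClosed_isBranch _ _ _).isTree
  root := ⟨[], trivial⟩
  graph t := graphAt Ps (t.1.length + rootLevel G) (base (whole G) Ps (rootLevel G) t.1)
  decomp t := (decAt Ps (t.1.length + rootLevel G) (base (whole G) Ps (rootLevel G) t.1)).toDec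
    (isDec_decAt _ _ _)
  graph_root := by
    simpa [base] using graphAt_rootLevel G Ps
  -- The default is never used, since a child is a non-empty list.
  place t s h := ⟨s.1.headD (centre V), by
    obtain ⟨x, hx⟩ := ((tailClosed_isBranch _ _ _).isChild_iff t s).1 h
    obtain ⟨s, hs⟩ := s
    obtain rfl : s = x :: t.1 := hx
    exact hs.2.1⟩
  place_injective := by
    intro t s s' h h' he
    obtain ⟨x, hx⟩ := ((tailClosed_isBranch _ _ _).isChild_iff t s).1 h
    obtain ⟨y, hy⟩ := ((tailClosed_isBranch _ _ _).isChild_iff t s').1 h'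
    have he' := congrArg Subtype.val he
    simp only [hx, hy, List.headD_cons] at he'
    exact Subtype.ext (by rw [hx, hy, he'])
  graph_child := by
    rintro t ⟨s, hs⟩ h
    obtain ⟨x, hx⟩ := ((tailClosed_isBranch _ _ _).isChild_iff t ⟨s, hs⟩).1 h
    obtain rfl : s = x :: t.1 := hx
    rw [RawDec.torso_eq]
    have := graphAt_stepAt Ps (t.1.length + rootLevel G) _ hs.2
    simpa [base, Nat.add_right_comm] using this

theorem level_decTree (G : SimpleGraph V) (Ps : Set (Set (Set V × Set V)))
    (t : (decTree G Ps).Node) : (decTree G Ps).level t = t.1.length + rootLevel G := by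
  unfold TreeOfTreeDecompositions.level rootLevel
  congr 1
  exact (tailClosed_isBranch _ _ _).dist_eq t

theorem isChild_decTree (G : SimpleGraph V) (Ps : Set (Set (Set V × Set V)))
    (s t : (decTree G Ps).Node) :
    IsChild (decTree G Ps).tree (decTree G Ps).root s t ↔ ∃ x, t.1 = x :: s.1 :=
  (tailClosed_isBranch _ _ _).isChild_iff s t

theorem TreeSeps.isBalanced {k : ℕ} {N : Set (Set V)} (hN : TreeSeps H k N) :
    ((blockDec H N).toDec hN.isDec_blockDec).IsBalanced k := by
  have key : ∀ X ∈ N, ∀ o, (blockDec H N).inc X o →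
      (blockDec H N).part (Sum.inl X) ∩ (blockDec H N).part (Sum.inr o) = X := fun X hX o hinc =>
    Set.inter_eq_left.2 (hN.subset_part hX hinc)
  rintro ⟨X | o, hs⟩ ⟨Y | o', ht⟩ hadj
  · exact hadj.elim
  · exact (congrArg Set.encard (key X hs o' hadj)).trans (hN.encard X hs)
  · exact (congrArg Set.encard ((Set.inter_comm _ _).trans (key Y ht o hadj))).trans (hN.encard Y ht)
  · exact hadj.elim

theorem GoodSeps.adhesionLE {k : ℕ} {N : Set (Set V)} (hN : GoodSeps H (k + 1) N) :
    ((starDec H N).toDec hN.isDec_starDec).AdhesionLE k := by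
  have key : ∀ K ∈ rubbish H N, ((K ∪ nbhd H K) ∩ (H.verts \ ⋃₀ rubbish H N)).encard ≤ k := by
    intro K hK
    have h1 := hN.encard_nbhd_lt hK
    rw [Nat.cast_add, Nat.cast_one] at h1
    refine (Set.encard_le_encard ?_).trans (Order.le_of_lt_add_one h1)
    rintro v ⟨h | h, h'⟩
    · exact (h'.2 ⟨K, hK, h⟩).elim
    · exact h
  rintro ⟨X | o, hs⟩ ⟨Y | o', ht⟩ hadj
  · exact hadj.elim
  · exact key X hs
  · exact (congrArg Set.encard (Set.inter_comm _ _)).trans_le (key Y ht)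
  · exact hadj.elim

theorem isBalanced_decAt {k : ℕ} (hn : n = 2 * k) :
    ((decAt Ps n H).toDec (isDec_decAt Ps n H)).IsBalanced k := by
  have he : Even n := hn ▸ even_two_mul k
  have hk : (n + 1) / 2 = k := by omega
  intro s t hst
  have hT := (goodSeps_nestSeps Ps H k).treeSeps
  have e1 : decAt Ps n H = blockDec (core H (nestSeps Ps H k)) (nestSeps Ps H k) := by
    simp [decAt, sepsAt, he, hk]
  obtain ⟨s, hs⟩ := s
  obtain ⟨t, ht⟩ := t
  change (decAt Ps n H).adj s t at hst
  change ((decAt Ps n H).part s ∩ (decAt Ps n H).part t).encard = k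
  rw [e1] at hs ht hst ⊢
  exact hT.isBalanced ⟨s, hs⟩ ⟨t, ht⟩ hst

theorem adhesionLE_decAt {k : ℕ} (hn : n = 2 * k + 1) :
    ((decAt Ps n H).toDec (isDec_decAt Ps n H)).AdhesionLE k := by
  have he : ¬ Even n := by rw [hn]; simp
  have hk : (n + 1) / 2 = k + 1 := by omega
  intro s t hst
  have e1 : decAt Ps n H = starDec H (nestSeps Ps H (k + 1)) := by
    simp [decAt, sepsAt, he, hk]
  obtain ⟨s, hs⟩ := s
  obtain ⟨t, ht⟩ := t
  change (decAt Ps n H).adj s t at hst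
  change ((decAt Ps n H).part s ∩ (decAt Ps n H).part t).encard ≤ k
  rw [e1] at hs ht hst ⊢
  exact (goodSeps_nestSeps Ps H (k + 1)).adhesionLE ⟨s, hs⟩ ⟨t, ht⟩ hst

theorem isBalanced_decTree (G : SimpleGraph V) (Ps : Set (Set (Set V × Set V)))
    (t : (decTree G Ps).Node) (k : ℕ) (h : (decTree G Ps).level t = 2 * k) :
    ((decTree G Ps).decomp t).IsBalanced k :=
  isBalanced_decAt ((level_decTree G Ps t).symm.trans h)

theorem adhesionLE_decTree (G : SimpleGraph V) (Ps : Set (Set (Set V × Set V)))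
    (t : (decTree G Ps).Node) (k : ℕ) (h : (decTree G Ps).level t = 2 * k + 1) :
    ((decTree G Ps).decomp t).AdhesionLE k :=
  adhesionLE_decAt ((level_decTree G Ps t).symm.trans h)

theorem exists_child_decTree (G : SimpleGraph V) (Ps : Set (Set (Set V × Set V)))
    (t : (decTree G Ps).Node) (k : ℕ) (h : (decTree G Ps).level t = 2 * k)
    (x : ((decTree G Ps).decomp t).Node) :
    ∃ s, ∃ h : IsChild (decTree G Ps).tree (decTree G Ps).root t s,
      (decTree G Ps).place t s h = x := by
  rw [level_decTree] at h
  refine ⟨⟨x.1 :: t.1, t.2, x.2, fun hn => (hn (h ▸ even_two_mul k)).elim⟩,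
    (isChild_decTree _ _ _ _).2 ⟨x.1, rfl⟩, rfl⟩

theorem child_unique_decTree (G : SimpleGraph V) (Ps : Set (Set (Set V × Set V)))
    (t : (decTree G Ps).Node) (k : ℕ) (h : (decTree G Ps).level t = 2 * k + 1)
    (s s' : (decTree G Ps).Node) (hs : IsChild (decTree G Ps).tree (decTree G Ps).root t s)
    (hs' : IsChild (decTree G Ps).tree (decTree G Ps).root t s') : s = s' := by
  rw [level_decTree] at h
  have hn : ¬ Even (t.1.length + rootLevel G) := by rw [h]; simp
  obtain ⟨x, hx⟩ := (isChild_decTree _ _ _ _).1 hs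
  obtain ⟨y, hy⟩ := (isChild_decTree _ _ _ _).1 hs'
  obtain ⟨s, hsb⟩ := s
  obtain ⟨s', hsb'⟩ := s'
  obtain rfl : s = x :: t.1 := hx
  obtain rfl : s' = y :: t.1 := hy
  exact Subtype.ext (congrArg (· :: t.1) ((hsb.2.2 hn).trans (hsb'.2.2 hn).symm))

theorem RawDec.induces_congr {R R' : RawDec V} {H H' : GraphIn V} (hR : R = R') (hH : H = H')
    (h : R.IsDec H) (h' : R'.IsDec H') {q : Set V × Set V} (hq : (R.toDec h).Induces q) :
    (R'.toDec h').Induces q := by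
  subst hR hH
  exact hq

theorem induced_whole {ℓ : ℕ∞} (h : RPProfile G ℓ P) : induced G P = P := by
  ext q
  constructor
  · rintro ⟨-, p, hp, rfl⟩
    rwa [restrict_self (h.isSeparation hp)]
  · exact fun hq => ⟨h.isSeparation hq, q, hq, (restrict_self (h.isSeparation hq)).symm⟩

/-- Neither side of q contains all vertices, so in a connected graph a separation of order 0 would
be crossed by an edge. This starts the invariant at k = 1 when the root has level 1. -/
theorem RPProfile.one_le_order {G : SimpleGraph V} {ℓ ℓ' : ℕ∞} (hG : G.Preconnected)
    (hP : RPProfile (whole G) ℓ P) (hP' : RPProfile (whole G) ℓ' P') {q : Set V × Set V}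
    (hq : q ∈ P) (hq' : q.swap ∈ P') : 1 ≤ order q := by
  rw [Order.one_le_iff_ne_zero]
  intro h0
  have hd : q.1 ∩ q.2 = ∅ := Set.encard_eq_zero.1 h0
  have hs := hP.isSeparation hq
  have hcov : ∀ v, v ∈ q.1 ∨ v ∈ q.2 := fun v => by
    have : v ∈ (whole G).verts := trivial
    rwa [← hs.1] at this
  obtain ⟨b, -, hb⟩ := Set.not_subset.1 (hP.verts_not_subset hq)
  obtain ⟨a, -, ha⟩ := Set.not_subset.1 (hP'.verts_not_subset hq')
  have hstep : ∀ x y, G.Adj x y → x ∈ q.1 → y ∈ q.1 := by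
    intro x y hxy hx
    by_contra hy
    have hx2 : x ∉ q.2 := fun h => Set.notMem_empty x (hd ▸ ⟨hx, h⟩)
    exact hs.2 x ⟨hx, hx2⟩ y ⟨(hcov y).resolve_left hy, hy⟩ hxy
  obtain ⟨w⟩ := hG a b
  have hw : ∀ x y (w : G.Walk x y), x ∈ q.1 → y ∈ q.1 := by
    intro x y w
    induction w with
    | nil => exact id
    | cons h w ih => exact fun hx => ih (hstep _ _ h hx)
  exact hb (hw a b w ((hcov a).resolve_right ha))

section Efficient

variable {G : SimpleGraph V}

theorem invariant_whole (hPs : ∀ P ∈ Ps, ∃ ℓ, RPProfile (whole G) ℓ P)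
    (hd : ∀ P ∈ Ps, ∀ P' ∈ Ps, P ≠ P' → ∃ p, IsSeparation (whole G) p ∧ Distinguishes p P P') :
    Invariant (whole G) Ps ((rootLevel G + 1) / 2) (whole G) := by
  refine ⟨Lifts.refl _, fun P hP P' hP' _ _ hne => ?_⟩
  obtain ⟨ℓ, hPr⟩ := hPs P hP
  obtain ⟨ℓ', hPr'⟩ := hPs P' hP'
  rw [induced_whole hPr, induced_whole hPr']
  have hex : {p | p ∈ P ∧ p.swap ∈ P'}.Nonempty := by
    obtain ⟨p, -, h | h⟩ := hd P hP P' hP' hne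
    · exact ⟨p, h⟩
    · exact ⟨p.swap, h⟩
  obtain ⟨q, ⟨hq, hq'⟩, hmin⟩ := (InvImage.wf order (wellFounded_lt (α := ℕ∞))).has_min _ hex
  refine ⟨q, hq, hq', ?_, fun p hp hp' => not_lt.1 (hmin p ⟨hp, hp'⟩)⟩
  unfold rootLevel
  split_ifs with hG
  · simpa using hPr.one_le_order hG hPr' hq hq'
  · simp

theorem invariant_base (hPs : ∀ P ∈ Ps, ∃ ℓ, RPProfile (whole G) ℓ P)
    (hd : ∀ P ∈ Ps, ∀ P' ∈ Ps, P ≠ P' → ∃ p, IsSeparation (whole G) p ∧ Distinguishes p P P') :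
    ∀ l, IsBranch (whole G) Ps (rootLevel G) l →
      Invariant (whole G) Ps ((l.length + rootLevel G + 1) / 2) (base (whole G) Ps (rootLevel G) l)
  | [], _ => by simpa [base] using invariant_whole hPs hd
  | x :: l, hl => by
    have hI := invariant_base hPs hd l hl.1
    have hx := hl.2
    have hlen : (x :: l).length + rootLevel G = l.length + rootLevel G + 1 := by
      rw [List.length_cons]; omega
    rw [hlen, base]
    generalize base (whole G) Ps (rootLevel G) l = H at *
    generalize l.length + rootLevel G = n at *
    by_cases hn : Even n
    · have h1 : (n + 1 + 1) / 2 = (n + 1) / 2 + 1 := by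
        obtain ⟨m, rfl⟩ := hn
        omega
      rw [h1]
      have hx' := hx.1
      simp only [decAt, stepAt, graphAt, hn, if_true] at hx' ⊢
      exact hI.torso hPs hx'
    · have h1 : (n + 1 + 1) / 2 = (n + 1) / 2 := by
        obtain ⟨m, rfl⟩ := Nat.not_even_iff_odd.1 hn
        omega
      rw [h1]
      simpa only [stepAt, hn, if_false] using hI

/-- A node in whose graph both profiles live, and whose tree-decomposition induces a separation that
distinguishes them and has minimum order, distinguishes them efficiently. -/
theorem distinguishesEfficiently_of_induces {ℓ ℓ' : ℕ∞} {q : Set V × Set V}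
    (t : (decTree G Ps).Node)
    (hP : RPProfile (whole G) ℓ P) (hP' : RPProfile (whole G) ℓ' P')
    (hL : Lifts (whole G) ((decTree G Ps).graph t))
    (hl : Lives ((decTree G Ps).graph t) P) (hl' : Lives ((decTree G Ps).graph t) P')
    (hi : ((decTree G Ps).decomp t).Induces q) (hq : q ∈ induced ((decTree G Ps).graph t) P)
    (hq' : q.swap ∈ induced ((decTree G Ps).graph t) P')
    (hmin : ∀ p, p ∈ P → p.swap ∈ P' → order q ≤ order p) :
    (decTree G Ps).DistinguishesEfficiently P P' := by
  have hmin' : ∀ p, p ∈ induced ((decTree G Ps).graph t) P →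
      p.swap ∈ induced ((decTree G Ps).graph t) P' → order q ≤ order p := by
    intro p hp hp'
    obtain ⟨p₀, -, -, h1, h2, h3⟩ := exists_lift_distinguishes hL hP hP' hl hl' hp hp'
    exact h3 ▸ hmin p₀ h1 h2
  obtain ⟨p, hp, hpq, h1, h2, h3⟩ := exists_lift_distinguishes hL hP hP' hl hl' hq hq'
  refine ⟨t, (hl.rpProfile_induced hP hL).ofOrder.isProfile,
    (hl'.rpProfile_induced hP' hL).ofOrder.isProfile, q, hi, ⟨Or.inl ⟨hq, hq'⟩, ?_⟩, p, hp,
    hpq.symm, Or.inl ⟨h1, h2⟩, ?_⟩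
  · rintro r (⟨h, h'⟩ | ⟨h, h'⟩)
    · exact hmin' r h h'
    · exact order_swap r ▸ hmin' r.swap h h'
  · rw [h3]
    rintro r (⟨h, h'⟩ | ⟨h, h'⟩)
    · exact hmin r h h'
    · exact order_swap r ▸ hmin r.swap h h'

/-- Both profiles are followed along a branch until an even level distinguishes them; d counts the
levels left before level 2m + 2. -/
theorem distinguishesEfficiently_of_branch (hPs : ∀ P ∈ Ps, ∃ ℓ, RPProfile (whole G) ℓ P)
    (hd : ∀ P ∈ Ps, ∀ P' ∈ Ps, P ≠ P' → ∃ p, IsSeparation (whole G) p ∧ Distinguishes p P P')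
    (hP : P ∈ Ps) (hP' : P' ∈ Ps) (hne : P ≠ P') {m : ℕ} {p : Set V × Set V} (hp : p ∈ P)
    (hp' : p.swap ∈ P') (hm : order p ≤ m) (d : ℕ) (l : List (NodeOf V))
    (hb : IsBranch (whole G) Ps (rootLevel G) l)
    (hl : Lives (base (whole G) Ps (rootLevel G) l) P)
    (hl' : Lives (base (whole G) Ps (rootLevel G) l) P')
    (hdl : l.length + rootLevel G + d = 2 * m + 2) :
    (decTree G Ps).DistinguishesEfficiently P P' := by
  induction d generalizing l with
  | zero =>
    -- On level 2m + 2 the invariant would force order at least m + 1, but p has order at most m.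
    obtain ⟨q, -, -, h1, h2⟩ :=
      (invariant_base hPs hd l hb).exists_distinguishes P hP P' hP' hl hl' hne
    have h3 : (((l.length + rootLevel G + 1) / 2 : ℕ) : ℕ∞) ≤ (m : ℕ) :=
      h1.trans ((h2 p hp hp').trans hm)
    rw [Nat.cast_le] at h3
    omega
  | succ d ih =>
    have hcons : ∀ x : NodeOf V, (x :: l).length + rootLevel G + d = 2 * m + 2 := fun x => by
      rw [List.length_cons]; omega
    by_cases hn : Even (l.length + rootLevel G)
    · have hI := invariant_base hPs hd l hb
      have hT := (goodSeps_nestSeps Ps (base (whole G) Ps (rootLevel G) l)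
        ((l.length + rootLevel G + 1) / 2)).treeSeps
      obtain ⟨ℓ, hPr⟩ := hPs P hP
      obtain ⟨ℓ', hPr'⟩ := hPs P' hP'
      have hg : graphAt Ps (l.length + rootLevel G) (base (whole G) Ps (rootLevel G) l) =
          core (base (whole G) Ps (rootLevel G) l) (nestSeps Ps (base (whole G) Ps (rootLevel G) l)
            ((l.length + rootLevel G + 1) / 2)) := by
        rw [graphAt, if_pos hn]; rfl
      have hdec : decAt Ps (l.length + rootLevel G) (base (whole G) Ps (rootLevel G) l) =
          blockDec (core (base (whole G) Ps (rootLevel G) l)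
            (nestSeps Ps (base (whole G) Ps (rootLevel G) l) ((l.length + rootLevel G + 1) / 2)))
            (nestSeps Ps (base (whole G) Ps (rootLevel G) l)
              ((l.length + rootLevel G + 1) / 2)) := by
        rw [decAt, if_pos hn]; rfl
      rcases hI.induces_or_lives hPs hP hP' hl hl' hne hT with ⟨q, hi, hq, hq', hmin⟩ | ⟨x, hx, h, h'⟩
      · have hg' : (decTree G Ps).graph ⟨l, hb⟩ = _ := hg
        refine distinguishesEfficiently_of_induces (q := q) ⟨l, hb⟩ hPr hPr' ?_ ?_ ?_
          (RawDec.induces_congr hdec.symm hg.symm _ (isDec_decAt _ _ _) hi) ?_ ?_ hmin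
        · rw [hg']; exact (hI.core hPs).lifts
        · rw [hg']; exact hI.lives_core hPs hP hP' hl hl' hne
        · rw [hg']; exact hI.lives_core hPs hP' hP hl' hl hne.symm
        · rw [hg']; exact hq
        · rw [hg']; exact hq'
      · have hs : stepAt Ps (l.length + rootLevel G) (base (whole G) Ps (rootLevel G) l) x =
            (decAt Ps (l.length + rootLevel G) (base (whole G) Ps (rootLevel G) l)).torso
              (graphAt Ps (l.length + rootLevel G) (base (whole G) Ps (rootLevel G) l)) x := by
          rw [stepAt, if_pos hn]
        rw [hdec, hg] at hs
        refine ih (x :: l) ⟨hb, hdec ▸ hx, fun h => (h hn).elim⟩ ?_ ?_ (hcons x)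
        · rw [base, hs]; exact h
        · rw [base, hs]; exact h'
    · have hs : stepAt Ps (l.length + rootLevel G) (base (whole G) Ps (rootLevel G) l) (centre V) =
          base (whole G) Ps (rootLevel G) l := by
        rw [stepAt, if_neg hn]
      have hx : (decAt Ps (l.length + rootLevel G) (base (whole G) Ps (rootLevel G) l)).IsNode
          (centre V) := by
        rw [decAt, if_neg hn]
        exact isNode_centre _ _
      refine ih (centre V :: l) ⟨hb, hx, fun _ => rfl⟩ ?_ ?_ (hcons _)
      · rw [base, hs]; exact hl
      · rw [base, hs]; exact hl'

theorem distinguishesEfficiently_decTree (hPs : ∀ P ∈ Ps, ∃ ℓ, RPProfile (whole G) ℓ P)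
    (hd : ∀ P ∈ Ps, ∀ P' ∈ Ps, P ≠ P' → ∃ p, IsSeparation (whole G) p ∧ Distinguishes p P P')
    (hP : P ∈ Ps) (hP' : P' ∈ Ps) (hne : P ≠ P') :
    (decTree G Ps).DistinguishesEfficiently P P' := by
  obtain ⟨ℓ, hPr⟩ := hPs P hP
  obtain ⟨ℓ', hPr'⟩ := hPs P' hP'
  have hex : ∃ p, p ∈ P ∧ p.swap ∈ P' := by
    obtain ⟨p, -, h | h⟩ := hd P hP P' hP' hne
    · exact ⟨p, h⟩
    · exact ⟨p.swap, h⟩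
  obtain ⟨p, hp, hp'⟩ := hex
  obtain ⟨m, hm⟩ := ENat.ne_top_iff_exists.1 (ne_top_of_lt (hPr.order_lt hp))
  have hr : rootLevel G ≤ 1 := by
    unfold rootLevel
    split_ifs <;> omega
  exact distinguishesEfficiently_of_branch hPs hd hP hP' hne hp hp' hm.symm.le
    (2 * m + 2 - rootLevel G) [] trivial (fun p hp => hPr.verts_not_subset hp)
    (fun p hp => hPr'.verts_not_subset hp) (by rw [List.length_nil]; omega)

end Efficient

end Construction

/-! ### Invariance of all ingredients under bijections of the vertex sets. -/

section Transport

variable {V W : Type u} (e : V ≃ W) {H : GraphIn W} {N : Set (Set W)} {k n : ℕ}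
  {P P' : Set (Set W × Set W)} {Ps : Set (Set (Set W × Set W))} {X C Z : Set W}

/-- The graph on `V` that corresponds to a graph on `W`. -/
def pullGraph (H : GraphIn W) : GraphIn V where
  verts := e ⁻¹' H.verts
  Adj a b := H.Adj (e a) (e b)
  adj_sub h := fun hab => h.adj_sub (congrArg e hab)
  edge_vert h := h.fst_mem
  symm := ⟨fun _ _ h => h.symm⟩

/-- The pair of subsets of `V` that corresponds to a pair of subsets of `W`. -/
def pullPair (p : Set W × Set W) : Set V × Set V := (e ⁻¹' p.1, e ⁻¹' p.2)

theorem preimage_surjective : Function.Surjective (Set.preimage e) :=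
  e.injective.preimage_surjective

theorem preimage_injective : Function.Injective (Set.preimage e) :=
  e.surjective.preimage_injective

theorem pullPair_injective : Function.Injective (pullPair e) := fun _ _ h =>
  Prod.ext (preimage_injective e (congrArg Prod.fst h)) (preimage_injective e (congrArg Prod.snd h))

theorem pullPair_surjective : Function.Surjective (pullPair e) := fun p => by
  obtain ⟨A, hA⟩ := preimage_surjective e p.1
  obtain ⟨B, hB⟩ := preimage_surjective e p.2
  exact ⟨(A, B), Prod.ext hA hB⟩

theorem encard_preimage_equiv (X : Set W) : (e ⁻¹' X).encard = X.encard := by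
  rw [← Equiv.image_symm_eq_preimage]
  exact e.symm.injective.encard_image X

theorem closedOff_pull : ClosedOff (pullGraph e H) (e ⁻¹' X) (e ⁻¹' C) ↔ ClosedOff H X C := by
  simp only [ClosedOff, e.surjective.forall]
  rfl

theorem conn_pull (v : V) : conn (pullGraph e H) (e ⁻¹' X) v = e ⁻¹' conn H X (e v) := by
  ext w
  simp only [conn, Set.mem_ofPred_eq, (preimage_surjective e).forall, closedOff_pull]
  rfl

theorem isComp_pull : IsComp (pullGraph e H) (e ⁻¹' X) (e ⁻¹' C) ↔ IsComp H X C := by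
  simp only [IsComp, e.surjective.exists, conn_pull, (preimage_injective e).eq_iff]
  rfl

theorem full_pull : Full (pullGraph e H) (e ⁻¹' X) (e ⁻¹' C) ↔ Full H X C := by
  simp only [Full, e.surjective.exists, e.surjective.forall]
  rfl

theorem separates_pull : Separates (pullGraph e H) (e ⁻¹' Z) (e ⁻¹' X) ↔ Separates H Z X := by
  simp only [Separates, e.surjective.exists, conn_pull]
  rfl

theorem tightSep_pull : TightSep (pullGraph e H) k (e ⁻¹' X) ↔ TightSep H k X := by
  simp only [TightSep, encard_preimage_equiv, (preimage_surjective e).exists, isComp_pull,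
    full_pull, (preimage_injective e).ne_iff]
  refine and_congr_left fun _ => ?_
  exact e.surjective.preimage_subset_preimage_iff

theorem mem_image_preimage_iff : e ⁻¹' X ∈ Set.preimage e '' N ↔ X ∈ N :=
  (preimage_injective e).mem_set_image

theorem crossers_pull :
    crossers (pullGraph e H) k (e ⁻¹' X) = Set.preimage e '' crossers H k X := by
  ext Z
  obtain ⟨Z, rfl⟩ := preimage_surjective e Z
  rw [mem_image_preimage_iff]
  exact and_congr (tightSep_pull e) (separates_pull e)

theorem isSeparation_pull {p : Set W × Set W} :
    IsSeparation (pullGraph e H) (pullPair e p) ↔ IsSeparation H p := by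
  refine and_congr ?_ ?_
  · exact (preimage_injective e).eq_iff (a := p.1 ∪ p.2) (b := H.verts)
  · simp only [e.surjective.forall]
    rfl

theorem lives_pull : Lives (pullGraph e H) (pullPair e '' P) ↔ Lives H P := by
  unfold Lives
  rw [Set.forall_mem_image]
  refine forall₂_congr fun p _ => not_congr ?_
  exact e.surjective.preimage_subset_preimage_iff

theorem induced_pull :
    induced (pullGraph e H) (pullPair e '' P) = pullPair e '' induced H P := by
  ext q
  obtain ⟨q, rfl⟩ := pullPair_surjective e q
  rw [(pullPair_injective e).mem_set_image]
  refine and_congr (isSeparation_pull e) ?_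
  rw [Set.exists_mem_image]
  refine exists_congr fun p => and_congr_right fun _ => ?_
  exact (pullPair_injective e).eq_iff (a := q) (b := restrict H p)

theorem familyOn_pull : familyOn (Set.image (pullPair e) '' Ps) (pullGraph e H) =
    Set.image (pullPair e) '' familyOn Ps H := by
  ext R
  constructor
  · rintro ⟨_, ⟨P, hP, rfl⟩, hl, rfl⟩
    exact ⟨_, ⟨P, hP, (lives_pull e).1 hl, rfl⟩, (induced_pull e).symm⟩
  · rintro ⟨_, ⟨P, hP, hl, rfl⟩, rfl⟩
    exact ⟨_, ⟨P, hP, rfl⟩, (lives_pull e).2 hl, (induced_pull e).symm⟩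

theorem sepSets_pull : sepSets k (pullPair e '' P) (pullPair e '' P') =
    Set.preimage e '' sepSets k P P' := by
  have hswap : ∀ p, (pullPair e p).swap = pullPair e p.swap := fun _ => rfl
  ext Y
  obtain ⟨Y, rfl⟩ := preimage_surjective e Y
  rw [mem_image_preimage_iff]
  simp only [sepSets, Set.mem_ofPred_eq, (pullPair_surjective e).exists, hswap,
    (pullPair_injective e).mem_set_image, encard_preimage_equiv]
  refine exists_congr fun p => and_congr_right fun _ => and_congr_right fun _ =>
    and_congr_left fun _ => ?_
  exact (preimage_injective e).eq_iff (a := p.1 ∩ p.2) (b := Y)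

theorem optimalSeps_pull {Qs : Set (Set (Set W × Set W))} :
    optimalSeps (pullGraph e H) k (Set.image (pullPair e) '' Qs) =
      Set.preimage e '' optimalSeps H k Qs := by
  ext Y
  obtain ⟨Y, rfl⟩ := preimage_surjective e Y
  rw [mem_image_preimage_iff]
  simp only [optimalSeps, Set.mem_ofPred_eq, Set.exists_mem_image, sepSets_pull,
    mem_image_preimage_iff, Set.forall_mem_image, crossers_pull,
    Set.ncard_image_of_injective _ (preimage_injective e)]

theorem goodSeps_pull : GoodSeps (pullGraph e H) k (Set.preimage e '' N) ↔ GoodSeps H k N := by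
  have hd : ∀ K Y : Set W, Disjoint (e ⁻¹' K) (e ⁻¹' Y) ↔ Disjoint K Y := fun K Y =>
    Set.disjoint_preimage_iff e.surjective
  constructor
  · rintro ⟨h1, h2, h3⟩
    simp only [Set.forall_mem_image, tightSep_pull, separates_pull, isComp_pull, full_pull, hd,
      (preimage_surjective e).forall] at h1 h2 h3
    exact ⟨fun X hX => h1 hX, fun X hX Y hY => h2 hX hY,
      fun X hX K hK hf Y hY => h3 hX K hK hf hY⟩
  · rintro ⟨h1, h2, h3⟩
    constructor <;> simp only [Set.forall_mem_image, tightSep_pull, separates_pull, isComp_pull,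
      full_pull, hd, (preimage_surjective e).forall]
    · exact fun X hX => h1 X hX
    · exact fun X hX Y hY => h2 X hX Y hY
    · exact fun X hX K hK hf Y hY => h3 X hX K hK hf Y hY

/-- Optimality refers only to crossing numbers and keeps all minimisers, so the set of separators
commutes with bijections. -/
theorem nestSeps_pull : nestSeps (Set.image (pullPair e) '' Ps) (pullGraph e H) k =
    Set.preimage e '' nestSeps Ps H k := by
  unfold nestSeps
  rw [familyOn_pull, optimalSeps_pull, goodSeps_pull]
  ext Y
  obtain ⟨Y, rfl⟩ := preimage_surjective e Y
  rw [mem_image_preimage_iff]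
  exact and_congr_left fun _ => mem_image_preimage_iff e

/-- The label on `V` that corresponds to a label on `W`. -/
def pullNode : NodeOf W → NodeOf V
  | Sum.inl S => Sum.inl (e ⁻¹' S)
  | Sum.inr o => Sum.inr fun Y => e ⁻¹' o (e.symm ⁻¹' Y)

theorem pullNode_pullNode {Z : Type u} (f : W ≃ Z) (x : NodeOf Z) :
    pullNode e (pullNode f x) = pullNode (e.trans f) x := by
  cases x <;> rfl

theorem pullNode_refl (x : NodeOf V) : pullNode (Equiv.refl V) x = x := by
  cases x <;> rfl

/-- The bijection between the labels on `W` and on `V`. -/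
def nodeEquiv : NodeOf W ≃ NodeOf V where
  toFun := pullNode e
  invFun := pullNode e.symm
  left_inv x := by rw [pullNode_pullNode, Equiv.symm_trans_self, pullNode_refl]
  right_inv x := by rw [pullNode_pullNode, Equiv.self_trans_symm, pullNode_refl]

theorem pullNode_centre : pullNode e (centre W) = centre V := rfl

/-- `R` corresponds to `R'`. -/
structure RawDec.Pulls (R : RawDec V) (R' : RawDec W) : Prop where
  isNode : ∀ x, R.IsNode (pullNode e x) ↔ R'.IsNode x
  adj : ∀ x y, R.adj (pullNode e x) (pullNode e y) ↔ R'.adj x y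
  part : ∀ x, R.part (pullNode e x) = e ⁻¹' R'.part x

variable {e} in
theorem RawDec.Pulls.torso {R : RawDec V} {R' : RawDec W} (h : R.Pulls e R') (x : NodeOf W) :
    R.torso (pullGraph e H) (pullNode e x) = pullGraph e (R'.torso H x) := by
  refine SimpleGraph.Subgraph.ext (h.part x) ?_
  funext a b
  refine propext (and_congr e.injective.ne_iff.symm ?_)
  simp only [h.part, (nodeEquiv e).surjective.exists]
  refine and_congr_right fun _ => and_congr_right fun _ => or_congr_right ?_
  refine exists_congr fun y => and_congr (h.isNode y) (and_congr (h.adj x y) ?_)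
  rw [show R.part (nodeEquiv e y) = e ⁻¹' R'.part y from h.part y]
  rfl

theorem rubbish_pull :
    rubbish (pullGraph e H) (Set.preimage e '' N) = Set.preimage e '' rubbish H N := by
  ext K
  obtain ⟨K, rfl⟩ := preimage_surjective e K
  rw [mem_image_preimage_iff]
  simp only [rubbish, Set.mem_ofPred_eq, Set.exists_mem_image, isComp_pull, full_pull]

theorem nbhd_pull : nbhd (pullGraph e H) (e ⁻¹' C) = e ⁻¹' nbhd H C := by
  ext x
  simp only [nbhd, Set.mem_ofPred_eq, Set.mem_preimage, e.surjective.exists]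
  rfl

theorem pulls_starDec :
    (starDec (pullGraph e H) (Set.preimage e '' N)).Pulls e (starDec H N) := by
  constructor
  · rintro (K | o)
    · change e ⁻¹' K ∈ rubbish _ _ ↔ K ∈ rubbish _ _
      rw [rubbish_pull, mem_image_preimage_iff]
    · exact ⟨fun h => Sum.inr.inj ((nodeEquiv e).injective
        (congrArg Sum.inr h : pullNode e (Sum.inr o) = pullNode e (centre W))),
        fun h => Sum.inr.inj (congrArg (fun o => pullNode e (Sum.inr o)) h)⟩
  · rintro (K | o) (L | o') <;> exact Iff.rfl
  · rintro (K | o)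
    · change e ⁻¹' K ∪ nbhd _ _ = e ⁻¹' (K ∪ nbhd _ _)
      rw [nbhd_pull, Set.preimage_union]
    · change e ⁻¹' H.verts \ ⋃₀ rubbish _ _ = e ⁻¹' (H.verts \ ⋃₀ rubbish _ _)
      rw [rubbish_pull, Set.preimage_sdiff, Set.preimage_sUnion, Set.sUnion_image]

theorem core_pull : core (pullGraph e H) (Set.preimage e '' N) = pullGraph e (core H N) :=
  (pulls_starDec e).torso (centre W)

theorem compTo_pull {Y S : Set W} :
    compTo (pullGraph e H) (e ⁻¹' Y) (e ⁻¹' S) = e ⁻¹' compTo H Y S := by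
  ext x
  simp only [compTo, Set.mem_ofPred_eq, Set.mem_preimage, e.surjective.exists, conn_pull]
  rfl

theorem pulls_blockDec :
    (blockDec (pullGraph e H) (Set.preimage e '' N)).Pulls e (blockDec H N) := by
  have hs : ∀ Y : Set W, e.symm ⁻¹' (e ⁻¹' Y) = Y := fun Y => by ext; simp
  have hinc : ∀ (X : Set W) (o : Set W → Set W), (∀ Y ∈ Set.preimage e '' N, Y ≠ e ⁻¹' X →
      e ⁻¹' o (e.symm ⁻¹' Y) = compTo (pullGraph e H) Y (e ⁻¹' X)) ↔
      ∀ Y ∈ N, Y ≠ X → o Y = compTo H Y X := by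
    intro X o
    simp only [Set.forall_mem_image, (preimage_injective e).ne_iff, compTo_pull, hs,
      (preimage_injective e).eq_iff]
  constructor
  · rintro (K | o)
    · exact mem_image_preimage_iff e
    · refine and_congr ?_ (and_congr ?_ ?_)
      · simp only [(preimage_surjective e).forall, mem_image_preimage_iff, hs,
          Set.preimage_eq_empty_iff, e.range_eq_univ, Set.disjoint_univ]
      · simp only [Set.forall_mem_image, hs, isComp_pull]
      · simp only [Set.image_nonempty, Set.exists_mem_image, hinc]
  · rintro (K | o) (L | o')
    · exact Iff.rfl
    · exact hinc K o'
    · exact hinc L o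
    · exact Iff.rfl
  · rintro (K | o)
    · rfl
    · ext v
      change (e v ∈ H.verts ∧ ∀ Z ∈ Set.preimage e '' N, v ∈ e ⁻¹' o (e.symm ⁻¹' Z) ∪ Z) ↔
        (e v ∈ H.verts ∧ ∀ Z ∈ N, e v ∈ o Z ∪ Z)
      simp only [Set.forall_mem_image, hs]
      rfl

theorem sepsAt_pull : sepsAt (Set.image (pullPair e) '' Ps) n (pullGraph e H) =
    Set.preimage e '' sepsAt Ps n H :=
  nestSeps_pull e

theorem graphAt_pull : graphAt (Set.image (pullPair e) '' Ps) n (pullGraph e H) =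
    pullGraph e (graphAt Ps n H) := by
  unfold graphAt
  rw [sepsAt_pull, core_pull]
  split_ifs <;> rfl

theorem pulls_decAt :
    (decAt (Set.image (pullPair e) '' Ps) n (pullGraph e H)).Pulls e (decAt Ps n H) := by
  unfold decAt
  rw [sepsAt_pull, core_pull]
  split_ifs
  · exact pulls_blockDec e
  · exact pulls_starDec e

theorem stepAt_pull (x : NodeOf W) :
    stepAt (Set.image (pullPair e) '' Ps) n (pullGraph e H) (pullNode e x) =
      pullGraph e (stepAt Ps n H x) := by
  unfold stepAt
  rw [graphAt_pull, (pulls_decAt e).torso]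
  split_ifs <;> rfl

theorem isStep_pull (x : NodeOf W) :
    IsStep (Set.image (pullPair e) '' Ps) n (pullGraph e H) (pullNode e x) ↔ IsStep Ps n H x := by
  refine and_congr ((pulls_decAt e).isNode x) (imp_congr_right fun _ => ?_)
  rw [← pullNode_centre e]
  exact (nodeEquiv e).injective.eq_iff (a := x) (b := centre W)

theorem base_pull (r : ℕ) (l : List (NodeOf W)) :
    base (pullGraph e H) (Set.image (pullPair e) '' Ps) r (l.map (pullNode e)) =
      pullGraph e (base H Ps r l) := by
  induction l with
  | nil => rfl
  | cons x l ih => rw [List.map_cons, base, base, ih, List.length_map, stepAt_pull]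

theorem isBranch_pull (r : ℕ) (l : List (NodeOf W)) :
    IsBranch (pullGraph e H) (Set.image (pullPair e) '' Ps) r (l.map (pullNode e)) ↔
      IsBranch H Ps r l := by
  induction l with
  | nil => exact Iff.rfl
  | cons x l ih => rw [List.map_cons, IsBranch, IsBranch, ih, base_pull, List.length_map, isStep_pull]

end Transport

/-! ### The isomorphisms induced on the constructed trees. -/

section Canonical

variable {V W : Type u} {G : SimpleGraph V} {G' : SimpleGraph W} {Ps : Set (Set (Set V × Set V))}
  {Ps' : Set (Set (Set W × Set W))}

theorem whole_eq_pullGraph (φ : G ≃g G') : whole G' = pullGraph φ.toEquiv.symm (whole G) :=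
  SimpleGraph.Subgraph.ext rfl (by
    funext a b
    exact propext (φ.symm.map_rel_iff (a := a) (b := b)).symm)

theorem rootLevel_eq (φ : G ≃g G') : rootLevel G' = rootLevel G := by
  unfold rootLevel
  have : G'.Preconnected ↔ G.Preconnected := φ.preconnected_iff.symm
  by_cases h : G.Preconnected
  · rw [if_pos h, if_pos (this.2 h)]
  · rw [if_neg h, if_neg fun h' => h (this.1 h')]

theorem profiles_eq (e : V ≃ W)
    (h : Ps' = (fun P => (fun p : Set V × Set V => (e '' p.1, e '' p.2)) '' P) '' Ps) :
    Ps' = Set.image (pullPair e.symm) '' Ps := by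
  rw [h]
  have : (fun p : Set V × Set V => (e '' p.1, e '' p.2)) = pullPair e.symm := by
    funext p
    simp only [pullPair, Equiv.image_eq_preimage_symm]
  rw [this]

theorem base_map (φ : G ≃g G') (hPs : Ps' = Set.image (pullPair φ.toEquiv.symm) '' Ps)
    (l : List (NodeOf V)) :
    base (whole G') Ps' (rootLevel G') (l.map (pullNode φ.toEquiv.symm)) =
      pullGraph φ.toEquiv.symm (base (whole G) Ps (rootLevel G) l) := by
  rw [whole_eq_pullGraph φ, hPs, rootLevel_eq φ, base_pull]

theorem isBranch_map (φ : G ≃g G') (hPs : Ps' = Set.image (pullPair φ.toEquiv.symm) '' Ps)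
    (l : List (NodeOf V)) :
    IsBranch (whole G') Ps' (rootLevel G') (l.map (pullNode φ.toEquiv.symm)) ↔
      IsBranch (whole G) Ps (rootLevel G) l := by
  rw [whole_eq_pullGraph φ, hPs, rootLevel_eq φ, isBranch_pull]

theorem graphAt_map (φ : G ≃g G') (hPs : Ps' = Set.image (pullPair φ.toEquiv.symm) '' Ps)
    (l : List (NodeOf V)) :
    graphAt Ps' ((l.map (pullNode φ.toEquiv.symm)).length + rootLevel G')
      (base (whole G') Ps' (rootLevel G') (l.map (pullNode φ.toEquiv.symm))) =
      pullGraph φ.toEquiv.symm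
        (graphAt Ps (l.length + rootLevel G) (base (whole G) Ps (rootLevel G) l)) := by
  rw [base_map φ hPs, hPs, rootLevel_eq φ, List.length_map, graphAt_pull]

theorem pulls_map (φ : G ≃g G') (hPs : Ps' = Set.image (pullPair φ.toEquiv.symm) '' Ps)
    (l : List (NodeOf V)) :
    (decAt Ps' ((l.map (pullNode φ.toEquiv.symm)).length + rootLevel G')
      (base (whole G') Ps' (rootLevel G') (l.map (pullNode φ.toEquiv.symm)))).Pulls φ.toEquiv.symm
        (decAt Ps (l.length + rootLevel G) (base (whole G) Ps (rootLevel G) l)) := by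
  rw [base_map φ hPs, hPs, rootLevel_eq φ, List.length_map]
  exact pulls_decAt _

/-- The bijection of lists of labels. -/
def listEquiv (e : V ≃ W) : List (NodeOf V) ≃ List (NodeOf W) :=
  Equiv.listEquivOfEquiv (nodeEquiv e.symm)

theorem listEquiv_apply (e : V ≃ W) (l : List (NodeOf V)) :
    listEquiv e l = l.map (pullNode e.symm) := rfl

/-- The isomorphism between the constructions that is induced by an isomorphism of the graphs. -/
noncomputable def isoOver (φ : G ≃g G')
    (hPs : Ps' = Set.image (pullPair φ.toEquiv.symm) '' Ps) :
    TreeOfTreeDecompositions.IsoOver φ.toEquiv (decTree G Ps) (decTree G' Ps') where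
  onTree :=
    { toEquiv := Equiv.subtypeEquiv (listEquiv φ.toEquiv) fun l => (isBranch_map φ hPs l).symm
      map_rel_iff' := by
        have key : ∀ s t : List (NodeOf V), (∃ x, t.map (pullNode φ.toEquiv.symm) =
            x :: s.map (pullNode φ.toEquiv.symm)) ↔ ∃ x, t = x :: s := by
          intro s t
          rw [(nodeEquiv φ.toEquiv.symm).surjective.exists]
          refine exists_congr fun x => ?_
          rw [show nodeEquiv φ.toEquiv.symm x :: s.map (pullNode φ.toEquiv.symm) =
            listEquiv φ.toEquiv (x :: s) from rfl, ← listEquiv_apply, Equiv.apply_eq_iff_eq]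
        intro s t
        exact or_congr (key s.1 t.1) (key t.1 s.1) }
  map_root := rfl
  map_verts t := by
    rw [Equiv.image_eq_preimage_symm]
    exact congrArg SimpleGraph.Subgraph.verts (graphAt_map φ hPs t.1)
  map_adj t x y := by
    have h := congrArg (fun K : GraphIn W => K.Adj (φ x) (φ y)) (graphAt_map φ hPs t.1)
    refine Iff.trans (iff_of_eq h) ?_
    change SimpleGraph.Subgraph.Adj _ (φ.toEquiv.symm (φ.toEquiv x))
      (φ.toEquiv.symm (φ.toEquiv y)) ↔ _
    rw [Equiv.symm_apply_apply, Equiv.symm_apply_apply]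
    rfl
  onDecomp t :=
    { toEquiv := Equiv.subtypeEquiv (nodeEquiv φ.toEquiv.symm)
        fun x => ((pulls_map φ hPs t.1).isNode x).symm
      map_rel_iff' := fun {x y} => (pulls_map φ hPs t.1).adj x.1 y.1 }
  map_part t x := by
    rw [Equiv.image_eq_preimage_symm]
    exact (pulls_map φ hPs t.1).part x.1
  map_place t s h h' := by
    refine Subtype.ext ?_
    obtain ⟨x, hx⟩ := (isChild_decTree _ _ _ _).1 h
    change pullNode _ (s.1.headD (centre V)) =
      (s.1.map (pullNode φ.toEquiv.symm)).headD (centre W)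
    rw [hx]
    rfl

theorem sigma_decTree_ext {a b : Σ t : (decTree G Ps).Node, ((decTree G Ps).decomp t).Node}
    (h : a.1.1 = b.1.1) (h' : a.2.1 = b.2.1) : a = b := by
  obtain ⟨⟨l, hl⟩, x, hx⟩ := a
  obtain ⟨⟨m, hm⟩, y, hy⟩ := b
  obtain rfl : l = m := h
  obtain rfl : x = y := h'
  rfl

/-- The induced isomorphism acts by transporting labels, and transport of labels respects identities
and composition. -/
theorem isCanonical_decTree :
    IsCanonical fun X : ProfiledGraph.{u} => decTree X.graph X.profiles := by
  refine ⟨fun X Y φ => isoOver φ.toIso (profiles_eq φ.toIso.toEquiv φ.map_profiles), ?_, ?_⟩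
  · intro X φ hφ
    have he : φ.toIso.toEquiv = Equiv.refl _ := Equiv.ext hφ
    have hn : pullNode φ.toIso.toEquiv.symm = id := by
      rw [he]
      exact funext pullNode_refl
    funext a
    refine sigma_decTree_ext ?_ ?_
    · change a.1.1.map (pullNode φ.toIso.toEquiv.symm) = a.1.1
      rw [hn, List.map_id]
    · change pullNode φ.toIso.toEquiv.symm a.2.1 = a.2.1
      rw [hn, id]
  · intro X Y Z φ χ ω hω
    have he : ω.toIso.toEquiv = φ.toIso.toEquiv.trans χ.toIso.toEquiv := Equiv.ext hω
    have hn : ∀ x, pullNode ω.toIso.toEquiv.symm x =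
        pullNode χ.toIso.toEquiv.symm (pullNode φ.toIso.toEquiv.symm x) := by
      intro x
      rw [pullNode_pullNode, he]
      rfl
    funext a
    refine sigma_decTree_ext ?_ ?_
    · change a.1.1.map (pullNode ω.toIso.toEquiv.symm) =
        (a.1.1.map (pullNode φ.toIso.toEquiv.symm)).map (pullNode χ.toIso.toEquiv.symm)
      rw [List.map_map]
      exact List.map_congr_left fun x _ => hn x
    · exact hn a.2.1

end Canonical

end TreeOfTD

open TreeOfTD in
theorem theorem6p1 :
    ∃ ψ : ∀ X : ProfiledGraph.{u}, TreeOfTreeDecompositions X.graph,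
      IsCanonical ψ ∧
      ∀ (V : Type u) (G : SimpleGraph V) (Ps : Set (Set (Set V × Set V))),
        (∀ P ∈ Ps, (∃ ℓ : ℕ∞, IsProfileOfOrder (whole G) ℓ P) ∧
          IsRobust (whole G) P ∧ IsPrincipal P) →
        (∀ P ∈ Ps, ∀ P' ∈ Ps, P ≠ P' → ∃ p, IsSeparation (whole G) p ∧ Distinguishes p P P') →
        ∀ D : TreeOfTreeDecompositions G, D = ψ ⟨V, G, Ps⟩ →
          (∀ P ∈ Ps, ∀ P' ∈ Ps, P ≠ P' → D.DistinguishesEfficiently P P') ∧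
          (∀ (t : D.Node) (k : ℕ), D.level t = 2 * k → (D.decomp t).IsBalanced k) ∧
          (∀ (t : D.Node) (k : ℕ), D.level t = 2 * k →
            ∀ x : (D.decomp t).Node, ∃ s, ∃ h : IsChild D.tree D.root t s, D.place t s h = x) ∧
          (∀ (t : D.Node) (k : ℕ), D.level t = 2 * k + 1 → (D.decomp t).AdhesionLE k) ∧
          (∀ (t : D.Node) (k : ℕ), D.level t = 2 * k + 1 →
            ∀ s s', IsChild D.tree D.root t s → IsChild D.tree D.root t s' → s = s') := by
  refine ⟨fun X => decTree X.graph X.profiles, isCanonical_decTree, ?_⟩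
  rintro V G Ps hPs hd D rfl
  have hPs' : ∀ P ∈ Ps, ∃ ℓ, RPProfile (whole G) ℓ P := fun P hP => by
    obtain ⟨⟨ℓ, h⟩, hr, hp⟩ := hPs P hP
    exact ⟨ℓ, h, hr, hp⟩
  exact ⟨fun P hP P' hP' hne => distinguishesEfficiently_decTree hPs' hd hP hP' hne,
    isBalanced_decTree G Ps, exists_child_decTree G Ps, adhesionLE_decTree G Ps,
    child_unique_decTree G Ps⟩
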